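/- **Setting.** Let $F$ be a field of characteristic $0$ and let $C$ be a non-degenerate finitely semi-simple $\mathrm{Vect}$-linear semi-strict spherical $2$-category over $F$. In detail (composites of $1$-morphisms, vertical composites $\cdot$ and horizontal composites $\circ$ of $2$-morphisms are written from left to right): * *Semi-strict monoidal $2$-category:* a strict $2$-category with a strictly associative, strictly unital tensor product of objects (unit $I$), strict $2$-functors $A\otimes-$ and $-\otimes A$, and natural invertible tensorators $\otimes_{f,g}\colon (f\otimes B)(C\otimes g)\Rightarrow (A\otimes g)(f\otimes D)$ for $f\colon A\to C$, $g\colon B\to D$ (a Gray monoid). * *Duals:* involutive strict duals $A^*$, $f^*\colon B\to A$, $\alpha^*\colon g\Rightarrow f$ of objects, of $1$-morphisms $f\colon A\to B$ and of $2$-morphisms $\alpha\colon f\Rightarrow g$, with $1$-morphisms $i_A\colon I\to A\otimes A^*$, $e_A\colon A^*\otimes A\to I$, $2$-morphisms $i_f\colon 1_A\Rightarrow ff^*$, $e_f\colon f^*f\Rightarrow 1_B$ and unitary triangulators $T_A\colon(i_A\otimes A)(A\otimes e_A)\Rightarrow 1_A$, compatible with composition and tensor product and satisfying the zigzag and swallowtail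 identities. * *Pivotal and spherical:* there are unitary natural $2$-isomorphisms $\varphi_f\colon {}^{\#}f\Rightarrow f^{\#}$ (where ${}^{\#}f,f^{\#}\colon B^*\to A^*$ are the two mates of $f\colon A\to B$), compatible with composition and adjoints, such that the resulting $2$-isomorphisms $\theta^R\colon \mathrm{Tr}_R(fg)\Rightarrow \mathrm{Tr}_R(gf)$ and $\theta^L\colon \mathrm{Tr}_L(fg)\Rightarrow \mathrm{Tr}_L(gf)$ are compatible with caps and cups (consistency); and there are unitary natural $2$-isomorphisms $\mathrm{Tr}_L(f)\Rightarrow\mathrm{Tr}_R(f)$ for $f\colon A\to A$, compatible with the caps and cups of identities. Here $\mathrm{Tr}_R(f)=i_A(f\otimes A^*)e_{A^*}$, $\mathrm{Tr}_L(f)=i_{A^*}(A^*\otimes f)e_A$, $\mathrm{cap}_f=i_{i_A(f\otimes A^*)}\colon 1_I\Rightarrow \mathrm{Tr}_R(ff^*)$, $\mathrm{cup}_f=\mathrm{cap}_f^*$, and similarly on the left. * *$\mathrm{Vect}$-linear:* every $2\mathrm{Hom}(f,g)$ is a finite-dimensional $F$-vector space, all compositions and tensor products are linear in each variable, every category $\mathrm{Hom}(A,B)$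 is a $2$-vector space of finite rank (it has finite direct sums and a finite basis, i.e. a finite set of mutually orthogonal simple $1$-morphisms with endomorphism algebra $F$ of which every $1$-morphism is a finite direct sum), $\mathrm{End}(I)$ has rank one and $2\mathrm{End}(1_I)=F$. * *Finitely semi-simple:* there is a finite set $\mathcal E$ of pairwise non-equivalent nonzero objects such that for all $A,B$ composition gives an equivalence $\bigoplus_{X\in\mathcal E}\mathrm{Hom}(A,X)\otimes\mathrm{Hom}(X,B)\to\mathrm{Hom}(A,B)$. Fix $\mathcal E$, and a finite basis $\mathcal F_{A,B}$ of every $\mathrm{Hom}(A,B)$. * *Non-degenerate:* for all $f,g\colon A\to B$ the pairing $\langle\cdot,\cdot\rangle\colon 2\mathrm{Hom}(f,g)\times 2\mathrm{Hom}(g,f)\to 2\mathrm{End}(1_I)=F$, $$\langle\alpha,\beta\rangle=\mathrm{cap}_f\cdot\mathrm{Tr}_R\big((\alpha\cdot\beta)\circ 1_{f^*}\big)\cdot\mathrm{cup}_f ,$$ is non-degenerate. The quantum dimension of a $1$-morphism is $\dim_q(f)=\langle 1_f,1_f\rangle\in F$. **State spaces.** Label every edge $(ij)$, $0\le i<j\le5$,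 by an object $e_{ij}\in\mathcal E$ and every triangle $(ijk)$, $0\le i<j<k\le5$, by a $1$-morphism $f_{ijk}\in\mathcal F_{e_{ik},\,e_{jk}\otimes e_{ij}}$. For $i<j<k<l$ put $$2H(ijkl)=2\mathrm{Hom}\big(f_{ikl}(e_{kl}\otimes f_{ijk}),\ f_{ijl}(f_{jkl}\otimes e_{ij})\big),$$ and let $2H'(ijkl)$ be the space of $2$-morphisms in the opposite direction; the pairing identifies $2H(ijkl)$ with the dual space of $2H'(ijkl)$. **Partition functions.** For $i<j<k<l<m$ let $$Z(+(ijklm))\colon 2H(iklm)\otimes 2H(ijkm)\to 2H(jklm)\otimes 2H(ijlm)\otimes 2H(ijkl)$$ be the linear map such that, for all $\beta\in 2H(iklm)$, $\delta\in 2H(ijkm)$, $\alpha\in 2H'(jklm)$, $\gamma\in 2H'(ijlm)$, $\varepsilon\in 2H'(ijkl)$, pairing $Z(+(ijklm))(\beta\otimes\delta)$ factorwise with $\alpha\otimes\gamma\otimes\varepsilon$ gives $\langle\beta\delta,\alpha\gamma\varepsilon\rangle$, where $$\beta\delta=\big(\beta\circ(e_{lm}\otimes e_{kl}\otimes f_{ijk})\big)\cdot\big(f_{ikm}\circ\otimes_{f_{klm},f_{ijk}}\big)\cdot\big(\delta\circ(f_{klm}\otimes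 e_{jk}\otimes e_{ij})\big),$$ $$\alpha\gamma\varepsilon=\big(f_{ijm}\circ(\alpha\otimes e_{ij})\big)\cdot\big(\gamma\circ(e_{lm}\otimes f_{jkl}\otimes e_{ij})\big)\cdot\big(f_{ilm}\circ(e_{lm}\otimes\varepsilon)\big)$$ and a $1$-morphism stands for its identity $2$-morphism. **Lemma 5.1** ($3\rightleftharpoons3$). Fix all the labels $e_{ij}$, and all the labels $f_{ijk}$ other than $f_{135}$ and $f_{024}$. Let $P$ denote transpositions $x\otimes y\mapsto y\otimes x$. Then, as linear maps $$2H(0345)\otimes 2H(0235)\otimes 2H(0125)\to 2H(2345)\otimes 2H(1245)\otimes 2H(0145)\otimes 2H(1234)\otimes 2H(0134)\otimes 2H(0123),$$ with composites of linear maps written from left to right (the leftmost map is applied first), $$\sum_{f_{135}}\dim_q(f_{135})\,(1\otimes Z(+(01235)))(P\otimes1\otimes1)(1\otimes Z(+(01345))\otimes1)(P\otimes1\otimes1\otimes1)(Z(+(12345))\otimes1\otimes1\otimes1)(1\otimes1\otimes P\otimes1\otimes1)$$ $$=\sum_{f_{024}}\dim_q(f_{024})\,(Z(+(02345))\otimes1)(1\otimes1\otimes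 P)(1\otimes Z(+(01245))\otimes1)(1\otimes1\otimes1\otimes P)(1\otimes1\otimes1\otimes Z(+(01234))),$$ where $f_{135}$ runs over $\mathcal F_{e_{15},\,e_{35}\otimes e_{13}}$ and $f_{024}$ over $\mathcal F_{e_{04},\,e_{24}\otimes e_{02}}$. -/

import Mathlib

universe u v w

/-! ## Strict 2-categories

A strict 2-category is presented by its sets of objects, 1-morphisms and 2-morphisms with source and
target maps, so that all equations between composites are plain equations.  The compositions are
total functions, but only their values on composable arguments are ever constrained or used. -/

/-- The operations of a strict 2-category.  Composites are written in diagrammatic order. -/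
structure TwoCatData where
  /-- objects -/
  Obj : Type u
  /-- 1-morphisms -/
  Mor : Type v
  /-- 2-morphisms -/
  Cell : Type w
  /-- source and target of a 1-morphism -/
  src : Mor → Obj
  tgt : Mor → Obj
  /-- source and target of a 2-morphism -/
  dom : Cell → Mor
  cod : Cell → Mor
  /-- identity 1-morphism -/
  one : Obj → Mor
  /-- composite of 1-morphisms -/
  comp : Mor → Mor → Mor
  /-- identity 2-morphism -/
  idc : Mor → Cell
  /-- vertical composite -/
  vcomp : Cell → Cell → Cell
  /-- horizontal composite -/
  hcomp : Cell → Cell → Cell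

/-- `f ⨾ g`: first `f`, then `g`. -/
local infixr:80 " ⨾ " => TwoCatData.comp _
/-- `α ⊙ᵥ β`: vertical composite, first `α`, then `β`. -/
local infixr:70 " ⊙ᵥ " => TwoCatData.vcomp _
/-- `α ⊙ₕ β`: horizontal composite, first `α`, then `β`. -/
local infixr:75 " ⊙ₕ " => TwoCatData.hcomp _
/-- `𝕀 f`: the identity 2-morphism of the 1-morphism `f`. -/
local prefix:max "𝕀" => TwoCatData.idc _

/-- The axioms of a strict 2-category. -/
structure IsStrictTwoCategory (C : TwoCatData.{u, v, w}) : Prop where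
  src_one (A : C.Obj) : C.src (C.one A) = A
  tgt_one (A : C.Obj) : C.tgt (C.one A) = A
  src_comp (f g : C.Mor) : C.tgt f = C.src g → C.src (f ⨾ g) = C.src f
  tgt_comp (f g : C.Mor) : C.tgt f = C.src g → C.tgt (f ⨾ g) = C.tgt g
  one_comp (f : C.Mor) : C.one (C.src f) ⨾ f = f
  comp_one (f : C.Mor) : f ⨾ C.one (C.tgt f) = f
  comp_assoc (f g h : C.Mor) : C.tgt f = C.src g → C.tgt g = C.src h →
    (f ⨾ g) ⨾ h = f ⨾ (g ⨾ h)
  src_dom (α : C.Cell) : C.src (C.dom α) = C.src (C.cod α)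
  tgt_dom (α : C.Cell) : C.tgt (C.dom α) = C.tgt (C.cod α)
  dom_idc (f : C.Mor) : C.dom (𝕀 f) = f
  cod_idc (f : C.Mor) : C.cod (𝕀 f) = f
  dom_vcomp (α β : C.Cell) : C.cod α = C.dom β → C.dom (α ⊙ᵥ β) = C.dom α
  cod_vcomp (α β : C.Cell) : C.cod α = C.dom β → C.cod (α ⊙ᵥ β) = C.cod β
  idc_vcomp (α : C.Cell) : 𝕀 (C.dom α) ⊙ᵥ α = α
  vcomp_idc (α : C.Cell) : α ⊙ᵥ 𝕀 (C.cod α) = α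
  vcomp_assoc (α β γ : C.Cell) : C.cod α = C.dom β → C.cod β = C.dom γ →
    (α ⊙ᵥ β) ⊙ᵥ γ = α ⊙ᵥ (β ⊙ᵥ γ)
  dom_hcomp (α β : C.Cell) : C.tgt (C.dom α) = C.src (C.dom β) →
    C.dom (α ⊙ₕ β) = C.dom α ⨾ C.dom β
  cod_hcomp (α β : C.Cell) : C.tgt (C.dom α) = C.src (C.dom β) →
    C.cod (α ⊙ₕ β) = C.cod α ⨾ C.cod β
  one_hcomp (α : C.Cell) : 𝕀 (C.one (C.src (C.dom α))) ⊙ₕ α = α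
  hcomp_one (α : C.Cell) : α ⊙ₕ 𝕀 (C.one (C.tgt (C.dom α))) = α
  hcomp_assoc (α β γ : C.Cell) : C.tgt (C.dom α) = C.src (C.dom β) →
    C.tgt (C.dom β) = C.src (C.dom γ) → (α ⊙ₕ β) ⊙ₕ γ = α ⊙ₕ (β ⊙ₕ γ)
  idc_hcomp_idc (f g : C.Mor) : C.tgt f = C.src g → 𝕀 f ⊙ₕ 𝕀 g = 𝕀 (f ⨾ g)
  interchange (α α' β β' : C.Cell) : C.cod α = C.dom α' → C.cod β = C.dom β' →
    C.tgt (C.dom α) = C.src (C.dom β) →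
    (α ⊙ᵥ α') ⊙ₕ (β ⊙ᵥ β') = (α ⊙ₕ β) ⊙ᵥ (α' ⊙ₕ β')

/-! ## Semi-strict monoidal 2-categories -/

/-- The operations of a semi-strict monoidal 2-category: tensor products of two objects, of an
object with a 1- or 2-morphism on either side, and the tensorator. -/
structure MonoidalTwoCatData extends TwoCatData.{u, v, w} where
  /-- the identity object `I` -/
  unit : Obj
  /-- `A ⊗ B` -/
  tensor : Obj → Obj → Obj
  /-- `A ⊗ f` -/
  lTensor : Obj → Mor → Mor
  /-- `f ⊗ A` -/
  rTensor : Mor → Obj → Mor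
  /-- `A ⊗ α` -/
  lTensor₂ : Obj → Cell → Cell
  /-- `α ⊗ A` -/
  rTensor₂ : Cell → Obj → Cell
  /-- the tensorator `⊗_{f,g} : (f ⊗ B)(C ⊗ g) ⇒ (A ⊗ g)(f ⊗ D)` for `f : A → C`, `g : B → D` -/
  tensorator : Mor → Mor → Cell
  /-- the inverse of the tensorator -/
  tensoratorInv : Mor → Mor → Cell

local infixr:90 " ⊠ " => MonoidalTwoCatData.tensor _
local infixr:90 " ⊲ " => MonoidalTwoCatData.lTensor _
local infixl:90 " ⊳ " => MonoidalTwoCatData.rTensor _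
local infixr:90 " ⊲₂ " => MonoidalTwoCatData.lTensor₂ _
local infixl:90 " ⊳₂ " => MonoidalTwoCatData.rTensor₂ _
local prefix:max "τ" => MonoidalTwoCatData.tensorator _
local prefix:max "τ⁻" => MonoidalTwoCatData.tensoratorInv _

/-- The axioms of a semi-strict monoidal 2-category. -/
structure IsSemistrictMonoidal (C : MonoidalTwoCatData.{u, v, w}) : Prop
    extends IsStrictTwoCategory C.toTwoCatData where
  -- `A ⊗ -` is a strict 2-functor
  src_lTensor (A : C.Obj) (f : C.Mor) : C.src (A ⊲ f) = A ⊠ C.src f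
  tgt_lTensor (A : C.Obj) (f : C.Mor) : C.tgt (A ⊲ f) = A ⊠ C.tgt f
  lTensor_one (A B : C.Obj) : A ⊲ C.one B = C.one (A ⊠ B)
  lTensor_comp (A : C.Obj) (f g : C.Mor) : C.tgt f = C.src g →
    A ⊲ (f ⨾ g) = (A ⊲ f) ⨾ (A ⊲ g)
  dom_lTensor₂ (A : C.Obj) (α : C.Cell) : C.dom (A ⊲₂ α) = A ⊲ C.dom α
  cod_lTensor₂ (A : C.Obj) (α : C.Cell) : C.cod (A ⊲₂ α) = A ⊲ C.cod α
  lTensor₂_idc (A : C.Obj) (f : C.Mor) : A ⊲₂ 𝕀 f = 𝕀 (A ⊲ f)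
  lTensor₂_vcomp (A : C.Obj) (α β : C.Cell) : C.cod α = C.dom β →
    A ⊲₂ (α ⊙ᵥ β) = (A ⊲₂ α) ⊙ᵥ (A ⊲₂ β)
  lTensor₂_hcomp (A : C.Obj) (α β : C.Cell) : C.tgt (C.dom α) = C.src (C.dom β) →
    A ⊲₂ (α ⊙ₕ β) = (A ⊲₂ α) ⊙ₕ (A ⊲₂ β)
  -- `- ⊗ A` is a strict 2-functor
  src_rTensor (f : C.Mor) (A : C.Obj) : C.src (f ⊳ A) = C.src f ⊠ A
  tgt_rTensor (f : C.Mor) (A : C.Obj) : C.tgt (f ⊳ A) = C.tgt f ⊠ A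
  one_rTensor (A B : C.Obj) : C.one A ⊳ B = C.one (A ⊠ B)
  comp_rTensor (f g : C.Mor) (A : C.Obj) : C.tgt f = C.src g →
    (f ⨾ g) ⊳ A = (f ⊳ A) ⨾ (g ⊳ A)
  dom_rTensor₂ (α : C.Cell) (A : C.Obj) : C.dom (α ⊳₂ A) = C.dom α ⊳ A
  cod_rTensor₂ (α : C.Cell) (A : C.Obj) : C.cod (α ⊳₂ A) = C.cod α ⊳ A
  idc_rTensor₂ (f : C.Mor) (A : C.Obj) : 𝕀 f ⊳₂ A = 𝕀 (f ⊳ A)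
  vcomp_rTensor₂ (α β : C.Cell) (A : C.Obj) : C.cod α = C.dom β →
    (α ⊙ᵥ β) ⊳₂ A = (α ⊳₂ A) ⊙ᵥ (β ⊳₂ A)
  hcomp_rTensor₂ (α β : C.Cell) (A : C.Obj) : C.tgt (C.dom α) = C.src (C.dom β) →
    (α ⊙ₕ β) ⊳₂ A = (α ⊳₂ A) ⊙ₕ (β ⊳₂ A)
  -- `I` is a strict unit
  unit_tensor (A : C.Obj) : C.unit ⊠ A = A
  tensor_unit (A : C.Obj) : A ⊠ C.unit = A
  unit_lTensor (f : C.Mor) : C.unit ⊲ f = f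
  rTensor_unit (f : C.Mor) : f ⊳ C.unit = f
  unit_lTensor₂ (α : C.Cell) : C.unit ⊲₂ α = α
  rTensor₂_unit (α : C.Cell) : α ⊳₂ C.unit = α
  -- the tensor product is strictly associative
  tensor_assoc (A B D : C.Obj) : (A ⊠ B) ⊠ D = A ⊠ (B ⊠ D)
  tensor_lTensor (A B : C.Obj) (f : C.Mor) : (A ⊠ B) ⊲ f = A ⊲ (B ⊲ f)
  lTensor_rTensor (A : C.Obj) (f : C.Mor) (B : C.Obj) : (A ⊲ f) ⊳ B = A ⊲ (f ⊳ B)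
  rTensor_tensor (f : C.Mor) (A B : C.Obj) : f ⊳ (A ⊠ B) = (f ⊳ A) ⊳ B
  tensor_lTensor₂ (A B : C.Obj) (α : C.Cell) : (A ⊠ B) ⊲₂ α = A ⊲₂ (B ⊲₂ α)
  lTensor₂_rTensor₂ (A : C.Obj) (α : C.Cell) (B : C.Obj) : (A ⊲₂ α) ⊳₂ B = A ⊲₂ (α ⊳₂ B)
  rTensor₂_tensor (α : C.Cell) (A B : C.Obj) : α ⊳₂ (A ⊠ B) = (α ⊳₂ A) ⊳₂ B
  -- the tensorator is a 2-isomorphism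
  dom_tensorator (f g : C.Mor) : C.dom (τ f g) = (f ⊳ C.src g) ⨾ (C.tgt f ⊲ g)
  cod_tensorator (f g : C.Mor) : C.cod (τ f g) = (C.src f ⊲ g) ⨾ (f ⊳ C.tgt g)
  dom_tensoratorInv (f g : C.Mor) : C.dom (τ⁻ f g) = C.cod (τ f g)
  cod_tensoratorInv (f g : C.Mor) : C.cod (τ⁻ f g) = C.dom (τ f g)
  tensorator_inv (f g : C.Mor) : τ f g ⊙ᵥ τ⁻ f g = 𝕀 (C.dom (τ f g))
  inv_tensorator (f g : C.Mor) : τ⁻ f g ⊙ᵥ τ f g = 𝕀 (C.cod (τ f g))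
  -- the tensorator is natural
  tensorator_natural (α β : C.Cell) :
    ((α ⊳₂ C.src (C.dom β)) ⊙ₕ (C.tgt (C.dom α) ⊲₂ β)) ⊙ᵥ τ (C.cod α) (C.cod β) =
      τ (C.dom α) (C.dom β) ⊙ᵥ ((C.src (C.dom α) ⊲₂ β) ⊙ₕ (α ⊳₂ C.tgt (C.dom β)))
  -- the tensorator is compatible with identities and composites
  tensorator_one_left (A : C.Obj) (g : C.Mor) : τ (C.one A) g = 𝕀 (A ⊲ g)
  tensorator_one_right (f : C.Mor) (A : C.Obj) : τ f (C.one A) = 𝕀 (f ⊳ A)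
  tensorator_comp_left (f f' g : C.Mor) : C.tgt f = C.src f' →
    τ (f ⨾ f') g = (𝕀 (f ⊳ C.src g) ⊙ₕ τ f' g) ⊙ᵥ (τ f g ⊙ₕ 𝕀 (f' ⊳ C.tgt g))
  tensorator_comp_right (f g g' : C.Mor) : C.tgt g = C.src g' →
    τ f (g ⨾ g') = (τ f g ⊙ₕ 𝕀 (C.tgt f ⊲ g')) ⊙ᵥ (𝕀 (C.src f ⊲ g) ⊙ₕ τ f g')
  -- the tensorator is compatible with the tensor product
  tensorator_lTensor (A : C.Obj) (f g : C.Mor) : τ (A ⊲ f) g = A ⊲₂ τ f g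
  tensorator_middle (f : C.Mor) (A : C.Obj) (g : C.Mor) : τ (f ⊳ A) g = τ f (A ⊲ g)
  tensorator_rTensor (f g : C.Mor) (A : C.Obj) : τ f (g ⊳ A) = τ f g ⊳₂ A

/-! ## Duals -/

/-- The operations of a semi-strict monoidal 2-category with duals. -/
structure DualTwoCatData extends MonoidalTwoCatData.{u, v, w} where
  /-- the dual `A*` of an object -/
  star₀ : Obj → Obj
  /-- the dual `f*` of a 1-morphism -/
  star₁ : Mor → Mor
  /-- the dual `α*` of a 2-morphism -/
  star₂ : Cell → Cell
  /-- the unit `i_A : I → A ⊗ A*` of an object -/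
  i₀ : Obj → Mor
  /-- the counit `e_A : A* ⊗ A → I` of an object -/
  e₀ : Obj → Mor
  /-- the unit `i_f : 1_A ⇒ f f*` of a 1-morphism `f : A → B` -/
  i₁ : Mor → Cell
  /-- the counit `e_f : f* f ⇒ 1_B` of a 1-morphism `f : A → B` -/
  e₁ : Mor → Cell
  /-- the triangulator `T_A : (i_A ⊗ A)(A ⊗ e_A) ⇒ 1_A` -/
  T : Obj → Cell

namespace DualTwoCatData

variable (C : DualTwoCatData.{u, v, w})

/-- A 2-morphism is unitary if `α*` is its inverse. -/
def IsUnitary (α : C.Cell) : Prop :=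
  α ⊙ᵥ C.star₂ α = 𝕀 (C.dom α) ∧ C.star₂ α ⊙ᵥ α = 𝕀 (C.cod α)

/-- The adjoint `α† : g* ⇒ f*` of `α : f ⇒ g`. -/
def dagger (α : C.Cell) : C.Cell :=
  (𝕀 (C.star₁ (C.cod α)) ⊙ₕ C.i₁ (C.dom α)) ⊙ᵥ
  (𝕀 (C.star₁ (C.cod α)) ⊙ₕ α ⊙ₕ 𝕀 (C.star₁ (C.dom α))) ⊙ᵥ
  (C.e₁ (C.cod α) ⊙ₕ 𝕀 (C.star₁ (C.dom α)))

/-- The other adjoint `†α : g* ⇒ f*` of `α : f ⇒ g`. -/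
def daggerL (α : C.Cell) : C.Cell :=
  (C.i₁ (C.star₁ (C.dom α)) ⊙ₕ 𝕀 (C.star₁ (C.cod α))) ⊙ᵥ
  (𝕀 (C.star₁ (C.dom α)) ⊙ₕ α ⊙ₕ 𝕀 (C.star₁ (C.cod α))) ⊙ᵥ
  (𝕀 (C.star₁ (C.dom α)) ⊙ₕ C.e₁ (C.star₁ (C.cod α)))

end DualTwoCatData

/-- The axioms of a semi-strict monoidal 2-category with duals. -/
structure HasDuals (C : DualTwoCatData.{u, v, w}) : Prop
    extends IsSemistrictMonoidal C.toMonoidalTwoCatData where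
  -- sources and targets
  src_star₁ (f : C.Mor) : C.src (C.star₁ f) = C.tgt f
  tgt_star₁ (f : C.Mor) : C.tgt (C.star₁ f) = C.src f
  dom_star₂ (α : C.Cell) : C.dom (C.star₂ α) = C.cod α
  cod_star₂ (α : C.Cell) : C.cod (C.star₂ α) = C.dom α
  src_i₀ (A : C.Obj) : C.src (C.i₀ A) = C.unit
  tgt_i₀ (A : C.Obj) : C.tgt (C.i₀ A) = A ⊠ C.star₀ A
  src_e₀ (A : C.Obj) : C.src (C.e₀ A) = C.star₀ A ⊠ A
  tgt_e₀ (A : C.Obj) : C.tgt (C.e₀ A) = C.unit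
  dom_i₁ (f : C.Mor) : C.dom (C.i₁ f) = C.one (C.src f)
  cod_i₁ (f : C.Mor) : C.cod (C.i₁ f) = f ⨾ C.star₁ f
  dom_e₁ (f : C.Mor) : C.dom (C.e₁ f) = C.star₁ f ⨾ f
  cod_e₁ (f : C.Mor) : C.cod (C.e₁ f) = C.one (C.tgt f)
  dom_T (A : C.Obj) : C.dom (C.T A) = (C.i₀ A ⊳ A) ⨾ (A ⊲ C.e₀ A)
  cod_T (A : C.Obj) : C.cod (C.T A) = C.one A
  -- duality is involutive and preserves identities
  star₀_star₀ (A : C.Obj) : C.star₀ (C.star₀ A) = A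
  star₁_star₁ (f : C.Mor) : C.star₁ (C.star₁ f) = f
  star₂_star₂ (α : C.Cell) : C.star₂ (C.star₂ α) = α
  star₁_one (A : C.Obj) : C.star₁ (C.one A) = C.one A
  star₂_idc (f : C.Mor) : C.star₂ (𝕀 f) = 𝕀 f
  -- duality and composition, duality and tensor product
  star₂_vcomp (α β : C.Cell) : C.cod α = C.dom β →
    C.star₂ (α ⊙ᵥ β) = C.star₂ β ⊙ᵥ C.star₂ α
  star₂_hcomp (α β : C.Cell) : C.tgt (C.dom α) = C.src (C.dom β) →
    C.star₂ (α ⊙ₕ β) = C.star₂ α ⊙ₕ C.star₂ β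
  star₁_comp (f g : C.Mor) : C.tgt f = C.src g → C.star₁ (f ⨾ g) = C.star₁ g ⨾ C.star₁ f
  star₂_lTensor₂ (A : C.Obj) (α : C.Cell) : C.star₂ (A ⊲₂ α) = A ⊲₂ C.star₂ α
  star₁_lTensor (A : C.Obj) (f : C.Mor) : C.star₁ (A ⊲ f) = A ⊲ C.star₁ f
  star₂_rTensor₂ (α : C.Cell) (A : C.Obj) : C.star₂ (α ⊳₂ A) = C.star₂ α ⊳₂ A
  star₁_rTensor (f : C.Mor) (A : C.Obj) : C.star₁ (f ⊳ A) = C.star₁ f ⊳ A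
  star₀_tensor (A B : C.Obj) : C.star₀ (A ⊠ B) = C.star₀ B ⊠ C.star₀ A
  tensorator_unitary (f g : C.Mor) : C.IsUnitary (τ f g)
  i₀_star (A : C.Obj) : C.i₀ (C.star₀ A) = C.star₁ (C.e₀ A)
  e₀_star (A : C.Obj) : C.e₀ (C.star₀ A) = C.star₁ (C.i₀ A)
  i₁_star (f : C.Mor) : C.i₁ (C.star₁ f) = C.star₂ (C.e₁ f)
  e₁_star (f : C.Mor) : C.e₁ (C.star₁ f) = C.star₂ (C.i₁ f)
  T_unitary (A : C.Obj) : C.IsUnitary (C.T A)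
  -- units, counits and triangulators of tensor products
  i₀_tensor (A B : C.Obj) : C.i₀ (A ⊠ B) = C.i₀ A ⨾ (A ⊲ C.i₀ B ⊳ C.star₀ A)
  e₀_tensor (A B : C.Obj) : C.e₀ (A ⊠ B) = (C.star₀ B ⊲ C.e₀ A ⊳ B) ⨾ C.e₀ B
  T_tensor (A B : C.Obj) : C.T (A ⊠ B) =
    (𝕀 (C.i₀ A ⊳ (A ⊠ B)) ⊙ₕ ((A ⊲₂ τ (C.i₀ B) (C.e₀ A)) ⊳₂ B) ⊙ₕ 𝕀 ((A ⊠ B) ⊲ C.e₀ B)) ⊙ᵥ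
    ((C.T A ⊳₂ B) ⊙ₕ (A ⊲₂ C.T B))
  T_unit : C.T C.unit = 𝕀 (C.one C.unit)
  -- units and counits of 1-morphisms
  i₁_lTensor (A : C.Obj) (f : C.Mor) : C.i₁ (A ⊲ f) = A ⊲₂ C.i₁ f
  i₁_rTensor (f : C.Mor) (A : C.Obj) : C.i₁ (f ⊳ A) = C.i₁ f ⊳₂ A
  e₁_lTensor (A : C.Obj) (f : C.Mor) : C.e₁ (A ⊲ f) = A ⊲₂ C.e₁ f
  e₁_rTensor (f : C.Mor) (A : C.Obj) : C.e₁ (f ⊳ A) = C.e₁ f ⊳₂ A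
  i₁_comp (f g : C.Mor) : C.tgt f = C.src g →
    C.i₁ (f ⨾ g) = C.i₁ f ⊙ᵥ (𝕀 f ⊙ₕ C.i₁ g ⊙ₕ 𝕀 (C.star₁ f))
  e₁_comp (f g : C.Mor) : C.tgt f = C.src g →
    C.e₁ (f ⨾ g) = (𝕀 (C.star₁ g) ⊙ₕ C.e₁ f ⊙ₕ 𝕀 g) ⊙ᵥ C.e₁ g
  zigzag (f : C.Mor) : (C.i₁ f ⊙ₕ 𝕀 f) ⊙ᵥ (𝕀 f ⊙ₕ C.e₁ f) = 𝕀 f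
  zigzag_star (f : C.Mor) :
    (𝕀 (C.star₁ f) ⊙ₕ C.i₁ f) ⊙ᵥ (C.e₁ f ⊙ₕ 𝕀 (C.star₁ f)) = 𝕀 (C.star₁ f)
  dagger_star (α : C.Cell) : C.star₂ (C.dagger α) = C.dagger (C.star₂ α)
  swallowtail (A : C.Obj) :
    (𝕀 (C.i₀ A) ⊙ₕ (A ⊲₂ C.dagger (C.T (C.star₀ A)))) ⊙ᵥ
    (τ (C.i₀ A) (C.i₀ A) ⊙ₕ 𝕀 (A ⊲ C.e₀ A ⊳ C.star₀ A)) ⊙ᵥ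
    (𝕀 (C.i₀ A) ⊙ₕ (C.T A ⊳₂ C.star₀ A)) = 𝕀 (C.i₀ A)

/-- A semi-strict monoidal 2-category with duals. -/
structure DualTwoCategory extends DualTwoCatData.{u, v, w} where
  law : HasDuals toDualTwoCatData

namespace DualTwoCategory

/-! ## Pivotal and spherical structures -/

section Pivotal

variable (C : DualTwoCategory.{u, v, w})

/-- `#f : B* → A*` for `f : A → B`. -/
def sharpL (f : C.Mor) : C.Mor :=
  (C.i₀ (C.star₀ (C.src f)) ⊳ C.star₀ (C.tgt f)) ⨾
  (C.star₀ (C.src f) ⊲ f ⊳ C.star₀ (C.tgt f)) ⨾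
  (C.star₀ (C.src f) ⊲ C.e₀ (C.star₀ (C.tgt f)))

/-- `f# : B* → A*` for `f : A → B`. -/
def sharpR (f : C.Mor) : C.Mor :=
  (C.star₀ (C.tgt f) ⊲ C.i₀ (C.src f)) ⨾
  (C.star₀ (C.tgt f) ⊲ f ⊳ C.star₀ (C.src f)) ⨾
  (C.e₀ (C.tgt f) ⊳ C.star₀ (C.src f))

/-- `#α : #f ⇒ #g` for `α : f ⇒ g`. -/
def sharpL₂ (α : C.Cell) : C.Cell :=
  let A := C.src (C.dom α)
  let B := C.tgt (C.dom α)
  𝕀 (C.i₀ (C.star₀ A) ⊳ C.star₀ B) ⊙ₕ (C.star₀ A ⊲₂ α ⊳₂ C.star₀ B) ⊙ₕ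
    𝕀 (C.star₀ A ⊲ C.e₀ (C.star₀ B))

/-- `α# : f# ⇒ g#` for `α : f ⇒ g`. -/
def sharpR₂ (α : C.Cell) : C.Cell :=
  let A := C.src (C.dom α)
  let B := C.tgt (C.dom α)
  𝕀 (C.star₀ B ⊲ C.i₀ A) ⊙ₕ (C.star₀ B ⊲₂ α ⊳₂ C.star₀ A) ⊙ₕ 𝕀 (C.e₀ B ⊳ C.star₀ A)

/-- The canonical 2-isomorphism `#(fg) ⇒ #g #f` for `f : X → Y`, `g : Y → Z`. -/
def sharpLComp (f g : C.Mor) : C.Cell :=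
  let X := C.src f
  let Y := C.tgt f
  let Z := C.tgt g
  let X' := C.star₀ X
  let Y' := C.star₀ Y
  let Z' := C.star₀ Z
  (𝕀 ((C.i₀ X' ⊳ Z') ⨾ (X' ⊲ f ⊳ Z')) ⊙ₕ (X' ⊲₂ C.dagger (C.T Y) ⊳₂ Z') ⊙ₕ
    𝕀 ((X' ⊲ g ⊳ Z') ⨾ (X' ⊲ C.e₀ Z'))) ⊙ᵥ
  (𝕀 ((C.i₀ X' ⊳ Z') ⨾ (X' ⊲ f ⊳ Z') ⨾ (X' ⊲ Y ⊲ C.i₀ Y' ⊳ Z')) ⊙ₕ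
    (X' ⊲₂ τ (C.e₀ Y') g ⊳₂ Z') ⊙ₕ 𝕀 (X' ⊲ C.e₀ Z')) ⊙ᵥ
  (τ (C.i₀ X' ⨾ (X' ⊲ f)) ((C.i₀ Y' ⊳ Z') ⨾ (Y' ⊲ g ⊳ Z')) ⊙ₕ
    𝕀 ((X' ⊲ C.e₀ Y' ⊳ (Z ⊠ Z')) ⨾ (X' ⊲ C.e₀ Z'))) ⊙ᵥ
  (𝕀 ((C.i₀ Y' ⊳ Z') ⨾ (Y' ⊲ g ⊳ Z')) ⊙ₕ τ (C.sharpL f) (C.e₀ Z'))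

/-- The canonical 2-isomorphism `(fg)# ⇒ g# f#` for `f : X → Y`, `g : Y → Z`. -/
def sharpRComp (f g : C.Mor) : C.Cell :=
  let X := C.src f
  let Y := C.tgt f
  let Z := C.tgt g
  let X' := C.star₀ X
  let Y' := C.star₀ Y
  let Z' := C.star₀ Z
  (𝕀 ((Z' ⊲ C.i₀ X) ⨾ (Z' ⊲ f ⊳ X')) ⊙ₕ (Z' ⊲₂ C.star₂ (C.T Y) ⊳₂ X') ⊙ₕ
    𝕀 ((Z' ⊲ g ⊳ X') ⨾ (C.e₀ Z ⊳ X'))) ⊙ᵥ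
  (𝕀 ((Z' ⊲ C.i₀ X) ⨾ (Z' ⊲ f ⊳ X') ⨾ (Z' ⊲ C.i₀ Y ⊳ (Y ⊠ X'))) ⊙ₕ
    (Z' ⊲₂ τ⁻ g (C.e₀ Y) ⊳₂ X') ⊙ₕ 𝕀 (C.e₀ Z ⊳ X')) ⊙ᵥ
  (τ⁻ ((Z' ⊲ C.i₀ Y) ⨾ (Z' ⊲ g ⊳ Y')) (C.i₀ X ⨾ (f ⊳ X')) ⊙ₕ
    𝕀 ((Z' ⊲ Z ⊲ C.e₀ Y ⊳ X') ⨾ (C.e₀ Z ⊳ X'))) ⊙ᵥ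
  (𝕀 ((Z' ⊲ C.i₀ Y) ⨾ (Z' ⊲ g ⊳ Y')) ⊙ₕ τ⁻ (C.e₀ Z) (C.sharpR f))

/-- The left trace functor `End(A) → End(I)` on 1-morphisms. -/
def trL (f : C.Mor) : C.Mor :=
  C.i₀ (C.star₀ (C.src f)) ⨾ (C.star₀ (C.src f) ⊲ f) ⨾ C.e₀ (C.src f)

/-- The right trace functor `End(A) → End(I)` on 1-morphisms. -/
def trR (f : C.Mor) : C.Mor :=
  C.i₀ (C.src f) ⨾ (f ⊳ C.star₀ (C.src f)) ⨾ C.e₀ (C.star₀ (C.src f))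

/-- The left trace functor on 2-morphisms. -/
def trL₂ (α : C.Cell) : C.Cell :=
  let A := C.src (C.dom α)
  𝕀 (C.i₀ (C.star₀ A)) ⊙ₕ (C.star₀ A ⊲₂ α) ⊙ₕ 𝕀 (C.e₀ A)

/-- The right trace functor on 2-morphisms. -/
def trR₂ (α : C.Cell) : C.Cell :=
  let A := C.src (C.dom α)
  𝕀 (C.i₀ A) ⊙ₕ (α ⊳₂ C.star₀ A) ⊙ₕ 𝕀 (C.e₀ (C.star₀ A))

/-- `cap : 1_I ⇒ Tr_R(f f*)`. -/
def capR (f : C.Mor) : C.Cell := C.i₁ (C.i₀ (C.src f) ⨾ (f ⊳ C.star₀ (C.src f)))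

/-- `cup : Tr_R(f f*) ⇒ 1_I`. -/
def cupR (f : C.Mor) : C.Cell := C.star₂ (C.capR f)

/-- `cap : 1_I ⇒ Tr_L(f f*)`. -/
def capL (f : C.Mor) : C.Cell :=
  C.i₁ (C.i₀ (C.star₀ (C.src f)) ⨾ (C.star₀ (C.src f) ⊲ f))

/-- `cup : Tr_L(f f*) ⇒ 1_I`. -/
def cupL (f : C.Mor) : C.Cell := C.star₂ (C.capL f)

/-- A pivotal structure: unitary 2-morphisms `φ_f : #f ⇒ f#`, subject to four conditions. -/
structure PivotalStructure where
  φ : C.Mor → C.Cell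
  dom_φ (f : C.Mor) : C.dom (φ f) = C.sharpL f
  cod_φ (f : C.Mor) : C.cod (φ f) = C.sharpR f
  unitary (f : C.Mor) : C.IsUnitary (φ f)
  natural (α : C.Cell) : C.sharpL₂ α ⊙ᵥ φ (C.cod α) = φ (C.dom α) ⊙ᵥ C.sharpR₂ α
  dagger_φ (f : C.Mor) : C.dagger (φ f) = φ (C.star₁ f)
  φ_comp (f g : C.Mor) : C.tgt f = C.src g →
    φ (f ⨾ g) ⊙ᵥ C.sharpRComp f g = C.sharpLComp f g ⊙ᵥ (φ g ⊙ₕ φ f)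
  sharpL_dagger (α : C.Cell) : C.sharpL₂ (C.dagger α) = C.daggerL (C.sharpR₂ α)
  dagger_sharpL (α : C.Cell) : C.dagger (C.sharpL₂ α) = C.sharpR₂ (C.daggerL α)

variable {C}

/-- The 2-isomorphism `θ^R_{f,g} : Tr_R(fg) ⇒ Tr_R(gf)` for `f : A → B`, `g : B → A`. -/
def PivotalStructure.thetaR (P : C.PivotalStructure) (f g : C.Mor) : C.Cell :=
  let A := C.src f
  let B := C.tgt f
  let A' := C.star₀ A
  let B' := C.star₀ B
  (𝕀 (C.i₀ A ⨾ (f ⊳ A')) ⊙ₕ (C.dagger (C.T B) ⊳₂ A') ⊙ₕ 𝕀 ((g ⊳ A') ⨾ C.e₀ A')) ⊙ᵥ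
  (𝕀 (C.i₀ A ⨾ (f ⊳ A') ⨾ (B ⊲ C.i₀ B' ⊳ A')) ⊙ₕ τ (C.e₀ B') ((g ⊳ A') ⨾ C.e₀ A')) ⊙ᵥ
  (𝕀 (C.i₀ A ⨾ (f ⊳ A')) ⊙ₕ (B ⊲₂ P.φ g) ⊙ₕ 𝕀 (C.e₀ B')) ⊙ᵥ
  (τ (C.i₀ A ⨾ (f ⊳ A')) (C.i₀ B ⨾ (g ⊳ B')) ⊙ₕ 𝕀 ((B ⊲ C.e₀ A ⊳ B') ⨾ C.e₀ B')) ⊙ᵥ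
  (𝕀 (C.i₀ B ⨾ (g ⊳ B') ⨾ (C.i₀ A ⊳ (A ⊠ B'))) ⊙ₕ (τ f (C.e₀ A) ⊳₂ B') ⊙ₕ 𝕀 (C.e₀ B')) ⊙ᵥ
  (𝕀 (C.i₀ B ⨾ (g ⊳ B')) ⊙ₕ (C.T A ⊳₂ B') ⊙ₕ 𝕀 ((f ⊳ B') ⨾ C.e₀ B'))

/-- The 2-isomorphism `θ^L_{f,g} : Tr_L(fg) ⇒ Tr_L(gf)` for `f : A → B`, `g : B → A`; it is the
mirror image of `θ^R`, obtained by reversing the order of all tensor products. -/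
def PivotalStructure.thetaL (P : C.PivotalStructure) (f g : C.Mor) : C.Cell :=
  let A := C.src f
  let B := C.tgt f
  let A' := C.star₀ A
  let B' := C.star₀ B
  (𝕀 (C.i₀ A' ⨾ (A' ⊲ f)) ⊙ₕ (A' ⊲₂ C.star₂ (C.T B)) ⊙ₕ 𝕀 ((A' ⊲ g) ⨾ C.e₀ A)) ⊙ᵥ
  (𝕀 (C.i₀ A' ⨾ (A' ⊲ f) ⨾ (A' ⊲ C.i₀ B ⊳ B)) ⊙ₕ τ⁻ ((A' ⊲ g) ⨾ C.e₀ A) (C.e₀ B)) ⊙ᵥ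
  (𝕀 (C.i₀ A' ⨾ (A' ⊲ f)) ⊙ₕ (C.star₂ (P.φ g) ⊳₂ B) ⊙ₕ 𝕀 (C.e₀ B)) ⊙ᵥ
  (τ⁻ (C.i₀ B' ⨾ (B' ⊲ g)) (C.i₀ A' ⨾ (A' ⊲ f)) ⊙ₕ 𝕀 ((B' ⊲ C.e₀ A' ⊳ B) ⨾ C.e₀ B)) ⊙ᵥ
  (𝕀 (C.i₀ B' ⨾ (B' ⊲ g) ⨾ ((B' ⊠ A) ⊲ C.i₀ A')) ⊙ₕ (B' ⊲₂ τ⁻ (C.e₀ A') f) ⊙ₕ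
    𝕀 (C.e₀ B)) ⊙ᵥ
  (𝕀 (C.i₀ B' ⨾ (B' ⊲ g)) ⊙ₕ (B' ⊲₂ C.star₂ (C.dagger (C.T A))) ⊙ₕ 𝕀 ((B' ⊲ f) ⨾ C.e₀ B))

/-- Consistency of a pivotal structure: caps and cups are compatible with `θ`. -/
structure PivotalStructure.IsConsistent (P : C.PivotalStructure) : Prop where
  capR (f : C.Mor) : C.capR f ⊙ᵥ P.thetaR f (C.star₁ f) = C.capR (C.star₁ f)
  cupR (f : C.Mor) : P.thetaR f (C.star₁ f) ⊙ᵥ C.cupR (C.star₁ f) = C.cupR f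
  capL (f : C.Mor) : C.capL f ⊙ᵥ P.thetaL f (C.star₁ f) = C.capL (C.star₁ f)
  cupL (f : C.Mor) : P.thetaL f (C.star₁ f) ⊙ᵥ C.cupL (C.star₁ f) = C.cupL f

variable (C) in
/-- A spherical structure: unitary natural 2-morphisms `σ_f : Tr_L(f) ⇒ Tr_R(f)` for
`f : A → A`, compatible with the caps and cups of identities.  A semi-strict spherical 2-category is
a semi-strict monoidal 2-category with duals, a consistent pivotal structure and a spherical
structure. -/
structure SphericalStructure where
  σ : C.Mor → C.Cell
  dom_σ (f : C.Mor) : C.src f = C.tgt f → C.dom (σ f) = C.trL f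
  cod_σ (f : C.Mor) : C.src f = C.tgt f → C.cod (σ f) = C.trR f
  unitary (f : C.Mor) : C.src f = C.tgt f → C.IsUnitary (σ f)
  natural (α : C.Cell) : C.src (C.dom α) = C.tgt (C.dom α) →
    σ (C.dom α) ⊙ᵥ C.trR₂ α = C.trL₂ α ⊙ᵥ σ (C.cod α)
  cap_σ (A : C.Obj) : C.capL (C.one A) ⊙ᵥ σ (C.one A) = C.capR (C.one A)
  σ_cup (A : C.Obj) : σ (C.one A) ⊙ᵥ C.cupR (C.one A) = C.cupL (C.one A)

end Pivotal

end DualTwoCategory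

/-! ## Hom-categories -/

/-- `Hom(A, B)`: the 1-morphisms `A → B`. -/
def TwoCatData.Hom (C : TwoCatData.{u, v, w}) (A B : C.Obj) : Type v :=
  {f : C.Mor // C.src f = A ∧ C.tgt f = B}

/-- `2Hom(f, g)`: the 2-morphisms `f ⇒ g`, for parallel 1-morphisms `f` and `g`. -/
def TwoCatData.Hom₂ (C : TwoCatData.{u, v, w}) {A B : C.Obj} (f g : C.Hom A B) : Type w :=
  {α : C.Cell // C.dom α = f.1 ∧ C.cod α = g.1}

namespace DualTwoCategory

variable {C : DualTwoCategory.{u, v, w}} {A B D : C.Obj}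

/-- The identity 1-morphism, as an element of `Hom(A, A)`. -/
def homOne (A : C.Obj) : C.Hom A A := ⟨C.one A, C.law.src_one A, C.law.tgt_one A⟩

theorem composable (f : C.Hom A B) (g : C.Hom B D) : C.tgt f.1 = C.src g.1 :=
  f.2.2.trans g.2.1.symm

/-- The composite of `f : A → B` and `g : B → D`. -/
def homComp (f : C.Hom A B) (g : C.Hom B D) : C.Hom A D :=
  ⟨f.1 ⨾ g.1, (C.law.src_comp _ _ (composable f g)).trans f.2.1,
    (C.law.tgt_comp _ _ (composable f g)).trans g.2.2⟩

/-- `X ⊗ f`. -/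
def homL (X : C.Obj) (f : C.Hom A B) : C.Hom (X ⊠ A) (X ⊠ B) :=
  ⟨X ⊲ f.1, (C.law.src_lTensor X f.1).trans (by rw [f.2.1]),
    (C.law.tgt_lTensor X f.1).trans (by rw [f.2.2])⟩

/-- `f ⊗ X`. -/
def homR (f : C.Hom A B) (X : C.Obj) : C.Hom (A ⊠ X) (B ⊠ X) :=
  ⟨f.1 ⊳ X, (C.law.src_rTensor f.1 X).trans (by rw [f.2.1]),
    (C.law.tgt_rTensor f.1 X).trans (by rw [f.2.2])⟩

/-- The dual of a 1-morphism. -/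
def homStar (f : C.Hom A B) : C.Hom B A :=
  ⟨C.star₁ f.1, (C.law.src_star₁ f.1).trans f.2.2, (C.law.tgt_star₁ f.1).trans f.2.1⟩

/-- The unit `i_A : I → A ⊗ A*`. -/
def homUnit (A : C.Obj) : C.Hom C.unit (A ⊠ C.star₀ A) :=
  ⟨C.i₀ A, C.law.src_i₀ A, C.law.tgt_i₀ A⟩

/-- The counit `e_{A*} : A ⊗ A* → I`. -/
def homCounit (A : C.Obj) : C.Hom (A ⊠ C.star₀ A) C.unit :=
  ⟨C.e₀ (C.star₀ A), by rw [C.law.src_e₀, C.law.star₀_star₀], C.law.tgt_e₀ _⟩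

/-- The right trace `i_A (f ⊗ A*) e_{A*}` of a 1-morphism `f : A → A`. -/
def homTrR (f : C.Hom A A) : C.Hom C.unit C.unit :=
  homComp (homUnit A) (homComp (homR f (C.star₀ A)) (homCounit A))

/-- The identity 2-morphism, as an element of `2Hom(f, f)`. -/
def idHom₂ (f : C.Hom A B) : C.Hom₂ f f := ⟨𝕀 f.1, C.law.dom_idc f.1, C.law.cod_idc f.1⟩

/-- Vertical composition `2Hom(f, g) × 2Hom(g, h) → 2Hom(f, h)`. -/
def vHom₂ {f g h : C.Hom A B} (α : C.Hom₂ f g) (β : C.Hom₂ g h) : C.Hom₂ f h :=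
  have e : C.cod α.1 = C.dom β.1 := α.2.2.trans β.2.1.symm
  ⟨α.1 ⊙ᵥ β.1, (C.law.dom_vcomp _ _ e).trans α.2.1, (C.law.cod_vcomp _ _ e).trans β.2.2⟩

/-- Horizontal composition `2Hom(f, f') × 2Hom(g, g') → 2Hom(fg, f'g')`. -/
def hHom₂ {f f' : C.Hom A B} {g g' : C.Hom B D} (α : C.Hom₂ f f') (β : C.Hom₂ g g') :
    C.Hom₂ (homComp f g) (homComp f' g') :=
  have e : C.tgt (C.dom α.1) = C.src (C.dom β.1) := by
    rw [α.2.1, β.2.1]; exact composable f g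
  ⟨α.1 ⊙ₕ β.1, by rw [C.law.dom_hcomp _ _ e, α.2.1, β.2.1]; rfl,
    by rw [C.law.cod_hcomp _ _ e, α.2.2, β.2.2]; rfl⟩

/-- `α ↦ X ⊗ α`. -/
def lHom₂ (X : C.Obj) {f g : C.Hom A B} (α : C.Hom₂ f g) : C.Hom₂ (homL X f) (homL X g) :=
  ⟨X ⊲₂ α.1, by rw [C.law.dom_lTensor₂, α.2.1]; rfl, by rw [C.law.cod_lTensor₂, α.2.2]; rfl⟩

/-- `α ↦ α ⊗ X`. -/
def rHom₂ {f g : C.Hom A B} (α : C.Hom₂ f g) (X : C.Obj) : C.Hom₂ (homR f X) (homR g X) :=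
  ⟨α.1 ⊳₂ X, by rw [C.law.dom_rTensor₂, α.2.1]; rfl, by rw [C.law.cod_rTensor₂, α.2.2]; rfl⟩

/-- Two objects are equivalent if there are 1-morphisms `f : A → B` and `g : B → A` with `fg` and
`gf` isomorphic to identities. -/
def Equivalent (A B : C.Obj) : Prop :=
  ∃ (f : C.Hom A B) (g : C.Hom B A)
    (α : C.Hom₂ (homComp f g) (homOne A)) (α' : C.Hom₂ (homOne A) (homComp f g))
    (β : C.Hom₂ (homComp g f) (homOne B)) (β' : C.Hom₂ (homOne B) (homComp g f)),
    vHom₂ α α' = idHom₂ _ ∧ vHom₂ α' α = idHom₂ _ ∧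
    vHom₂ β β' = idHom₂ _ ∧ vHom₂ β' β = idHom₂ _

/-! ## Linear structure -/

/-- All the sets `2Hom(f, g)` are abelian groups. -/
class Additive (C : DualTwoCategory.{u, v, w}) where
  addCommGroup {A B : C.Obj} (f g : C.Hom A B) : AddCommGroup (C.Hom₂ f g)

instance [Additive C] (f g : C.Hom A B) : AddCommGroup (C.Hom₂ f g) :=
  Additive.addCommGroup f g

/-- All the sets `2Hom(f, g)` are finite-dimensional vector spaces over `F`, and all compositions and
tensor products of 2-morphisms are linear in each variable. -/
class FLinear (F : Type*) [Field F] (C : DualTwoCategory.{u, v, w}) [Additive C] where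
  module {A B : C.Obj} (f g : C.Hom A B) : Module F (C.Hom₂ f g)
  finite {A B : C.Obj} (f g : C.Hom A B) : Module.Finite F (C.Hom₂ f g)
  add_v {A B : C.Obj} {f g h : C.Hom A B} (α α' : C.Hom₂ f g) (β : C.Hom₂ g h) :
    vHom₂ (α + α') β = vHom₂ α β + vHom₂ α' β
  v_add {A B : C.Obj} {f g h : C.Hom A B} (α : C.Hom₂ f g) (β β' : C.Hom₂ g h) :
    vHom₂ α (β + β') = vHom₂ α β + vHom₂ α β'
  smul_v {A B : C.Obj} {f g h : C.Hom A B} (r : F) (α : C.Hom₂ f g) (β : C.Hom₂ g h) :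
    vHom₂ (r • α) β = r • vHom₂ α β
  v_smul {A B : C.Obj} {f g h : C.Hom A B} (r : F) (α : C.Hom₂ f g) (β : C.Hom₂ g h) :
    vHom₂ α (r • β) = r • vHom₂ α β
  add_h {A B D : C.Obj} {f f' : C.Hom A B} {g g' : C.Hom B D} (α α' : C.Hom₂ f f')
    (β : C.Hom₂ g g') : hHom₂ (α + α') β = hHom₂ α β + hHom₂ α' β
  h_add {A B D : C.Obj} {f f' : C.Hom A B} {g g' : C.Hom B D} (α : C.Hom₂ f f')
    (β β' : C.Hom₂ g g') : hHom₂ α (β + β') = hHom₂ α β + hHom₂ α β'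
  smul_h {A B D : C.Obj} {f f' : C.Hom A B} {g g' : C.Hom B D} (r : F) (α : C.Hom₂ f f')
    (β : C.Hom₂ g g') : hHom₂ (r • α) β = r • hHom₂ α β
  h_smul {A B D : C.Obj} {f f' : C.Hom A B} {g g' : C.Hom B D} (r : F) (α : C.Hom₂ f f')
    (β : C.Hom₂ g g') : hHom₂ α (r • β) = r • hHom₂ α β
  lHom₂_add (X : C.Obj) {A B : C.Obj} {f g : C.Hom A B} (α α' : C.Hom₂ f g) :
    lHom₂ X (α + α') = lHom₂ X α + lHom₂ X α'
  lHom₂_smul (X : C.Obj) {A B : C.Obj} {f g : C.Hom A B} (r : F) (α : C.Hom₂ f g) :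
    lHom₂ X (r • α) = r • lHom₂ X α
  rHom₂_add (X : C.Obj) {A B : C.Obj} {f g : C.Hom A B} (α α' : C.Hom₂ f g) :
    rHom₂ (α + α') X = rHom₂ α X + rHom₂ α' X
  rHom₂_smul (X : C.Obj) {A B : C.Obj} {f g : C.Hom A B} (r : F) (α : C.Hom₂ f g) :
    rHom₂ (r • α) X = r • rHom₂ α X

instance {F : Type*} [Field F] [Additive C] [FLinear F C] (f g : C.Hom A B) :
    Module F (C.Hom₂ f g) := FLinear.module f g

instance {F : Type*} [Field F] [Additive C] [FLinear F C] (f g : C.Hom A B) :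
    Module.Finite F (C.Hom₂ f g) := FLinear.finite f g

section Semisimple

variable (F : Type*) [Field F] [Additive C] [FLinear F C]

/-- `g` is a direct sum of the finite family `h` in the category `Hom(A, B)`. -/
def IsDirectSum {n : ℕ} (g : C.Hom A B) (h : Fin n → C.Hom A B) : Prop :=
  ∃ (incl : ∀ k, C.Hom₂ (h k) g) (proj : ∀ k, C.Hom₂ g (h k)),
    (∀ k, vHom₂ (incl k) (proj k) = idHom₂ (h k)) ∧
    (∀ k l, k ≠ l → vHom₂ (incl k) (proj l) = 0) ∧
    ∑ k, vHom₂ (proj k) (incl k) = idHom₂ g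

/-- `𝓑` is a basis of `Hom(A, B)`: its members are simple, with endomorphism algebra `F`, there are
no nonzero 2-morphisms between distinct members, and every 1-morphism `A → B` is a finite direct sum
of members. -/
structure IsBasis (𝓑 : Finset (C.Hom A B)) : Prop where
  simple : ∀ b ∈ 𝓑, Function.Bijective fun r : F => r • idHom₂ b
  orthogonal : ∀ b ∈ 𝓑, ∀ b' ∈ 𝓑, b ≠ b' → ∀ α : C.Hom₂ b b', α = 0
  generates : ∀ g : C.Hom A B, ∃ (n : ℕ) (h : Fin n → C.Hom A B),
    (∀ k, h k ∈ 𝓑) ∧ IsDirectSum g h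

/-- `Hom(A, B)` is a 2-vector space of finite rank, that is, an `F`-linear category equivalent to a
finite power of the category of finite-dimensional vector spaces: it has finite direct sums
(including the empty one) and a finite basis. -/
structure IsTwoVectorSpace (A B : C.Obj) : Prop where
  directSums : ∀ (n : ℕ) (h : Fin n → C.Hom A B), ∃ g, IsDirectSum g h
  exists_basis : ∃ 𝓑 : Finset (C.Hom A B), IsBasis F 𝓑

/-- An object is simple if `End(A)` has rank one. -/
def IsSimple (A : C.Obj) : Prop := ∃ b : C.Hom A A, IsBasis F {b}

end Semisimple

variable (F : Type*) [Field F] (C : DualTwoCategory.{u, v, w}) [Additive C]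

/-- `C` is `Vect`-linear: in addition to the linearity of composition and tensor product, every
`Hom(A, B)` is a 2-vector space of finite rank.  Moreover `End(I)` is equivalent to `Vect`, and
`2End(1_I)` is the field `F`. -/
class VectLinear extends FLinear F C where
  twoVectorSpace (A B : C.Obj) : IsTwoVectorSpace F A B
  unit_simple : IsSimple F C.unit
  unit_bijective : Function.Bijective fun r : F => r • idHom₂ (homOne C.unit)

section Linear

variable {F C} [FLinear F C] {A B D : C.Obj}

variable (F) in
/-- Horizontal composition as a bilinear map. -/
def hₗ {f f' : C.Hom A B} {g g' : C.Hom B D} :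
    C.Hom₂ f f' →ₗ[F] C.Hom₂ g g' →ₗ[F] C.Hom₂ (homComp f g) (homComp f' g') :=
  LinearMap.mk₂ F hHom₂ (FLinear.add_h F) FLinear.smul_h (FLinear.h_add F) FLinear.h_smul

variable (F) in
/-- Vertical composition as a bilinear map. -/
def vₗ {f g h : C.Hom A B} : C.Hom₂ f g →ₗ[F] C.Hom₂ g h →ₗ[F] C.Hom₂ f h :=
  LinearMap.mk₂ F vHom₂ (FLinear.add_v F) FLinear.smul_v (FLinear.v_add F) FLinear.v_smul

variable (F) in
/-- `α ↦ X ⊗ α` as a linear map. -/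
def lₗ (X : C.Obj) {f g : C.Hom A B} : C.Hom₂ f g →ₗ[F] C.Hom₂ (homL X f) (homL X g) where
  toFun α := lHom₂ X α
  map_add' := FLinear.lHom₂_add F X
  map_smul' := FLinear.lHom₂_smul X

variable (F) in
/-- `α ↦ α ⊗ X` as a linear map. -/
def rₗ (X : C.Obj) {f g : C.Hom A B} : C.Hom₂ f g →ₗ[F] C.Hom₂ (homR f X) (homR g X) where
  toFun α := rHom₂ α X
  map_add' := FLinear.rHom₂_add F X
  map_smul' := FLinear.rHom₂_smul X

variable (F) in
/-- The identity map `2Hom(f, g) → 2Hom(f', g')` when `f` and `f'`, and `g` and `g'`, are equal as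
1-morphisms (their given sources and targets may be different expressions for the same objects). -/
def recast {A' B' : C.Obj} {f g : C.Hom A B} {f' g' : C.Hom A' B'} (hf : f.1 = f'.1)
    (hg : g.1 = g'.1) : C.Hom₂ f g →ₗ[F] C.Hom₂ f' g' where
  toFun α := ⟨α.1, α.2.1.trans hf, α.2.2.trans hg⟩
  map_add' := by
    obtain ⟨f, rfl, rfl⟩ := f
    obtain ⟨f', rfl, rfl⟩ := f'
    obtain rfl : f = f' := hf
    obtain ⟨g, h₁, h₂⟩ := g
    obtain ⟨g', h₁', h₂'⟩ := g'
    obtain rfl : g = g' := hg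
    intro α β
    rfl
  map_smul' := by
    obtain ⟨f, rfl, rfl⟩ := f
    obtain ⟨f', rfl, rfl⟩ := f'
    obtain rfl : f = f' := hf
    obtain ⟨g, h₁, h₂⟩ := g
    obtain ⟨g', h₁', h₂'⟩ := g'
    obtain rfl : g = g' := hg
    intro r α
    rfl

end Linear

section

variable {C} [FLinear F C]

/-- `C` is finitely semi-simple with respect to the finite set `𝓔` of pairwise non-equivalent
nonzero objects: for all `A`, `B` composition is an equivalence from the direct sum over `X ∈ 𝓔` of
`Hom(A, X) ⊗ Hom(X, B)` to `Hom(A, B)`.  In that direct sum the space of morphisms from `f ⊗ g` to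
`f' ⊗ g'` is `2Hom(f, f') ⊗ 2Hom(g, g')` if they belong to the same `X` and zero otherwise, and every
object is a finite direct sum of objects `f ⊗ g`. -/
structure IsFinitelySemisimple (𝓔 : Finset C.Obj) : Prop where
  nonzero : ∀ X ∈ 𝓔, ∃ f : C.Hom X X, idHom₂ f ≠ 0
  inequivalent : ∀ X ∈ 𝓔, ∀ Y ∈ 𝓔, X ≠ Y → ¬ Equivalent X Y
  fully_faithful : ∀ X ∈ 𝓔, ∀ (A B : C.Obj) (f f' : C.Hom A X) (g g' : C.Hom X B),
    Function.Bijective (TensorProduct.lift (hₗ F (f := f) (f' := f') (g := g) (g' := g')))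
  orthogonal : ∀ X ∈ 𝓔, ∀ Y ∈ 𝓔, X ≠ Y → ∀ (A B : C.Obj) (f : C.Hom A X) (g : C.Hom X B)
    (f' : C.Hom A Y) (g' : C.Hom Y B) (α : C.Hom₂ (homComp f g) (homComp f' g')), α = 0
  essentially_surjective : ∀ (A B : C.Obj) (h : C.Hom A B), ∃ (n : ℕ) (X : Fin n → C.Obj)
    (f : ∀ k, C.Hom A (X k)) (g : ∀ k, C.Hom (X k) B),
    (∀ k, X k ∈ 𝓔) ∧ IsDirectSum h fun k => homComp (f k) (g k)

end

/-! ## The pairing and quantum dimensions -/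

section Pairing

/-- The 2-morphism `cap : 1_I ⇒ Tr_R(f f*)`. -/
def homCap {C : DualTwoCategory.{u, v, w}} {A B : C.Obj} (f : C.Hom A B) :
    C.Hom₂ (homOne C.unit) (homTrR (homComp f (homStar f))) :=
  ⟨C.capR f.1, by
    obtain ⟨f, rfl, rfl⟩ := f
    have h : C.tgt (C.i₀ (C.src f)) = C.src (f ⊳ C.star₀ (C.src f)) := by
      rw [C.law.tgt_i₀, C.law.src_rTensor]
    have h' : C.tgt f = C.src (C.star₁ f) := (C.law.src_star₁ f).symm
    have h₁ : C.tgt (f ⊳ C.star₀ (C.src f)) = C.src (C.star₁ f ⊳ C.star₀ (C.src f)) := by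
      rw [C.law.tgt_rTensor, C.law.src_rTensor, h']
    have h₂ : C.tgt (C.star₁ f ⊳ C.star₀ (C.src f)) = C.src (C.star₁ (C.i₀ (C.src f))) := by
      rw [C.law.tgt_rTensor, C.law.src_star₁, C.law.tgt_star₁, C.law.tgt_i₀]
    constructor
    · rw [capR, C.law.dom_i₁, C.law.src_comp _ _ h, C.law.src_i₀]
      rfl
    · rw [capR, C.law.cod_i₁, C.law.star₁_comp _ _ h, C.law.star₁_rTensor,
        C.law.comp_assoc _ _ _ h ((h₁.trans (C.law.src_comp _ _ h₂).symm)),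
        ← C.law.comp_assoc _ _ _ h₁ h₂, ← C.law.comp_rTensor _ _ _ h', ← C.law.e₀_star]
      rfl⟩

/-- The 2-morphism `cup : Tr_R(f f*) ⇒ 1_I`, the dual of the cap. -/
def homCup {C : DualTwoCategory.{u, v, w}} {A B : C.Obj} (f : C.Hom A B) :
    C.Hom₂ (homTrR (homComp f (homStar f))) (homOne C.unit) :=
  ⟨C.cupR f.1, (C.law.dom_star₂ _).trans (homCap f).2.2,
    (C.law.cod_star₂ _).trans (homCap f).2.1⟩

variable {C} [VectLinear F C] {A B : C.Obj}

/-- The identification of `2End(1_I)` with `F`. -/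
noncomputable def scalar : C.Hom₂ (homOne C.unit) (homOne C.unit) ≃ₗ[F] F :=
  (LinearEquiv.ofBijective (LinearMap.toSpanSingleton F _ (idHom₂ (homOne C.unit)))
    VectLinear.unit_bijective).symm

/-- The right trace functor on 2-morphisms, `α ↦ 1_{i_A} ∘ (α ⊗ A*) ∘ 1_{e_{A*}}`. -/
def trRₗ {f g : C.Hom A A} : C.Hom₂ f g →ₗ[F] C.Hom₂ (homTrR f) (homTrR g) :=
  (hₗ F (idHom₂ (homUnit A))) ∘ₗ
    ((hₗ F).flip (idHom₂ (homCounit A))) ∘ₗ rₗ F (C.star₀ A)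

/-- The trace `2End(f) → F`, `α ↦ cap_f · Tr_R(α ∘ 1_{f*}) · cup_f`. -/
noncomputable def traceₗ (f : C.Hom A B) : C.Hom₂ f f →ₗ[F] F :=
  (scalar F).toLinearMap ∘ₗ (vₗ F (homCap f)) ∘ₗ ((vₗ F).flip (homCup f)) ∘ₗ trRₗ F ∘ₗ
    ((hₗ F).flip (idHom₂ (homStar f)))

/-- The pairing `⟨α, β⟩ = cap_f · Tr_R((α · β) ∘ 1_{f*}) · cup_f` of `α : f ⇒ g` and `β : g ⇒ f`. -/
noncomputable def pairing (f g : C.Hom A B) : C.Hom₂ f g →ₗ[F] C.Hom₂ g f →ₗ[F] F :=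
  (vₗ F).compr₂ (traceₗ F f)

/-- The pairing, written out in terms of 2-morphisms. -/
theorem pairing_apply {f g : C.Hom A B} (α : C.Hom₂ f g) (β : C.Hom₂ g f) :
    ((scalar F).symm (pairing F f g α β)).1 =
      C.capR f.1 ⊙ᵥ
        (𝕀 (C.i₀ A) ⊙ₕ (((α.1 ⊙ᵥ β.1) ⊙ₕ 𝕀 (C.star₁ f.1)) ⊳₂ C.star₀ A) ⊙ₕ
          𝕀 (C.e₀ (C.star₀ A))) ⊙ᵥ C.cupR f.1 :=
  congrArg Subtype.val ((scalar F).symm_apply_apply _)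

/-- The quantum dimension of a 1-morphism. -/
noncomputable def qdim (f : C.Hom A B) : F := pairing F f f (idHom₂ f) (idHom₂ f)

variable (C) in
/-- `C` is non-degenerate if all the pairings are non-degenerate. -/
class NonDegenerate : Prop where
  nondegenerate {A B : C.Obj} (f g : C.Hom A B) : (pairing F f g).Nondegenerate

variable [NonDegenerate F C]

instance isPerfPair_pairing (f g : C.Hom A B) : (pairing F f g).IsPerfPair :=
  LinearMap.IsPerfPair.of_injective
    (LinearMap.ker_eq_bot.1 (LinearMap.separatingLeft_iff_ker_eq_bot.1
      (NonDegenerate.nondegenerate f g).1))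
    (LinearMap.ker_eq_bot.1 (LinearMap.separatingRight_iff_flip_ker_eq_bot.1
      (NonDegenerate.nondegenerate f g).2))

/-- The identification of `2Hom(f, g)` with the dual space of `2Hom(g, f)`. -/
noncomputable def toDual (f g : C.Hom A B) : C.Hom₂ f g ≃ₗ[F] Module.Dual F (C.Hom₂ g f) :=
  (pairing F f g).toPerfPair

end Pairing

/-! ## Labelled simplices -/

section Simplex

open scoped TensorProduct

section Paths

variable {C : DualTwoCategory.{u, v, w}}

/-- A 1-morphism `A → B` regarded as a 1-morphism `A → B'` when `B = B'`. -/
def castTgt {A B B' : C.Obj} (h : B = B') (f : C.Hom A B) : C.Hom A B' :=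
  ⟨f.1, f.2.1, f.2.2.trans h⟩

theorem homComp_assoc {A B D E : C.Obj} (f : C.Hom A B) (g : C.Hom B D) (h : C.Hom D E) :
    (f.1 ⨾ g.1) ⨾ h.1 = f.1 ⨾ (g.1 ⨾ h.1) :=
  C.law.comp_assoc _ _ _ (composable f g) (composable g h)

theorem homL_homComp {A B D : C.Obj} (X : C.Obj) (f : C.Hom A B) (g : C.Hom B D) :
    X ⊲ (f.1 ⨾ g.1) = (X ⊲ f.1) ⨾ (X ⊲ g.1) :=
  C.law.lTensor_comp _ _ _ (composable f g)

theorem homR_homComp {A B D : C.Obj} (f : C.Hom A B) (g : C.Hom B D) (X : C.Obj) :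
    (f.1 ⨾ g.1) ⊳ X = (f.1 ⊳ X) ⨾ (g.1 ⊳ X) :=
  C.law.comp_rTensor _ _ _ (composable f g)

/-- The tensorator of `f : A → A'` and `g : B → B'`. -/
def homTau {A A' B B' : C.Obj} (f : C.Hom A A') (g : C.Hom B B') :
    C.Hom₂ (homComp (homR f B) (homL A' g)) (homComp (homL A g) (homR f B')) :=
  ⟨τ f.1 g.1, by rw [C.law.dom_tensorator, f.2.2, g.2.1]; rfl,
    by rw [C.law.cod_tensorator, f.2.1, g.2.2]; rfl⟩

variable {e_ij e_jk e_kl e_lm e_ik e_jl e_km e_il e_jm e_im : C.Obj}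

/-- `f_{(ijk)l} = f_{ikl} (e_{kl} ⊗ f_{ijk})`. -/
def leftPath (f_ijk : C.Hom e_ik (e_jk ⊠ e_ij)) (f_ikl : C.Hom e_il (e_kl ⊠ e_ik)) :
    C.Hom e_il (e_kl ⊠ e_jk ⊠ e_ij) :=
  homComp f_ikl (homL e_kl f_ijk)

/-- `f_{i(jkl)} = f_{ijl} (f_{jkl} ⊗ e_{ij})`. -/
def rightPath (f_ijl : C.Hom e_il (e_jl ⊠ e_ij)) (f_jkl : C.Hom e_jl (e_kl ⊠ e_jk)) :
    C.Hom e_il (e_kl ⊠ e_jk ⊠ e_ij) :=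
  castTgt (C.law.tensor_assoc _ _ _) (homComp f_ijl (homR f_jkl e_ij))

/-- `f_{((ijk)l)m} = f_{ilm} (e_{lm} ⊗ f_{ikl}) (e_{lm} ⊗ e_{kl} ⊗ f_{ijk})`. -/
def leftPath₄ (f_ijk : C.Hom e_ik (e_jk ⊠ e_ij)) (f_ikl : C.Hom e_il (e_kl ⊠ e_ik))
    (f_ilm : C.Hom e_im (e_lm ⊠ e_il)) : C.Hom e_im (e_lm ⊠ e_kl ⊠ e_jk ⊠ e_ij) :=
  homComp f_ilm (homComp (homL e_lm f_ikl) (homL e_lm (homL e_kl f_ijk)))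

/-- `f_{i(j(klm))} = f_{ijm} (f_{jkm} ⊗ e_{ij}) (f_{klm} ⊗ e_{jk} ⊗ e_{ij})`. -/
def rightPath₄ (f_ijm : C.Hom e_im (e_jm ⊠ e_ij)) (f_jkm : C.Hom e_jm (e_km ⊠ e_jk))
    (f_klm : C.Hom e_km (e_lm ⊠ e_kl)) : C.Hom e_im (e_lm ⊠ e_kl ⊠ e_jk ⊠ e_ij) :=
  homComp f_ijm (homComp (castTgt (C.law.tensor_assoc _ _ _) (homR f_jkm e_ij))
    (castTgt (C.law.tensor_assoc _ _ _) (homR f_klm (e_jk ⊠ e_ij))))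

/-- `f_{ikm} (f_{klm} ⊗ e_{ik}) (e_{lm} ⊗ e_{kl} ⊗ f_{ijk})`. -/
def midPath₁ (f_ijk : C.Hom e_ik (e_jk ⊠ e_ij)) (f_ikm : C.Hom e_im (e_km ⊠ e_ik))
    (f_klm : C.Hom e_km (e_lm ⊠ e_kl)) : C.Hom e_im (e_lm ⊠ e_kl ⊠ e_jk ⊠ e_ij) :=
  castTgt (C.law.tensor_assoc _ _ _)
    (homComp f_ikm (homComp (homR f_klm e_ik) (homL (e_lm ⊠ e_kl) f_ijk)))

/-- `f_{ikm} (e_{km} ⊗ f_{ijk}) (f_{klm} ⊗ e_{jk} ⊗ e_{ij})`. -/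
def midPath₂ (f_ijk : C.Hom e_ik (e_jk ⊠ e_ij)) (f_ikm : C.Hom e_im (e_km ⊠ e_ik))
    (f_klm : C.Hom e_km (e_lm ⊠ e_kl)) : C.Hom e_im (e_lm ⊠ e_kl ⊠ e_jk ⊠ e_ij) :=
  castTgt (C.law.tensor_assoc _ _ _)
    (homComp f_ikm (homComp (homL e_km f_ijk) (homR f_klm (e_jk ⊠ e_ij))))

/-- `f_{ijm} (f_{jlm} ⊗ e_{ij}) (e_{lm} ⊗ f_{jkl} ⊗ e_{ij})`. -/
def midPath₃ (f_ijm : C.Hom e_im (e_jm ⊠ e_ij)) (f_jlm : C.Hom e_jm (e_lm ⊠ e_jl))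
    (f_jkl : C.Hom e_jl (e_kl ⊠ e_jk)) : C.Hom e_im (e_lm ⊠ e_kl ⊠ e_jk ⊠ e_ij) :=
  homComp f_ijm (homComp (castTgt (C.law.tensor_assoc _ _ _) (homR f_jlm e_ij))
    (homL e_lm (castTgt (C.law.tensor_assoc _ _ _) (homR f_jkl e_ij))))

/-- `f_{ilm} (e_{lm} ⊗ f_{ijl}) (e_{lm} ⊗ f_{jkl} ⊗ e_{ij})`. -/
def midPath₄ (f_ilm : C.Hom e_im (e_lm ⊠ e_il)) (f_ijl : C.Hom e_il (e_jl ⊠ e_ij))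
    (f_jkl : C.Hom e_jl (e_kl ⊠ e_jk)) : C.Hom e_im (e_lm ⊠ e_kl ⊠ e_jk ⊠ e_ij) :=
  homComp f_ilm (homComp (homL e_lm f_ijl)
    (homL e_lm (castTgt (C.law.tensor_assoc _ _ _) (homR f_jkl e_ij))))

/-- The state space `2H(ijkl) = 2Hom(f_{(ijk)l}, f_{i(jkl)})` of a labelled tetrahedron. -/
abbrev H₂ (f_ijk : C.Hom e_ik (e_jk ⊠ e_ij)) (f_ijl : C.Hom e_il (e_jl ⊠ e_ij))
    (f_ikl : C.Hom e_il (e_kl ⊠ e_ik)) (f_jkl : C.Hom e_jl (e_kl ⊠ e_jk)) : Type w :=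
  C.Hom₂ (leftPath f_ijk f_ikl) (rightPath f_ijl f_jkl)

/-- The opposite space `2Hom(f_{i(jkl)}, f_{(ijk)l})`, which the pairing identifies with the dual of
`2H(ijkl)`. -/
abbrev H₂' (f_ijk : C.Hom e_ik (e_jk ⊠ e_ij)) (f_ijl : C.Hom e_il (e_jl ⊠ e_ij))
    (f_ikl : C.Hom e_il (e_kl ⊠ e_ik)) (f_jkl : C.Hom e_jl (e_kl ⊠ e_jk)) : Type w :=
  C.Hom₂ (rightPath f_ijl f_jkl) (leftPath f_ijk f_ikl)

end Paths

variable {C} [VectLinear F C]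
variable {e_ij e_jk e_kl e_lm e_ik e_jl e_km e_il e_jm e_im : C.Obj}
variable (f_ijk : C.Hom e_ik (e_jk ⊠ e_ij)) (f_ijl : C.Hom e_il (e_jl ⊠ e_ij))
  (f_ijm : C.Hom e_im (e_jm ⊠ e_ij)) (f_ikl : C.Hom e_il (e_kl ⊠ e_ik))
  (f_ikm : C.Hom e_im (e_km ⊠ e_ik)) (f_ilm : C.Hom e_im (e_lm ⊠ e_il))
  (f_jkl : C.Hom e_jl (e_kl ⊠ e_jk)) (f_jkm : C.Hom e_jm (e_km ⊠ e_jk))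
  (f_jlm : C.Hom e_jm (e_lm ⊠ e_jl)) (f_klm : C.Hom e_km (e_lm ⊠ e_kl))

/-- The linear map `β ⊗ δ ↦ βδ`, where `βδ` is the composite
`(β ∘ (e_{lm} ⊗ e_{kl} ⊗ f_{ijk})) · (f_{ikm} ∘ ⊗_{f_{klm}, f_{ijk}}) ·
(δ ∘ (f_{klm} ⊗ e_{jk} ⊗ e_{ij}))`. -/
noncomputable def glueSource :
    H₂ f_ikl f_ikm f_ilm f_klm ⊗[F] H₂ f_ijk f_ijm f_ikm f_jkm →ₗ[F]
      C.Hom₂ (leftPath₄ f_ijk f_ikl f_ilm) (rightPath₄ f_ijm f_jkm f_klm) :=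
  TensorProduct.lift <| (vₗ F).compl₁₂
    (recast F (f' := leftPath₄ f_ijk f_ikl f_ilm) (g' := midPath₁ f_ijk f_ikm f_klm)
        (homComp_assoc f_ilm (homL e_lm f_ikl) (homL e_lm (homL e_kl f_ijk)))
        (by
          refine (congrArg (fun x => C.comp _ x) (C.law.tensor_lTensor _ _ _).symm).trans ?_
          exact homComp_assoc f_ikm (homR f_klm e_ik) (homL (e_lm ⊠ e_kl) f_ijk)) ∘ₗ
      (hₗ F).flip (idHom₂ (homL e_lm (homL e_kl f_ijk))))
    (vₗ F (recast F (f' := midPath₁ f_ijk f_ikm f_klm) (g' := midPath₂ f_ijk f_ikm f_klm) rfl rfl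
        (hHom₂ (idHom₂ f_ikm) (homTau f_klm f_ijk))) ∘ₗ
      recast F (f' := midPath₂ f_ijk f_ikm f_klm) (g' := rightPath₄ f_ijm f_jkm f_klm)
        (homComp_assoc f_ikm (homL e_km f_ijk) (homR f_klm (e_jk ⊠ e_ij)))
        (homComp_assoc f_ijm (castTgt (C.law.tensor_assoc _ _ _) (homR f_jkm e_ij))
          (homR f_klm (e_jk ⊠ e_ij))) ∘ₗ
      (hₗ F).flip (idHom₂ (homR f_klm (e_jk ⊠ e_ij))))

/-- The linear map `α ⊗ γ ⊗ ε ↦ αγε`, where `αγε` is the composite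
`(f_{ijm} ∘ (α ⊗ e_{ij})) · (γ ∘ (e_{lm} ⊗ f_{jkl} ⊗ e_{ij})) · (f_{ilm} ∘ (e_{lm} ⊗ ε))`. -/
noncomputable def glueTarget :
    H₂' f_jkl f_jkm f_jlm f_klm ⊗[F] (H₂' f_ijl f_ijm f_ilm f_jlm ⊗[F]
      H₂' f_ijk f_ijl f_ikl f_jkl) →ₗ[F]
      C.Hom₂ (rightPath₄ f_ijm f_jkm f_klm) (leftPath₄ f_ijk f_ikl f_ilm) :=
  TensorProduct.lift <| (vₗ F).compl₁₂
    (recast F (f' := rightPath₄ f_ijm f_jkm f_klm) (g' := midPath₃ f_ijm f_jlm f_jkl)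
        (congrArg (fun x => C.comp _ x) <| by
          refine (homR_homComp f_jkm (homR f_klm e_jk) e_ij).trans ?_
          exact congrArg (fun x => C.comp _ x) (C.law.rTensor_tensor _ _ _).symm)
        (congrArg (fun x => C.comp _ x) <| by
          refine (homR_homComp f_jlm (homL e_lm f_jkl) e_ij).trans ?_
          exact congrArg (fun x => C.comp _ x) (C.law.lTensor_rTensor _ _ _)) ∘ₗ
      hₗ F (idHom₂ f_ijm) ∘ₗ rₗ F e_ij)
    (TensorProduct.lift <| (vₗ F).compl₁₂
      (recast F (f' := midPath₃ f_ijm f_jlm f_jkl) (g' := midPath₄ f_ilm f_ijl f_jkl)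
          (homComp_assoc f_ijm (castTgt (C.law.tensor_assoc _ _ _) (homR f_jlm e_ij))
            (homL e_lm (homR f_jkl e_ij)))
          (homComp_assoc f_ilm (homL e_lm f_ijl) (homL e_lm (homR f_jkl e_ij))) ∘ₗ
        (hₗ F).flip (idHom₂ (homL e_lm (homR f_jkl e_ij))))
      (recast F (f' := midPath₄ f_ilm f_ijl f_jkl) (g' := leftPath₄ f_ijk f_ikl f_ilm)
          (congrArg (fun x => C.comp _ x) (homL_homComp e_lm f_ijl (homR f_jkl e_ij)))
          (congrArg (fun x => C.comp _ x) (homL_homComp e_lm f_ikl (homL e_kl f_ijk))) ∘ₗ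
        hₗ F (idHom₂ f_ilm) ∘ₗ lₗ F e_lm))

theorem glueSource_tmul (β : H₂ f_ikl f_ikm f_ilm f_klm) (δ : H₂ f_ijk f_ijm f_ikm f_jkm) :
    (glueSource F f_ijk f_ijm f_ikl f_ikm f_ilm f_jkm f_klm (β ⊗ₜ δ)).1 =
      (β.1 ⊙ₕ 𝕀 (e_lm ⊲ e_kl ⊲ f_ijk.1)) ⊙ᵥ (𝕀 f_ikm.1 ⊙ₕ τ f_klm.1 f_ijk.1) ⊙ᵥ
        (δ.1 ⊙ₕ 𝕀 (f_klm.1 ⊳ (e_jk ⊠ e_ij))) :=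
  rfl

theorem glueTarget_tmul (α : H₂' f_jkl f_jkm f_jlm f_klm) (γ : H₂' f_ijl f_ijm f_ilm f_jlm)
    (ε : H₂' f_ijk f_ijl f_ikl f_jkl) :
    (glueTarget F f_ijk f_ijl f_ijm f_ikl f_ilm f_jkl f_jkm f_jlm f_klm (α ⊗ₜ (γ ⊗ₜ ε))).1 =
      (𝕀 f_ijm.1 ⊙ₕ (α.1 ⊳₂ e_ij)) ⊙ᵥ (γ.1 ⊙ₕ 𝕀 (e_lm ⊲ f_jkl.1 ⊳ e_ij)) ⊙ᵥ
        (𝕀 f_ilm.1 ⊙ₕ (e_lm ⊲₂ ε.1)) :=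
  rfl

variable [NonDegenerate F C]

/-- The identification of `2H(jklm) ⊗ 2H(ijlm) ⊗ 2H(ijkl)` with the dual space of the tensor product
of the opposite spaces, by means of the pairings. -/
noncomputable def targetDual :
    H₂ f_jkl f_jkm f_jlm f_klm ⊗[F] (H₂ f_ijl f_ijm f_ilm f_jlm ⊗[F]
      H₂ f_ijk f_ijl f_ikl f_jkl) ≃ₗ[F]
    Module.Dual F (H₂' f_jkl f_jkm f_jlm f_klm ⊗[F] (H₂' f_ijl f_ijm f_ilm f_jlm ⊗[F]
      H₂' f_ijk f_ijl f_ikl f_jkl)) :=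
  TensorProduct.congr (toDual F _ _)
      (TensorProduct.congr (toDual F _ _) (toDual F _ _) ≪≫ₗ
        TensorProduct.dualDistribEquiv F _ _) ≪≫ₗ
    TensorProduct.dualDistribEquiv F _ _

/-- The partition function `Z(+(ijklm))` of a labelled 4-simplex: the linear map
`2H(iklm) ⊗ 2H(ijkm) → 2H(jklm) ⊗ 2H(ijlm) ⊗ 2H(ijkl)` that corresponds to the form
`α ⊗ β ⊗ γ ⊗ δ ⊗ ε ↦ ⟨βδ, αγε⟩`. -/
noncomputable def Zpos :
    H₂ f_ikl f_ikm f_ilm f_klm ⊗[F] H₂ f_ijk f_ijm f_ikm f_jkm →ₗ[F]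
      H₂ f_jkl f_jkm f_jlm f_klm ⊗[F] (H₂ f_ijl f_ijm f_ilm f_jlm ⊗[F]
        H₂ f_ijk f_ijl f_ikl f_jkl) :=
  (targetDual F f_ijk f_ijl f_ijm f_ikl f_ilm f_jkl f_jkm f_jlm f_klm).symm.toLinearMap ∘ₗ
    (pairing F (leftPath₄ f_ijk f_ikl f_ilm) (rightPath₄ f_ijm f_jkm f_klm)).compl₁₂
      (glueSource F f_ijk f_ijm f_ikl f_ikm f_ilm f_jkm f_klm)
      (glueTarget F f_ijk f_ijl f_ijm f_ikl f_ilm f_jkl f_jkm f_jlm f_klm)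

theorem targetDual_tmul (α₁ : H₂ f_jkl f_jkm f_jlm f_klm) (γ₁ : H₂ f_ijl f_ijm f_ilm f_jlm)
    (ε₁ : H₂ f_ijk f_ijl f_ikl f_jkl) (α : H₂' f_jkl f_jkm f_jlm f_klm)
    (γ : H₂' f_ijl f_ijm f_ilm f_jlm) (ε : H₂' f_ijk f_ijl f_ikl f_jkl) :
    targetDual F f_ijk f_ijl f_ijm f_ikl f_ilm f_jkl f_jkm f_jlm f_klm (α₁ ⊗ₜ (γ₁ ⊗ₜ ε₁))
        (α ⊗ₜ (γ ⊗ₜ ε)) =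
      pairing F _ _ α₁ α * (pairing F _ _ γ₁ γ * pairing F _ _ ε₁ ε) := by
  simp [targetDual, toDual, TensorProduct.dualDistribEquiv]

theorem targetDual_Zpos (β : H₂ f_ikl f_ikm f_ilm f_klm) (δ : H₂ f_ijk f_ijm f_ikm f_jkm)
    (α : H₂' f_jkl f_jkm f_jlm f_klm) (γ : H₂' f_ijl f_ijm f_ilm f_jlm)
    (ε : H₂' f_ijk f_ijl f_ikl f_jkl) :
    targetDual F f_ijk f_ijl f_ijm f_ikl f_ilm f_jkl f_jkm f_jlm f_klm
        (Zpos F f_ijk f_ijl f_ijm f_ikl f_ikm f_ilm f_jkl f_jkm f_jlm f_klm (β ⊗ₜ δ))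
        (α ⊗ₜ (γ ⊗ₜ ε)) =
      pairing F _ _ (glueSource F f_ijk f_ijm f_ikl f_ikm f_ilm f_jkm f_klm (β ⊗ₜ δ))
        (glueTarget F f_ijk f_ijl f_ijm f_ikl f_ilm f_jkl f_jkm f_jlm f_klm (α ⊗ₜ (γ ⊗ₜ ε))) := by
  simp [Zpos]

end Simplex

section TensorMaps

open scoped TensorProduct

variable {F}

/-- `L ⊗ 1_R` for a linear map `L` from a product of two spaces to a product of three. -/
noncomputable def tensorRight {V₁ V₂ W₁ W₂ W₃ : Type*} (R : Type*)
    [AddCommGroup V₁] [AddCommGroup V₂] [AddCommGroup W₁] [AddCommGroup W₂] [AddCommGroup W₃]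
    [AddCommGroup R] [Module F V₁] [Module F V₂] [Module F W₁] [Module F W₂] [Module F W₃]
    [Module F R] (L : V₁ ⊗[F] V₂ →ₗ[F] W₁ ⊗[F] (W₂ ⊗[F] W₃)) :
    V₁ ⊗[F] (V₂ ⊗[F] R) →ₗ[F] W₁ ⊗[F] (W₂ ⊗[F] (W₃ ⊗[F] R)) :=
  (TensorProduct.assoc F W₂ W₃ R).toLinearMap.lTensor W₁ ∘ₗ
    (TensorProduct.assoc F W₁ (W₂ ⊗[F] W₃) R).toLinearMap ∘ₗ
    L.rTensor R ∘ₗ (TensorProduct.assoc F V₁ V₂ R).symm.toLinearMap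

/-- The transposition `P ⊗ 1_R`. -/
noncomputable def swapHead (V W R : Type*) [AddCommGroup V] [AddCommGroup W] [AddCommGroup R]
    [Module F V] [Module F W] [Module F R] : V ⊗[F] (W ⊗[F] R) →ₗ[F] W ⊗[F] (V ⊗[F] R) :=
  (TensorProduct.leftComm F V W R).toLinearMap

/-- The transposition `P`. -/
noncomputable def swapLast (V W : Type*) [AddCommGroup V] [AddCommGroup W]
    [Module F V] [Module F W] : V ⊗[F] W →ₗ[F] W ⊗[F] V :=
  (TensorProduct.comm F V W).toLinearMap

end TensorMaps

end DualTwoCategory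

/-! Both sides are maps into a tensor product of six spaces `H₂`, each of which the pairing puts in
duality with the opposite space `H₂'`. It therefore suffices to evaluate on a pure tensor a ⊗ b ⊗ c
and to contract the six outputs with elements p, q, r, s, t, u of the opposite spaces
(`LinearMap.sum_smul_eq_of_contract`). Inserting dual bases in the three interior state spaces turns
each side into a sum of products of three numbers, each the trace of a closed chain of 2-morphisms
attached to one 4-simplex.

These sums are evaluated with two tools. The first is a calculus of traces. The pairing is the trace
of a composite, the trace is cyclic (`trace_comm`), and the trace of an endomorphism of a composite
f g is the trace over f of its partial trace over g (`trace_ptr`). Hence the form of a 4-simplex can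
be written as the pairing of any one of its entries with a single 2-morphism, and the sums over two
of the three interior dual bases fuse the three factors into one
(`LinearMap.sum_mul_dual_families`).

The second tool is semi-simplicity. If x and y are dual bases of 2Hom(X, s g) and 2Hom(s g, X), then
the products of their mates, weighted by dim_q(s) and summed over a basis of 1-morphisms s, give the
identity of X g* (`IsBasis.resolution`). So a 2-morphism between words that end in the right letters
splits into pieces that factor through s, with exactly the weights of the lemma. This removes the
third dual basis together with the interior label. Each side becomes one trace over words of four
letters in which the interior label no longer occurs (`contract_sum_left`, `contract_sum_right`).

The two remaining traces contain the same nine 2-morphisms a, b, c, p, q, r, s, t, u, in the same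
cyclic pattern up to the interchange law for 2-morphisms on disjoint letters. They differ in the
tensorators between them: p has to be moved past tensorators with f012, and u past tensorators with
f345. Both moves are naturality of the tensorator (`rCell'_tauCell`, `tauCell_natural`), and
`trace_word_eq` assembles them with cyclicity. -/

namespace DualTwoCategory

/-! ## The underlying bicategory -/

section Bicategory

open CategoryTheory

variable {C : DualTwoCategory.{u, v, w}} {A B D E : C.Obj}

/-- The identity 2-morphism between 1-morphisms with the same underlying 1-morphism. -/
def eqCell {f g : C.Hom A B} (h : f.1 = g.1) : C.Hom₂ f g :=
  ⟨𝕀 f.1, C.law.dom_idc _, (C.law.cod_idc _).trans h⟩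

theorem vcomposable {f g h : C.Hom A B} (α : C.Hom₂ f g) (β : C.Hom₂ g h) :
    C.cod α.1 = C.dom β.1 :=
  α.2.2.trans β.2.1.symm

theorem hcomposable {f f' : C.Hom A B} {g g' : C.Hom B D} (α : C.Hom₂ f f') (β : C.Hom₂ g g') :
    C.tgt (C.dom α.1) = C.src (C.dom β.1) := by
  rw [α.2.1, β.2.1]; exact composable f g

theorem vcomp_eqCell {f g h : C.Hom A B} (α : C.Hom₂ f g) (e : g.1 = h.1) :
    α.1 ⊙ᵥ (eqCell e).1 = α.1 := by
  have := C.law.vcomp_idc α.1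
  rwa [α.2.2] at this

theorem eqCell_vcomp {f g h : C.Hom A B} (e : f.1 = g.1) (α : C.Hom₂ g h) :
    (eqCell e).1 ⊙ᵥ α.1 = α.1 := by
  have := C.law.idc_vcomp α.1
  rw [α.2.1] at this
  exact (congrArg (fun x => C.vcomp (C.idc x) α.1) e).trans this

theorem vHom₂_assoc {f g h k : C.Hom A B} (α : C.Hom₂ f g) (β : C.Hom₂ g h) (γ : C.Hom₂ h k) :
    vHom₂ (vHom₂ α β) γ = vHom₂ α (vHom₂ β γ) :=
  Subtype.ext (C.law.vcomp_assoc _ _ _ (vcomposable α β) (vcomposable β γ))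

theorem hHom₂_assoc {f f' : C.Hom A B} {g g' : C.Hom B D} {h h' : C.Hom D E}
    (α : C.Hom₂ f f') (β : C.Hom₂ g g') (γ : C.Hom₂ h h') :
    (α.1 ⊙ₕ β.1) ⊙ₕ γ.1 = α.1 ⊙ₕ (β.1 ⊙ₕ γ.1) :=
  C.law.hcomp_assoc _ _ _ (hcomposable α β) (hcomposable β γ)

theorem hHom₂_vHom₂ {f f' f'' : C.Hom A B} {g g' g'' : C.Hom B D}
    (α : C.Hom₂ f f') (α' : C.Hom₂ f' f'') (β : C.Hom₂ g g') (β' : C.Hom₂ g' g'') :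
    hHom₂ (vHom₂ α α') (vHom₂ β β') = vHom₂ (hHom₂ α β) (hHom₂ α' β') :=
  Subtype.ext (C.law.interchange _ _ _ _ (vcomposable α α') (vcomposable β β')
    (hcomposable α β))

theorem idHom₂_v {f g : C.Hom A B} (α : C.Hom₂ f g) : vHom₂ (idHom₂ f) α = α :=
  Subtype.ext (eqCell_vcomp rfl α)

theorem v_idHom₂ {f g : C.Hom A B} (α : C.Hom₂ f g) : vHom₂ α (idHom₂ g) = α :=
  Subtype.ext (vcomp_eqCell α rfl)

theorem hHom₂_id (f : C.Hom A B) (g : C.Hom B D) :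
    hHom₂ (idHom₂ f) (idHom₂ g) = idHom₂ (homComp f g) :=
  Subtype.ext (C.law.idc_hcomp_idc _ _ (composable f g))

instance homCategory (A B : C.Obj) : Category (C.Hom A B) where
  Hom f g := C.Hom₂ f g
  id := idHom₂
  comp := vHom₂
  id_comp := idHom₂_v
  comp_id := v_idHom₂
  assoc := vHom₂_assoc

/-- The isomorphism between 1-morphisms with the same underlying 1-morphism. -/
def eqIso {f g : C.Hom A B} (h : f.1 = g.1) : f ≅ g where
  hom := eqCell h
  inv := eqCell h.symm
  hom_inv_id := Subtype.ext (vcomp_eqCell (eqCell h) h.symm)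
  inv_hom_id := Subtype.ext (vcomp_eqCell (eqCell h.symm) h)

/-- All coherence isomorphisms below have identities as underlying 2-morphisms. This lemma and its
variants delete them in front of or behind a 2-morphism, which turns a bicategorical equation into
an equation in the strict 2-category. -/
theorem eqIso_hom_comp_val {f g h : C.Hom A B} (e : f.1 = g.1) (α : g ⟶ h) :
    ((eqIso e).hom ≫ α).1 = α.1 :=
  eqCell_vcomp e α

theorem eqIso_inv_comp_val {f g h : C.Hom A B} (e : g.1 = f.1) (α : g ⟶ h) :
    ((eqIso e).inv ≫ α).1 = α.1 :=
  eqCell_vcomp e.symm α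

theorem comp_eqIso_hom_val {f g h : C.Hom A B} (e : g.1 = h.1) (α : f ⟶ g) :
    (α ≫ (eqIso e).hom).1 = α.1 :=
  vcomp_eqCell α e

theorem comp_eqIso_inv_val {f g h : C.Hom A B} (e : h.1 = g.1) (α : f ⟶ g) :
    (α ≫ (eqIso e).inv).1 = α.1 :=
  vcomp_eqCell α e.symm

theorem eqIso_conj_val {f g f' g' : C.Hom A B} (e : f'.1 = f.1) (e' : g'.1 = g.1) (α : f ⟶ g) :
    ((eqIso e).hom ≫ α ≫ (eqIso e').inv).1 = α.1 :=
  (eqIso_hom_comp_val _ _).trans (comp_eqIso_inv_val _ _)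

theorem eqIso_conj_val' {f g f' g' : C.Hom A B} (e : f.1 = f'.1) (e' : g.1 = g'.1) (α : f ⟶ g) :
    ((eqIso e).inv ≫ α ≫ (eqIso e').hom).1 = α.1 :=
  (eqIso_inv_comp_val _ _).trans (comp_eqIso_hom_val _ _)

theorem eqCell_h {f f' : C.Hom A B} (e : f.1 = f'.1) (g : C.Hom B D) :
    (hHom₂ (eqCell e) (idHom₂ g)).1 = 𝕀 (f.1 ⨾ g.1) :=
  C.law.idc_hcomp_idc _ _ (composable f g)

theorem h_eqCell (f : C.Hom A B) {g g' : C.Hom B D} (e : g.1 = g'.1) :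
    (hHom₂ (idHom₂ f) (eqCell e)).1 = 𝕀 (f.1 ⨾ g.1) :=
  C.law.idc_hcomp_idc _ _ (composable f g)

theorem one_homComp (f : C.Hom A B) : (homComp (homOne A) f).1 = f.1 := by
  obtain ⟨f, rfl, rfl⟩ := f
  exact C.law.one_comp f

theorem homComp_one (f : C.Hom A B) : (homComp f (homOne B)).1 = f.1 := by
  obtain ⟨f, rfl, rfl⟩ := f
  exact C.law.comp_one f

/-- Since the coherence isomorphisms are invisible on underlying 2-morphisms, each axiom reduces to
a strict law: associativity, unitality or interchange. The purpose is to make adjunctions, mates and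
whiskering calculus available for 1-morphisms with typed source and target. -/
instance bicategory : Bicategory C.Obj where
  Hom A B := C.Hom A B
  id A := homOne A
  comp f g := homComp f g
  homCategory A B := homCategory A B
  whiskerLeft f _ _ η := hHom₂ (idHom₂ f) η
  whiskerRight η h := hHom₂ η (idHom₂ h)
  associator f g h := eqIso (homComp_assoc f g h)
  leftUnitor f := eqIso (one_homComp f)
  rightUnitor f := eqIso (homComp_one f)
  whiskerLeft_id := hHom₂_id
  whiskerLeft_comp f _ _ _ η θ := by
    refine .trans ?_ (hHom₂_vHom₂ _ _ _ _)
    rw [idHom₂_v]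
    rfl
  id_whiskerLeft {A B f g} η := by
    apply Subtype.ext
    refine .trans ?_ (eqIso_conj_val _ _ _).symm
    have := C.law.one_hcomp η.1
    rwa [η.2.1, f.2.1] at this
  comp_whiskerLeft f g h h' η := by
    apply Subtype.ext
    refine .trans ?_ (eqIso_conj_val _ _ _).symm
    refine .trans ?_ (hHom₂_assoc (idHom₂ f) (idHom₂ g) η)
    exact congrArg (C.hcomp · _) (C.law.idc_hcomp_idc _ _ (composable f g)).symm
  id_whiskerRight := hHom₂_id
  comp_whiskerRight η θ i := by
    refine .trans ?_ (hHom₂_vHom₂ _ _ _ _)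
    rw [idHom₂_v]
    rfl
  whiskerRight_id {A B f g} η := by
    apply Subtype.ext
    refine .trans ?_ (eqIso_conj_val _ _ _).symm
    have := C.law.hcomp_one η.1
    rwa [η.2.1, f.2.2] at this
  whiskerRight_comp η g h := by
    apply Subtype.ext
    refine .trans ?_ (eqIso_conj_val' _ _ _).symm
    refine .trans ?_ (hHom₂_assoc η (idHom₂ g) (idHom₂ h)).symm
    exact congrArg (C.hcomp _) (C.law.idc_hcomp_idc _ _ (composable g h)).symm
  whisker_assoc f _ _ η h := by
    apply Subtype.ext
    refine .trans ?_ (eqIso_conj_val _ _ _).symm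
    exact hHom₂_assoc (idHom₂ f) η (idHom₂ h)
  whisker_exchange η θ := by
    refine (hHom₂_vHom₂ _ _ _ _).symm.trans (.trans ?_ (hHom₂_vHom₂ _ _ _ _))
    rw [idHom₂_v, idHom₂_v, v_idHom₂, v_idHom₂]
  pentagon f g h i := by
    apply Subtype.ext
    refine .trans ?_ (eqIso_hom_comp_val _ _).symm
    refine (congrArg (C.vcomp · _) (eqCell_h (homComp_assoc f g h) i)).trans ?_
    refine (eqCell_vcomp (f := homComp (homComp (homComp f g) h) i)
      (g := homComp (homComp f (homComp g h)) i)
      (congrArg (C.comp · i.1) (homComp_assoc f g h)) _).trans ?_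
    refine (eqIso_hom_comp_val _ _).trans ((h_eqCell f (homComp_assoc g h i)).trans ?_)
    exact congrArg C.idc ((congrArg (C.comp f.1) (homComp_assoc g h i)).trans
      (homComp_assoc f g (homComp h i)).symm)
  triangle f g := by
    apply Subtype.ext
    refine (eqIso_hom_comp_val _ _).trans ((h_eqCell f (one_homComp g)).trans
      (.trans ?_ (eqCell_h (homComp_one f) g).symm))
    exact congrArg _ (homComp_assoc f (homOne _) g).symm

end Bicategory

end DualTwoCategory

/-! ## Partial traces and words in bicategories -/

namespace CategoryTheory.Bicategory

variable {B : Type*} [Bicategory B] {a b c d e : B}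

/-- A 1-morphism `g` that is both a right and a left adjoint of `f`. -/
structure Biadjunction (f : a ⟶ b) (g : b ⟶ a) where
  adj : f ⊣ g
  coadj : g ⊣ f

namespace Biadjunction

variable {g : b ⟶ c} {g' : c ⟶ b} (G : Biadjunction g g')

/-- The mate `P g' ⟶ Q` of `P ⟶ Q g`. -/
def hat {P : a ⟶ c} {Q : a ⟶ b} (μ : P ⟶ Q ≫ g) : P ≫ g' ⟶ Q :=
  μ ▷ g' ≫ (α_ _ _ _).hom ≫ Q ◁ G.coadj.counit ≫ (ρ_ Q).hom

/-- The mate `P ⟶ Q g` of `P g' ⟶ Q`. -/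
def unhat {P : a ⟶ c} {Q : a ⟶ b} (ν : P ≫ g' ⟶ Q) : P ⟶ Q ≫ g :=
  (ρ_ P).inv ≫ P ◁ G.coadj.unit ≫ (α_ _ _ _).inv ≫ ν ▷ g

/-- The mate `Q ⟶ P g'` of `Q g ⟶ P`. -/
def check {P : a ⟶ c} {Q : a ⟶ b} (μ : Q ≫ g ⟶ P) : Q ⟶ P ≫ g' :=
  (ρ_ Q).inv ≫ Q ◁ G.adj.unit ≫ (α_ _ _ _).inv ≫ μ ▷ g'

/-- The mate `Q g ⟶ P` of `Q ⟶ P g'`. -/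
def uncheck {P : a ⟶ c} {Q : a ⟶ b} (ν : Q ⟶ P ≫ g') : Q ≫ g ⟶ P :=
  ν ▷ g ≫ (α_ _ _ _).hom ≫ P ◁ G.adj.counit ≫ (ρ_ P).hom

/-- The partial trace `f ⟶ f'` of `f g ⟶ f' g`. -/
def ptr {f f' : a ⟶ b} (α : f ≫ g ⟶ f' ≫ g) : f ⟶ f' :=
  (ρ_ f).inv ≫ f ◁ G.adj.unit ≫ (α_ _ _ _).inv ≫ α ▷ g' ≫ (α_ _ _ _).hom ≫
    f' ◁ G.coadj.counit ≫ (ρ_ f').hom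

/-- Closing the strand g of a composite amounts to bending g once in each factor. This is what
converts the trace coefficients of a dual basis into composites of mates. -/
theorem check_comp_hat {P : a ⟶ c} {f f' : a ⟶ b} (μ : f ≫ g ⟶ P) (ν : P ⟶ f' ≫ g) :
    G.check μ ≫ G.hat ν = G.ptr (μ ≫ ν) := by
  simp [check, hat, ptr]

/-- Bending g back and forth creates a zigzag. The interchange law brings its unit and counit
together and a triangle identity straightens it; the two inversion lemmas that follow work in the
same way. -/
theorem unhat_hat {P : a ⟶ c} {Q : a ⟶ b} (μ : P ⟶ Q ≫ g) : G.unhat (G.hat μ) = μ := by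
  have h := G.coadj.right_triangle
  calc _ = 𝟙 _ ⊗≫ (P ◁ G.coadj.unit ≫ μ ▷ (g' ≫ g)) ⊗≫ Q ◁ G.coadj.counit ▷ g ⊗≫ 𝟙 _ := by
        simp only [unhat, hat]; bicategory
    _ = μ ⊗≫ Q ◁ rightZigzag G.coadj.unit G.coadj.counit ⊗≫ 𝟙 _ := by
        rw [whisker_exchange, rightZigzag]; bicategory
    _ = μ := by rw [h]; bicategory

theorem uncheck_check {P : a ⟶ c} {Q : a ⟶ b} (μ : Q ≫ g ⟶ P) : G.uncheck (G.check μ) = μ := by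
  have h := G.adj.left_triangle
  calc _ = 𝟙 _ ⊗≫ Q ◁ G.adj.unit ▷ g ⊗≫ (μ ▷ (g' ≫ g) ≫ P ◁ G.adj.counit) ⊗≫ 𝟙 _ := by
        simp only [uncheck, check]; bicategory
    _ = 𝟙 _ ⊗≫ Q ◁ leftZigzag G.adj.unit G.adj.counit ⊗≫ μ := by
        rw [← whisker_exchange, leftZigzag]; bicategory
    _ = μ := by rw [h]; bicategory

theorem hat_unhat {P : a ⟶ c} {Q : a ⟶ b} (ν : P ≫ g' ⟶ Q) : G.hat (G.unhat ν) = ν := by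
  have h := G.coadj.left_triangle
  calc _ = 𝟙 _ ⊗≫ P ◁ G.coadj.unit ▷ g' ⊗≫ (ν ▷ (g ≫ g') ≫ Q ◁ G.coadj.counit) ⊗≫ 𝟙 _ := by
        simp only [unhat, hat]; bicategory
    _ = 𝟙 _ ⊗≫ P ◁ leftZigzag G.coadj.unit G.coadj.counit ⊗≫ ν := by
        rw [← whisker_exchange, leftZigzag]; bicategory
    _ = ν := by rw [h]; bicategory

theorem unhat_comp {P : a ⟶ c} {Q R : a ⟶ b} (ν : P ≫ g' ⟶ Q) (κ : Q ⟶ R) :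
    G.unhat (ν ≫ κ) = G.unhat ν ≫ κ ▷ g := by
  simp [unhat]

theorem comp_uncheck {P : a ⟶ c} {Q R : a ⟶ b} (κ : R ⟶ Q) (ν : Q ⟶ P ≫ g') :
    G.uncheck (κ ≫ ν) = κ ▷ g ≫ G.uncheck ν := by
  simp [uncheck]

theorem unhat_hat_comp {P : a ⟶ c} {Q R : a ⟶ b} (μ : P ⟶ Q ≫ g) (κ : Q ⟶ R) :
    G.unhat (G.hat μ ≫ κ) = μ ≫ κ ▷ g := by
  rw [unhat_comp, unhat_hat]

theorem uncheck_comp_check {P : a ⟶ c} {Q R : a ⟶ b} (κ : R ⟶ Q) (μ : Q ≫ g ⟶ P) :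
    G.uncheck (κ ≫ G.check μ) = κ ▷ g ≫ μ := by
  rw [comp_uncheck, uncheck_check]

/-- A 2-morphism that does not touch g passes the unit of g by interchange, so it slides out of the
partial trace. -/
theorem comp_ptr {f f' f'' : a ⟶ b} (β : f ⟶ f') (α : f' ≫ g ⟶ f'' ≫ g) :
    G.ptr (β ▷ g ≫ α) = β ≫ G.ptr α := by
  calc _ = 𝟙 _ ⊗≫ (f ◁ G.adj.unit ≫ β ▷ (g ≫ g')) ⊗≫ α ▷ g' ⊗≫ f'' ◁ G.coadj.counit ⊗≫ 𝟙 _ := by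
        simp only [ptr]; bicategory
    _ = _ := by
        rw [whisker_exchange, ptr]; bicategory

theorem ptr_whiskerLeft (x : a ⟶ b) {a' : B} (g : a' ⟶ c) {g' : c ⟶ a'} (G : Biadjunction g g')
    {f f' : b ⟶ a'} (α : f ≫ g ⟶ f' ≫ g) :
    G.ptr ((α_ x f g).hom ≫ x ◁ α ≫ (α_ x f' g).inv) = x ◁ G.ptr α := by
  simp only [ptr]
  bicategory

/-- The closure of an endomorphism. -/
def loop (α : g ⟶ g) : 𝟙 b ⟶ 𝟙 b :=
  G.adj.unit ≫ α ▷ g' ≫ G.coadj.counit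

/-- The composite of two biadjunctions. -/
def comp {f : a ⟶ b} {f' : b ⟶ a} (K : Biadjunction f f') : Biadjunction (f ≫ g) (g' ≫ f') where
  adj := K.adj.comp G.adj
  coadj := G.coadj.comp K.coadj

theorem comp_unit {f : a ⟶ b} {f' : b ⟶ a} (K : Biadjunction f f') :
    (G.comp K).adj.unit = K.adj.unit ≫ f ◁ ((λ_ f').inv ≫ G.adj.unit ▷ f' ≫ (α_ g g' f').hom) ≫
      (α_ f g (g' ≫ f')).inv := by
  simp only [comp, Adjunction.comp, Adjunction.compUnit]
  bicategory

theorem comp_counit {f : a ⟶ b} {f' : b ⟶ a} (K : Biadjunction f f') :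
    (G.comp K).coadj.counit = (α_ f g (g' ≫ f')).hom ≫
      f ◁ ((α_ g g' f').inv ≫ G.coadj.counit ▷ f' ≫ (λ_ f').hom) ≫ K.coadj.counit := by
  simp only [comp, Adjunction.comp, Adjunction.compCounit]
  bicategory

/-- The unit and counit of a composite biadjunction are nested, with those of g inside those of f.
The inner closure is the partial trace over g. -/
theorem loop_comp_eq_loop_ptr {f : a ⟶ b} {f' : b ⟶ a} (K : Biadjunction f f')
    (α : f ≫ g ⟶ f ≫ g) : (G.comp K).loop α = K.loop (G.ptr α) := by
  simp only [loop, ptr, comp, Adjunction.comp, Adjunction.compUnit, Adjunction.compCounit]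
  bicategory

variable {h : b ⟶ c} {h' : c ⟶ b} (H : Biadjunction h h')

/-- The mate `h' ⟶ g'` of `g ⟶ h` with respect to `g ⊣ g'` and `h ⊣ h'`. -/
def rightMate (α : g ⟶ h) : h' ⟶ g' :=
  (ρ_ h').inv ≫ h' ◁ G.adj.unit ≫ h' ◁ α ▷ g' ≫ (α_ _ _ _).inv ≫ H.adj.counit ▷ g' ≫ (λ_ g').hom

/-- The mate `h' ⟶ g'` of `g ⟶ h` with respect to `g' ⊣ g` and `h' ⊣ h`. -/
def leftMate (α : g ⟶ h) : h' ⟶ g' :=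
  (λ_ h').inv ≫ G.coadj.unit ▷ h' ≫ (α_ _ _ _).hom ≫ g' ◁ α ▷ h' ≫ g' ◁ H.coadj.counit ≫ (ρ_ g').hom

/-- A 2-morphism on one leg of a unit can be carried around the bend, where it becomes its mate. The
next lemma is the same for the counit of the other adjunction, with the other mate. -/
theorem unit_comp_rightMate (α : g ⟶ h) :
    H.adj.unit ≫ h ◁ rightMate G H α = G.adj.unit ≫ α ▷ g' := by
  have t := H.adj.left_triangle
  calc _ = 𝟙 _ ⊗≫ (H.adj.unit ▷ 𝟙 b ≫ (h ≫ h') ◁ (G.adj.unit ≫ α ▷ g')) ⊗≫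
          h ◁ H.adj.counit ▷ g' ⊗≫ 𝟙 _ := by
        simp only [rightMate]; bicategory
    _ = 𝟙 _ ⊗≫ (G.adj.unit ≫ α ▷ g') ⊗≫
          leftZigzag H.adj.unit H.adj.counit ▷ g' ⊗≫ 𝟙 _ := by
        rw [← whisker_exchange, leftZigzag]; bicategory
    _ = _ := by rw [t]; bicategory

theorem leftMate_comp_counit (α : g ⟶ h) :
    g ◁ leftMate G H α ≫ G.coadj.counit = α ▷ h' ≫ H.coadj.counit := by
  have t := G.coadj.right_triangle
  calc _ = 𝟙 _ ⊗≫ g ◁ G.coadj.unit ▷ h' ⊗≫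
          ((g ≫ g') ◁ (α ▷ h' ≫ H.coadj.counit) ≫ G.coadj.counit ▷ 𝟙 b) ⊗≫ 𝟙 _ := by
        simp only [leftMate]; bicategory
    _ = 𝟙 _ ⊗≫ rightZigzag G.coadj.unit G.coadj.counit ▷ h' ⊗≫
          (α ▷ h' ≫ H.coadj.counit) ⊗≫ 𝟙 _ := by
        rw [whisker_exchange, rightZigzag]; bicategory
    _ = _ := by rw [t]; bicategory

/-- α is carried once around the loop. It goes around the unit as its right mate and around the
counit as its left mate, so cyclicity needs precisely that the two mates agree. -/
theorem loop_comp (α : g ⟶ h) (β : h ⟶ g) (hα : rightMate G H α = leftMate G H α) :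
    G.loop (α ≫ β) = H.loop (β ≫ α) := by
  have h₁ {k : b ⟶ b} (γ : h ≫ g' ⟶ k) := unit_comp_rightMate G H α =≫ γ
  have h₂ := leftMate_comp_counit G H α
  simp only [Category.assoc] at h₁
  rw [loop, loop, comp_whiskerRight, comp_whiskerRight, Category.assoc, Category.assoc, ← h₂,
    ← whisker_exchange_assoc, ← hα, h₁]

end Biadjunction

/-! ### Words -/

/-- A 2-morphism on the first two letters of a word. -/
def head {x₁ : a ⟶ b} {x₂ : b ⟶ c} {b' : B} {y₁ : a ⟶ b'} {y₂ : b' ⟶ c}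
    (α : x₁ ≫ x₂ ⟶ y₁ ≫ y₂) (z : c ⟶ d) : x₁ ≫ x₂ ≫ z ⟶ y₁ ≫ y₂ ≫ z :=
  (α_ _ _ _).inv ≫ α ▷ z ≫ (α_ _ _ _).hom

/-- A 2-morphism on the first three letters of a word. -/
def head₃ {x₁ : a ⟶ b} {x₂ : b ⟶ c} {x₃ : c ⟶ d} {b' c' : B} {y₁ : a ⟶ b'} {y₂ : b' ⟶ c'}
    {y₃ : c' ⟶ d} (α : x₁ ≫ x₂ ≫ x₃ ⟶ y₁ ≫ y₂ ≫ y₃) (z : d ⟶ e) :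
    x₁ ≫ x₂ ≫ x₃ ≫ z ⟶ y₁ ≫ y₂ ≫ y₃ ≫ z :=
  x₁ ◁ (α_ _ _ _).inv ≫ (α_ _ _ _).inv ≫ α ▷ z ≫ (α_ _ _ _).hom ≫ y₁ ◁ (α_ _ _ _).hom

section

variable {x₁ : a ⟶ b} {x₂ : b ⟶ c} {b' : B} {y₁ : a ⟶ b'} {y₂ : b' ⟶ c}

theorem head_exchange (α : x₁ ≫ x₂ ⟶ y₁ ≫ y₂) {z z' : c ⟶ d} (β : z ⟶ z') :
    head α z ≫ y₁ ◁ y₂ ◁ β = x₁ ◁ x₂ ◁ β ≫ head α z' := by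
  have h := whisker_exchange α β
  simp only [comp_whiskerLeft, Category.assoc] at h
  simp only [head, Category.assoc]
  rw [← cancel_epi (α_ x₁ x₂ z).hom, ← cancel_mono (α_ y₁ y₂ z').inv]
  simpa using h.symm

theorem head_exchange_assoc (α : x₁ ≫ x₂ ⟶ y₁ ≫ y₂) {z z' : c ⟶ d} (β : z ⟶ z') {w : a ⟶ d}
    (k : y₁ ≫ y₂ ≫ z' ⟶ w) :
    head α z ≫ y₁ ◁ y₂ ◁ β ≫ k = x₁ ◁ x₂ ◁ β ≫ head α z' ≫ k := by
  rw [← Category.assoc, head_exchange, Category.assoc]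

end

section

variable {x₁ : a ⟶ b} {x₂ : b ⟶ c} {x₃ : c ⟶ d} {b' c' : B} {y₁ : a ⟶ b'} {y₂ : b' ⟶ c'}
  {y₃ : c' ⟶ d}

theorem head₃_comp {b'' c'' : B} {z₁ : a ⟶ b''} {z₂ : b'' ⟶ c''} {z₃ : c'' ⟶ d}
    (α : x₁ ≫ x₂ ≫ x₃ ⟶ y₁ ≫ y₂ ≫ y₃) (β : y₁ ≫ y₂ ≫ y₃ ⟶ z₁ ≫ z₂ ≫ z₃) (z : d ⟶ e) :
    head₃ (α ≫ β) z = head₃ α z ≫ head₃ β z := by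
  simp [head₃]

theorem head₃_cons {b' : B} {y₂ : b ⟶ b'} {y₃ : b' ⟶ d} (α : x₂ ≫ x₃ ⟶ y₂ ≫ y₃) (z : d ⟶ e) :
    head₃ (x₁ ◁ α) z = x₁ ◁ head α z := by
  simp [head₃, head]

theorem head₃_head {b' : B} {y₁ : a ⟶ b'} {y₂ : b' ⟶ c} (α : x₁ ≫ x₂ ⟶ y₁ ≫ y₂) (z : d ⟶ e) :
    head₃ (head α x₃) z = head α (x₃ ≫ z) := by
  simp only [head₃, head]
  bicategory

end

end CategoryTheory.Bicategory

namespace DualTwoCategory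

/-! ### Duals as two-sided adjoints, and the equality of left and right mates. -/

section Duality

open CategoryTheory Bicategory

variable {C : DualTwoCategory.{u, v, w}} {A B D E : C.Obj}

theorem associator_hom_comp_val (f : A ⟶ B) (g : B ⟶ D) (h : D ⟶ E) {k : A ⟶ E}
    (α : f ≫ g ≫ h ⟶ k) : ((α_ f g h).hom ≫ α).1 = α.1 :=
  eqIso_hom_comp_val _ _

theorem associator_inv_comp_val (f : A ⟶ B) (g : B ⟶ D) (h : D ⟶ E) {k : A ⟶ E}
    (α : (f ≫ g) ≫ h ⟶ k) : ((α_ f g h).inv ≫ α).1 = α.1 :=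
  eqIso_inv_comp_val _ _

theorem comp_associator_hom_val (f : A ⟶ B) (g : B ⟶ D) (h : D ⟶ E) {k : A ⟶ E}
    (α : k ⟶ (f ≫ g) ≫ h) : (α ≫ (α_ f g h).hom).1 = α.1 :=
  comp_eqIso_hom_val _ _

theorem comp_associator_inv_val (f : A ⟶ B) (g : B ⟶ D) (h : D ⟶ E) {k : A ⟶ E}
    (α : k ⟶ f ≫ g ≫ h) : (α ≫ (α_ f g h).inv).1 = α.1 :=
  comp_eqIso_inv_val _ _

theorem rightUnitor_inv_comp_val (f : A ⟶ B) {k : A ⟶ B} (α : f ≫ 𝟙 B ⟶ k) :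
    ((ρ_ f).inv ≫ α).1 = α.1 :=
  eqIso_inv_comp_val _ _

theorem comp_rightUnitor_hom_val (f : A ⟶ B) {k : A ⟶ B} (α : k ⟶ f ≫ 𝟙 B) :
    (α ≫ (ρ_ f).hom).1 = α.1 :=
  comp_eqIso_hom_val _ _

theorem leftUnitor_inv_comp_val (f : A ⟶ B) {k : A ⟶ B} (α : 𝟙 A ≫ f ⟶ k) :
    ((λ_ f).inv ≫ α).1 = α.1 :=
  eqIso_inv_comp_val _ _

theorem comp_leftUnitor_hom_val (f : A ⟶ B) {k : A ⟶ B} (α : k ⟶ 𝟙 A ≫ f) :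
    (α ≫ (λ_ f).hom).1 = α.1 :=
  comp_eqIso_hom_val _ _

/-- The dual of a 1-morphism. -/
def dual (f : A ⟶ B) : B ⟶ A := homStar f

/-- `X ⊗ f`. -/
def lTens (X : C.Obj) (f : A ⟶ B) : X ⊠ A ⟶ X ⊠ B := homL X f

/-- `f ⊗ X`. -/
def rTens (f : A ⟶ B) (X : C.Obj) : A ⊠ X ⟶ B ⊠ X := homR f X

/-- `X ⊗ α`. -/
def lTens₂ (X : C.Obj) {f g : A ⟶ B} (α : f ⟶ g) : lTens X f ⟶ lTens X g := lHom₂ X α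

/-- `α ⊗ X`. -/
def rTens₂ {f g : A ⟶ B} (α : f ⟶ g) (X : C.Obj) : rTens f X ⟶ rTens g X := rHom₂ α X

/-- The unit `1_A ⇒ f f*`. -/
def unitCell (f : A ⟶ B) : 𝟙 A ⟶ f ≫ dual f :=
  ⟨C.i₁ f.1, (C.law.dom_i₁ _).trans (congrArg _ f.2.1), C.law.cod_i₁ _⟩

/-- The counit `f* f ⇒ 1_B`. -/
def counitCell (f : A ⟶ B) : dual f ≫ f ⟶ 𝟙 B :=
  ⟨C.e₁ f.1, C.law.dom_e₁ _, (C.law.cod_e₁ _).trans (congrArg _ f.2.2)⟩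

/-- The unit `1_B ⇒ f* f`. -/
def unitCell' (f : A ⟶ B) : 𝟙 B ⟶ dual f ≫ f :=
  ⟨C.i₁ (C.star₁ f.1), ((C.law.dom_i₁ _).trans (congrArg _ (homStar f).2.1)),
    (C.law.cod_i₁ _).trans (congrArg (C.comp _) (C.law.star₁_star₁ _))⟩

/-- The counit `f f* ⇒ 1_A`. -/
def counitCell' (f : A ⟶ B) : f ≫ dual f ⟶ 𝟙 A :=
  ⟨C.e₁ (C.star₁ f.1), (C.law.dom_e₁ _).trans (congrArg (C.comp · _) (C.law.star₁_star₁ _)),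
    (C.law.cod_e₁ _).trans (congrArg _ (homStar f).2.2)⟩

theorem zigzag_val {f : A ⟶ B} {g : B ⟶ A} (η : 𝟙 A ⟶ f ≫ g) (κ : g ≫ f ⟶ 𝟙 B)
    (h : (η.1 ⊙ₕ 𝕀 f.1) ⊙ᵥ (𝕀 f.1 ⊙ₕ κ.1) = 𝕀 f.1) :
    leftZigzag η κ = (λ_ f).hom ≫ (ρ_ f).inv := by
  apply Subtype.ext
  have h₁ : (leftZigzag η κ).1 = ((η ▷ f) ≫ (α_ _ _ _).hom ≫ f ◁ κ).1 := by
    simp [leftZigzag, bicategoricalComp]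
  rw [h₁]
  refine (congrArg (C.vcomp _) (associator_hom_comp_val f g f (f ◁ κ))).trans (h.trans ?_)
  exact ((comp_eqIso_inv_val _ (eqIso (one_homComp f)).hom).trans
    (congrArg C.idc (one_homComp f))).symm

theorem zigzag_val' {f : A ⟶ B} {g : B ⟶ A} (η : 𝟙 A ⟶ f ≫ g) (κ : g ≫ f ⟶ 𝟙 B)
    (h : (𝕀 g.1 ⊙ₕ η.1) ⊙ᵥ (κ.1 ⊙ₕ 𝕀 g.1) = 𝕀 g.1) :
    rightZigzag η κ = (ρ_ g).hom ≫ (λ_ g).inv := by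
  apply Subtype.ext
  have h₁ : (rightZigzag η κ).1 = ((g ◁ η) ≫ (α_ _ _ _).inv ≫ κ ▷ g).1 := by
    simp [rightZigzag, bicategoricalComp]
  rw [h₁]
  refine (congrArg (C.vcomp _) (associator_inv_comp_val g f g (κ ▷ g))).trans (h.trans ?_)
  exact ((comp_eqIso_inv_val _ (eqIso (homComp_one g)).hom).trans
    (congrArg C.idc (homComp_one g))).symm

/-- A 1-morphism is both left and right adjoint to its dual. -/
def biadj (f : A ⟶ B) : Biadjunction f (dual f) where
  adj :=
    { unit := unitCell f
      counit := counitCell f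
      left_triangle := zigzag_val _ _ (C.law.zigzag f.1)
      right_triangle := zigzag_val' _ _ (C.law.zigzag_star f.1) }
  -- The second adjunction is the first one for `f*`, with its unit and counit retyped along the
  -- equality of `f**` and `f`.
  coadj :=
    { unit := unitCell' f
      counit := counitCell' f
      left_triangle := zigzag_val _ _ (C.law.zigzag (C.star₁ f.1))
      right_triangle := zigzag_val' _ _ (by
        have := C.law.zigzag_star (C.star₁ f.1)
        rwa [C.law.star₁_star₁] at this) }

theorem star₂_h {f f' : C.Hom A B} {g g' : C.Hom B D} (α : C.Hom₂ f f') (β : C.Hom₂ g g') :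
    C.star₂ (α.1 ⊙ₕ β.1) = C.star₂ α.1 ⊙ₕ C.star₂ β.1 :=
  C.law.star₂_hcomp _ _ (hcomposable α β)

theorem star₂_v {f g h : C.Hom A B} (α : C.Hom₂ f g) (β : C.Hom₂ g h) :
    C.star₂ (α.1 ⊙ᵥ β.1) = C.star₂ β.1 ⊙ᵥ C.star₂ α.1 :=
  C.law.star₂_vcomp _ _ (vcomposable α β)

theorem rightMate_val {f g : A ⟶ B} (α : f ⟶ g) :
    ((biadj f).rightMate (biadj g) α).1 = C.dagger α.1 := by
  rw [DualTwoCatData.dagger, α.2.1, α.2.2, Biadjunction.rightMate]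
  refine (rightUnitor_inv_comp_val _ _).trans ?_
  refine congrArg (C.vcomp _) ?_
  refine congrArg (C.vcomp _) ?_
  exact (associator_inv_comp_val _ _ _ _).trans (comp_leftUnitor_hom_val _ _)

/-- The unit and counit of `f*` are the duals of the counit and unit of `f`. Hence dualizing the
composite that defines the adjoint of `α*` reverses it, and it becomes the mate of α for the
opposite pair of adjunctions. -/
theorem leftMate_val {f g : A ⟶ B} (α : f ⟶ g) :
    ((biadj f).leftMate (biadj g) α).1 = C.star₂ (C.dagger (C.star₂ α.1)) := by
  let β : g ⟶ f := ⟨C.star₂ α.1, (C.law.dom_star₂ _).trans α.2.2, (C.law.cod_star₂ _).trans α.2.1⟩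
  let f' : B ⟶ A := dual f
  let g' : B ⟶ A := dual g
  let X₃ : f' ≫ f ≫ g' ⟶ 𝟙 B ≫ g' := (α_ _ _ _).inv ≫ counitCell f ▷ g'
  have h₁ : C.dagger (C.star₂ α.1) =
      (f' ◁ unitCell g).1 ⊙ᵥ ((f' ◁ β ▷ g').1 ⊙ᵥ X₃.1) := by
    rw [DualTwoCatData.dagger, C.law.dom_star₂, C.law.cod_star₂, α.2.1, α.2.2]
    exact congrArg (C.vcomp _) (congrArg (C.vcomp _)
      (associator_inv_comp_val f' f g' (counitCell f ▷ g')).symm)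
  have h₂ : C.star₂ X₃.1 = C.i₁ (C.star₁ f.1) ⊙ₕ 𝕀 (C.star₁ g.1) := by
    refine (congrArg C.star₂ (associator_inv_comp_val _ _ _ _)).trans ?_
    refine (star₂_h (counitCell f) (idHom₂ g')).trans ?_
    rw [C.law.i₁_star]
    exact congrArg (C.hcomp _) (C.law.star₂_idc _)
  have h₃ : C.star₂ (f' ◁ β ▷ g').1 = 𝕀 (C.star₁ f.1) ⊙ₕ (α.1 ⊙ₕ 𝕀 (C.star₁ g.1)) := by
    refine (star₂_h (idHom₂ f') (β ▷ g')).trans ?_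
    refine congrArg₂ C.hcomp (C.law.star₂_idc _) ((star₂_h β (idHom₂ g')).trans ?_)
    exact congrArg₂ C.hcomp (C.law.star₂_star₂ _) (C.law.star₂_idc _)
  have h₄ : C.star₂ (f' ◁ unitCell g).1 = 𝕀 (C.star₁ f.1) ⊙ₕ C.e₁ (C.star₁ g.1) := by
    refine (star₂_h (idHom₂ f') (unitCell g)).trans ?_
    rw [C.law.e₁_star]
    exact congrArg (C.hcomp · _) (C.law.star₂_idc _)
  have h₅ := (star₂_v (f' ◁ unitCell g) (f' ◁ β ▷ g' ≫ X₃)).trans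
    (congrArg (C.vcomp · _) (star₂_v (f' ◁ β ▷ g') X₃))
  rw [h₂, h₃, h₄] at h₅
  rw [h₁]
  refine .trans ?_ h₅.symm
  rw [Biadjunction.leftMate]
  let Y₁ : 𝟙 B ≫ g' ⟶ f' ≫ f ≫ g' := unitCell' f ▷ g' ≫ (α_ _ _ _).hom
  have e₁ : Y₁.1 = C.i₁ (C.star₁ f.1) ⊙ₕ 𝕀 (C.star₁ g.1) := comp_associator_hom_val _ _ _ _
  refine (leftUnitor_inv_comp_val _ _).trans ?_
  rw [← e₁]
  refine .trans ?_ (congrArg Subtype.val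
    (Category.assoc Y₁ (f' ◁ α ▷ g') (f' ◁ counitCell' g))).symm
  refine (congrArg Subtype.val (Category.assoc (unitCell' f ▷ g') (α_ _ _ _).hom
    (f' ◁ α ▷ g' ≫ f' ◁ counitCell' g ≫ (ρ_ f').hom))).symm.trans ?_
  exact congrArg (C.vcomp _) (congrArg (C.vcomp _) (comp_rightUnitor_hom_val _ _))

/-- The two mates are the adjoint of α and the dual of the adjoint of `α*`. The law `dagger_star`
and the involutivity of duality identify them, which is the hypothesis of `Biadjunction.loop_comp`.
-/
theorem rightMate_eq_leftMate {f g : A ⟶ B} (α : f ⟶ g) :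
    (biadj f).rightMate (biadj g) α = (biadj f).leftMate (biadj g) α := by
  apply Subtype.ext
  rw [rightMate_val, leftMate_val, C.law.dagger_star, C.law.star₂_star₂]

end Duality

end DualTwoCategory

namespace DualTwoCategory

/-! ### The trace as a closed loop; its cyclicity and its compatibility with partial traces. -/

section Trace

open CategoryTheory Bicategory

variable {C : DualTwoCategory.{u, v, w}} {A B D E : C.Obj}

theorem ptr_val {g : B ⟶ D} {f f' : A ⟶ B} (α : f ≫ g ⟶ f' ≫ g) :
    ((biadj g).ptr α).1 = (𝕀 f.1 ⊙ₕ C.i₁ g.1) ⊙ᵥ (α.1 ⊙ₕ 𝕀 (C.star₁ g.1)) ⊙ᵥ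
      (𝕀 f'.1 ⊙ₕ C.e₁ (C.star₁ g.1)) := by
  rw [Biadjunction.ptr]
  refine (rightUnitor_inv_comp_val _ _).trans (congrArg (C.vcomp _) ?_)
  refine (associator_inv_comp_val _ _ _ _).trans (congrArg (C.vcomp _) ?_)
  exact (associator_hom_comp_val _ _ _ _).trans (comp_rightUnitor_hom_val _ _)

/-- The 1-morphism `i_A`. -/
def coev (A : C.Obj) : C.unit ⟶ A ⊠ C.star₀ A := homUnit A

/-- The 1-morphism `i_A (f ⊗ A*)`, whose closed endomorphisms compute the right trace. -/
def bend (f : A ⟶ B) : C.unit ⟶ B ⊠ C.star₀ A :=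
  coev A ≫ rTens f (C.star₀ A)

/-- The 2-morphism `i_A ∘ (α ⊗ A*)`. -/
def bend₂ {f g : A ⟶ B} (α : f ⟶ g) : bend f ⟶ bend g :=
  coev A ◁ rTens₂ α (C.star₀ A)

theorem rTens₂_comp {f g h : A ⟶ B} (α : f ⟶ g) (β : g ⟶ h) (X : C.Obj) :
    rTens₂ (α ≫ β) X = rTens₂ α X ≫ rTens₂ β X :=
  Subtype.ext (C.law.vcomp_rTensor₂ _ _ _ (vcomposable α β))

theorem lTens₂_comp {f g h : A ⟶ B} (X : C.Obj) (α : f ⟶ g) (β : g ⟶ h) :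
    lTens₂ X (α ≫ β) = lTens₂ X α ≫ lTens₂ X β :=
  Subtype.ext (C.law.lTensor₂_vcomp _ _ _ (vcomposable α β))

theorem bend₂_comp {f g h : A ⟶ B} (α : f ⟶ g) (β : g ⟶ h) :
    bend₂ (α ≫ β) = bend₂ α ≫ bend₂ β := by
  rw [bend₂, rTens₂_comp, Bicategory.whiskerLeft_comp]
  rfl

theorem star_bend_val (f : A ⟶ B) :
    C.star₁ (bend f).1 = (C.star₁ f.1 ⊳ C.star₀ A) ⨾ C.e₀ (C.star₀ A) := by
  refine (C.law.star₁_comp _ _ (composable (homUnit A) (homR f (C.star₀ A)))).trans ?_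
  rw [C.law.e₀_star]
  exact congrArg (C.comp · _) (C.law.star₁_rTensor _ _)

section

variable {F : Type*} [Field F] [Additive C] [VectLinear F C]

/-- The cap of f is by definition the unit of i_A (f ⊗ A*), and the dual of this 1-morphism is (f* ⊗
A*) e_{A*}. The right trace of α ∘ 1_{f*} between cap and cup is therefore a loop for the
biadjunction of the bent 1-morphism. -/
theorem scalar_symm_trace (f : A ⟶ B) (α : f ⟶ f) :
    (scalar F).symm (traceₗ F f α) = (biadj (bend f)).loop (bend₂ α) := by
  refine ((scalar F).symm_apply_apply _).trans (Subtype.ext ?_)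
  obtain ⟨f, rfl, rfl⟩ := f
  let A := C.src f
  let f' : C.Hom A (C.tgt f) := ⟨f, rfl, rfl⟩
  let i := homUnit A
  let x := homR (homStar f') (C.star₀ A)
  let y := homCounit A
  let β : C.Hom₂ (homR f' (C.star₀ A)) (homR f' (C.star₀ A)) := rHom₂ α (C.star₀ A)
  have h₂ : 𝕀 (C.star₁ (bend f').1) = 𝕀 x.1 ⊙ₕ 𝕀 y.1 := by
    rw [star_bend_val]
    exact (C.law.idc_hcomp_idc _ _ (composable x y)).symm
  have h₃ : (α.1 ⊙ₕ 𝕀 (C.star₁ f)) ⊳₂ C.star₀ A = β.1 ⊙ₕ 𝕀 x.1 := by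
    refine (C.law.hcomp_rTensor₂ _ _ _ (hcomposable α (idHom₂ (homStar f')))).trans ?_
    exact congrArg (C.hcomp _) (C.law.idc_rTensor₂ _ _)
  have h₄ : 𝕀 i.1 ⊙ₕ (((α.1 ⊙ₕ 𝕀 (C.star₁ f)) ⊳₂ C.star₀ A) ⊙ₕ 𝕀 y.1) =
      (𝕀 i.1 ⊙ₕ β.1) ⊙ₕ 𝕀 (C.star₁ (bend f').1) := by
    rw [h₂, h₃]
    refine .trans ?_ (hHom₂_assoc (idHom₂ i) β (hHom₂ (idHom₂ x) (idHom₂ y))).symm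
    exact congrArg (C.hcomp _) (hHom₂_assoc β (idHom₂ x) (idHom₂ y))
  refine congrArg (C.vcomp _) (congrArg₂ C.vcomp h₄ ?_)
  exact (C.law.e₁_star _).symm

theorem trace_comm {f g : A ⟶ B} (α : f ⟶ g) (β : g ⟶ f) :
    traceₗ F f (α ≫ β) = traceₗ F g (β ≫ α) := by
  apply (scalar F (C := C)).symm.injective
  rw [scalar_symm_trace, scalar_symm_trace, bend₂_comp, bend₂_comp]
  exact Biadjunction.loop_comp _ _ _ _ (rightMate_eq_leftMate _)

end

theorem unit_comp_val (f : A ⟶ B) (g : B ⟶ D) :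
    ((biadj g).comp (biadj f)).adj.unit.1 = C.i₁ (f ≫ g).1 := by
  rw [Biadjunction.comp_unit]
  refine .trans ?_ (C.law.i₁_comp _ _ (composable f g)).symm
  refine congrArg (C.vcomp _) ((comp_associator_inv_val _ _ _ _).trans (congrArg (C.hcomp _) ?_))
  exact (leftUnitor_inv_comp_val _ _).trans (comp_associator_hom_val _ _ _ _)

theorem counit_comp_val (f : A ⟶ B) (g : B ⟶ D) :
    ((biadj g).comp (biadj f)).coadj.counit.1 = C.e₁ (C.star₁ (f ≫ g).1) := by
  have h₁ : C.star₁ (f ≫ g).1 = C.star₁ g.1 ⨾ C.star₁ f.1 :=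
    C.law.star₁_comp _ _ (composable f g)
  have h₂ := C.law.e₁_comp _ _ (composable (homStar g) (homStar f))
  rw [Biadjunction.comp_counit, h₁]
  refine .trans ?_ h₂.symm
  refine (associator_hom_comp_val _ _ _ _).trans ?_
  refine congrArg (C.vcomp · _) (congrArg₂ C.hcomp ?_ ?_)
  · exact congrArg C.idc (C.law.star₁_star₁ _).symm
  · exact (associator_inv_comp_val _ _ _ _).trans (comp_leftUnitor_hom_val _ _)

/-- The laws `i₁_comp` and `e₁_comp` say that the duality of a composite is the nested one, so its
loops can be computed with the composite biadjunction. -/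
theorem loop_comp_val (f : A ⟶ B) (g : B ⟶ D) (α : f ≫ g ⟶ f ≫ g) :
    (biadj (f ≫ g)).loop α = (biadj f).loop ((biadj g).ptr α) := by
  rw [← Biadjunction.loop_comp_eq_loop_ptr]
  apply Subtype.ext
  have h : C.star₁ (f ≫ g).1 = C.star₁ g.1 ⨾ C.star₁ f.1 :=
    C.law.star₁_comp _ _ (composable f g)
  refine congrArg₂ C.vcomp (unit_comp_val f g).symm
    (congrArg₂ C.vcomp ?_ (counit_comp_val f g).symm)
  exact congrArg (fun x => C.hcomp _ (C.idc x)) h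

/-- `(f g) ⊗ X` is `(f ⊗ X) (g ⊗ X)`. -/
def rTensComp (f : A ⟶ B) (g : B ⟶ D) (X : C.Obj) :
    rTens (f ≫ g) X ≅ rTens f X ≫ rTens g X :=
  eqIso (homR_homComp f g X)

theorem rTens₂_h {f f' : A ⟶ B} {g g' : B ⟶ D} (α : f ⟶ f') (β : g ⟶ g') (X : C.Obj) :
    (α.1 ⊙ₕ β.1) ⊳₂ X = (α.1 ⊳₂ X) ⊙ₕ (β.1 ⊳₂ X) :=
  C.law.hcomp_rTensor₂ _ _ _ (hcomposable α β)

theorem lTens₂_h {f f' : A ⟶ B} {g g' : B ⟶ D} (X : C.Obj) (α : f ⟶ f') (β : g ⟶ g') :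
    X ⊲₂ (α.1 ⊙ₕ β.1) = (X ⊲₂ α.1) ⊙ₕ (X ⊲₂ β.1) :=
  C.law.lTensor₂_hcomp _ _ _ (hcomposable α β)

theorem ptr_eq {g : B ⟶ D} {f f' : A ⟶ B} (α : f ≫ g ⟶ f' ≫ g) :
    (biadj g).ptr α = ((ρ_ f).inv ≫ f ◁ unitCell g) ≫
      ((α_ _ _ _).inv ≫ α ▷ dual g ≫ (α_ _ _ _).hom) ≫ f' ◁ counitCell' g ≫ (ρ_ f').hom := by
  simp [Biadjunction.ptr, biadj]

/-- The functor - ⊗ X preserves both compositions, duals, units and counits. The partial trace is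
built from these alone, so it is preserved factor by factor. -/
theorem ptr_rTens (X : C.Obj) {g : B ⟶ D} {f f' : A ⟶ B} (α : f ≫ g ⟶ f' ≫ g) :
    (biadj (rTens g X)).ptr ((rTensComp f g X).inv ≫ rTens₂ α X ≫ (rTensComp f' g X).hom) =
      rTens₂ ((biadj g).ptr α) X := by
  apply Subtype.ext
  have h : ((rTensComp f g X).inv ≫ rTens₂ α X ≫ (rTensComp f' g X).hom).1 = α.1 ⊳₂ X :=
    eqIso_conj_val' _ _ _
  let p₁ : f ⟶ f ≫ g ≫ dual g := (ρ_ f).inv ≫ f ◁ unitCell g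
  let p₂ : f ≫ g ≫ dual g ⟶ f' ≫ g ≫ dual g := (α_ _ _ _).inv ≫ α ▷ dual g ≫ (α_ _ _ _).hom
  let p₃ : f' ≫ g ≫ dual g ⟶ f' := f' ◁ counitCell' g ≫ (ρ_ f').hom
  have h' := (congrArg Subtype.val (rTens₂_comp p₁ (p₂ ≫ p₃) X)).trans
    (congrArg (C.vcomp _) (congrArg Subtype.val (rTens₂_comp p₂ p₃ X)))
  rw [ptr_val, ptr_eq, h]
  refine .trans ?_ h'.symm
  refine congrArg₂ C.vcomp ?_ (congrArg₂ C.vcomp ?_ ?_)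
  · refine .trans ?_ (congrArg (C.rTensor₂ · X) (rightUnitor_inv_comp_val _ _)).symm
    refine .trans ?_ (rTens₂_h (𝟙 f) (unitCell g) X).symm
    exact congrArg₂ C.hcomp (C.law.idc_rTensor₂ _ _).symm (C.law.i₁_rTensor _ _)
  · refine .trans ?_ (congrArg (C.rTensor₂ · X) ((associator_inv_comp_val _ _ _ _).trans
      (comp_associator_hom_val _ _ _ _))).symm
    refine .trans ?_ (rTens₂_h α (𝟙 (dual g)) X).symm
    refine congrArg (C.hcomp _) ((congrArg C.idc (C.law.star₁_rTensor _ _)).trans ?_)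
    exact (C.law.idc_rTensor₂ _ _).symm
  · refine .trans ?_ (congrArg (C.rTensor₂ · X) (comp_rightUnitor_hom_val _ _)).symm
    refine .trans ?_ (rTens₂_h (𝟙 f') (counitCell' g) X).symm
    refine congrArg₂ C.hcomp (C.law.idc_rTensor₂ _ _).symm ?_
    exact (congrArg C.e₁ (C.law.star₁_rTensor _ _)).trans (C.law.e₁_rTensor _ _)

/-- The bend of a composite. -/
theorem bend_comp_val (f : A ⟶ B) (g : B ⟶ D) :
    (bend (f ≫ g)).1 = (bend f ≫ rTens g (C.star₀ A)).1 := by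
  refine .trans ?_ (homComp_assoc (coev A) (rTens f (C.star₀ A)) (rTens g (C.star₀ A))).symm
  exact congrArg (C.comp _) (homR_homComp f g _)

/-- Bends of composites agree only as underlying 1-morphisms, being bracketed differently; a loop
depends on nothing else. -/
theorem loop_congr {B' : C.Obj} {f : A ⟶ B} {g : A ⟶ B'} {α : f ⟶ f} {β : g ⟶ g}
    (h : f.1 = g.1) (hα : α.1 = β.1) : (biadj f).loop α = (biadj g).loop β :=
  Subtype.ext (congrArg₂ C.vcomp (congrArg C.i₁ h) (congrArg₂ C.vcomp
    (congrArg₂ C.hcomp hα (congrArg (fun x => C.idc (C.star₁ x)) h))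
    (congrArg (fun x => C.e₁ (C.star₁ x)) h)))

/-- Bending a composite f g gives the bend of f followed by g ⊗ A*. The loop over it closes in two
stages, and the inner stage is the partial trace over g, placed behind i_A and tensored with A*. -/
theorem trace_ptr {F : Type*} [Field F] [Additive C] [VectLinear F C]
    (f : A ⟶ B) (g : B ⟶ D) (α : f ≫ g ⟶ f ≫ g) :
    traceₗ F (f ≫ g) α = traceₗ F f ((biadj g).ptr α) := by
  apply (scalar F (C := C)).symm.injective
  have h : bend₂ ((biadj g).ptr α) = (biadj (rTens g (C.star₀ A))).ptr
      (f := bend f) (f' := bend f) ((α_ _ _ _).hom ≫ coev A ◁ ((rTensComp f g _).inv ≫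
        rTens₂ α _ ≫ (rTensComp f g _).hom) ≫ (α_ _ _ _).inv) := by
    rw [bend₂, ← ptr_rTens]
    exact (Biadjunction.ptr_whiskerLeft _ _ _ _).symm
  rw [scalar_symm_trace, scalar_symm_trace, h]
  refine .trans ?_ (loop_comp_val (bend f) (rTens g (C.star₀ A)) _)
  refine loop_congr (bend_comp_val f g) ?_
  refine .trans ?_ ((associator_hom_comp_val _ _ _ _).trans
    (comp_associator_inv_val _ _ _ _)).symm
  exact congrArg (C.hcomp _) (eqIso_conj_val' _ _ _).symm

end Trace

end DualTwoCategory

/-! ## Dual bases -/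

/-- The family x is a basis and `y i` represents its i-th coordinate form under the pairing. The
second expansion holds because both of its sides represent the same form on V. -/
theorem LinearMap.IsPerfPair.exists_dual_families {F V W : Type*} [Field F] [AddCommGroup V]
    [AddCommGroup W] [Module F V] [Module F W] [Module.Finite F V] (p : V →ₗ[F] W →ₗ[F] F)
    [p.IsPerfPair] :
    ∃ (n : ℕ) (x : Fin n → V) (y : Fin n → W), (∀ v, v = ∑ i, p v (y i) • x i) ∧
      ∀ w, w = ∑ i, p (x i) w • y i := by
  let b := Module.finBasis F V
  have hy (i) : ∃ y, p.flip y = b.coord i := ⟨p.flip.toPerfPair.symm (b.coord i),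
    LinearEquiv.apply_symm_apply p.flip.toPerfPair (b.coord i)⟩
  choose y hy using hy
  have hy' (i v) : p v (y i) = b.repr v i := by
    rw [← LinearMap.flip_apply, hy]; rfl
  have h₁ (v) : v = ∑ i, p v (y i) • b i := by
    simp only [hy']; exact (b.sum_repr v).symm
  refine ⟨_, b, y, h₁, fun w => ?_⟩
  apply p.flip.toPerfPair.injective
  ext v
  simp only [LinearMap.toPerfPair_apply, LinearMap.flip_apply]
  conv_lhs => rw [h₁ v]
  simp [mul_comm]

namespace DualTwoCategory

/-! ### Semi-simplicity as a resolution of the identity weighted by quantum dimensions. -/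

section Resolution

open CategoryTheory Bicategory

variable {C : DualTwoCategory.{u, v, w}} {A B D E : C.Obj}
variable {F : Type*} [Field F] [Additive C] [VectLinear F C]

variable (F) in
/-- `hat` as a linear map. -/
def hatₗ (g : B ⟶ D) (P : A ⟶ D) (Q : A ⟶ B) : C.Hom₂ P (Q ≫ g) →ₗ[F] C.Hom₂ (P ≫ dual g) Q :=
  (vₗ F).flip ((α_ _ _ _).hom ≫ Q ◁ (biadj g).coadj.counit ≫ (ρ_ Q).hom) ∘ₗ
    (hₗ F).flip (idHom₂ (dual g))

variable (F) in
/-- `unhat` as a linear map. -/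
def unhatₗ (g : B ⟶ D) (P : A ⟶ D) (Q : A ⟶ B) :
    C.Hom₂ (P ≫ dual g) Q →ₗ[F] C.Hom₂ P (Q ≫ g) :=
  vₗ F ((ρ_ P).inv ≫ P ◁ (biadj g).coadj.unit ≫ (α_ _ _ _).inv) ∘ₗ (hₗ F).flip (idHom₂ g)

theorem unhatₗ_apply (g : B ⟶ D) {P : A ⟶ D} {Q : A ⟶ B} (ν : P ≫ dual g ⟶ Q) :
    unhatₗ F g P Q ν = (biadj g).unhat ν := by
  refine .trans (b := ((ρ_ P).inv ≫ P ◁ (biadj g).coadj.unit ≫ (α_ _ _ _).inv) ≫ ν ▷ g) rfl ?_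
  simp [Biadjunction.unhat]

variable (F) in
/-- `uncheck` as a linear map. -/
def uncheckₗ (g : B ⟶ D) (P : A ⟶ D) (Q : A ⟶ B) :
    C.Hom₂ Q (P ≫ dual g) →ₗ[F] C.Hom₂ (Q ≫ g) P :=
  (vₗ F).flip ((α_ _ _ _).hom ≫ P ◁ (biadj g).adj.counit ≫ (ρ_ P).hom) ∘ₗ
    (hₗ F).flip (idHom₂ g)

/-- By simplicity α is a scalar multiple c of the identity, so its trace is c times dim_q(b). In
this form the quantum dimension is never divided by, and its being nonzero is not needed. -/
theorem IsBasis.qdim_smul_comp {𝓑 : Finset (C.Hom A B)} (h𝓑 : IsBasis F 𝓑) {b : C.Hom A B}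
    (hb : b ∈ 𝓑) {K : C.Hom A B} (ν : C.Hom₂ K b) (α : C.Hom₂ b b) :
    qdim F b • vHom₂ ν α = traceₗ F b α • ν := by
  obtain ⟨c, rfl⟩ := (h𝓑.simple b hb).2 α
  have h₁ : traceₗ F b (c • idHom₂ b) = c * qdim F b := by
    rw [map_smul, smul_eq_mul]
    congr 1
    exact congrArg (traceₗ F b) (v_idHom₂ _).symm
  rw [h₁, mul_comm, mul_smul]
  exact congrArg _ ((FLinear.v_smul c ν (idHom₂ b)).trans (congrArg (c • ·) (v_idHom₂ ν)))

/-- The resolution of the identity of `X g*` by the members of a basis. -/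
theorem IsBasis.resolution [NonDegenerate F C] {𝓑 : Finset (C.Hom A D)} (h𝓑 : IsBasis F 𝓑)
    (X : A ⟶ B) (g : D ⟶ B) (n : C.Hom A D → ℕ)
    (x : ∀ s : C.Hom A D, Fin (n s) → C.Hom₂ X (homComp s g))
    (y : ∀ s : C.Hom A D, Fin (n s) → C.Hom₂ (homComp s g) X)
    (hx : ∀ s, ∀ v, v = ∑ i, pairing F X (homComp s g) v (y s i) • x s i) :
    ∑ s ∈ 𝓑, qdim F s • ∑ i, vHom₂ ((biadj g).hat (x s i)) ((biadj g).check (y s i)) =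
      idHom₂ (homComp X (homStar g)) := by
  let K : C.Hom A D := homComp X (homStar g)
  let ξ (s : C.Hom A D) (i : Fin (n s)) : C.Hom₂ K s := (biadj g).hat (x s i)
  let η (s : C.Hom A D) (i : Fin (n s)) : C.Hom₂ s K := (biadj g).check (y s i)
  let R : C.Hom₂ K K := ∑ s ∈ 𝓑, qdim F s • ∑ i, vHom₂ (ξ s i) (η s i)
  change R = idHom₂ K
  -- It suffices that R acts as the identity on 2-morphisms into members of the basis, because K is
  -- a direct sum of such members.
  have key (b : C.Hom A D) (hb : b ∈ 𝓑) (ν : C.Hom₂ K b) : vHom₂ R ν = ν := by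
    have h₁ : vHom₂ R ν = ∑ s ∈ 𝓑, qdim F s • ∑ i, vHom₂ (ξ s i) (vHom₂ (η s i) ν) := by
      refine .trans (b := (vₗ F).flip ν R) rfl ?_
      refine (map_sum ((vₗ F).flip ν) _ _).trans (Finset.sum_congr rfl fun s _ => ?_)
      refine (map_smul ((vₗ F).flip ν) _ _).trans (congrArg _ ?_)
      exact (map_sum ((vₗ F).flip ν) _ _).trans
        (Finset.sum_congr rfl fun i _ => vHom₂_assoc _ _ _)
    -- The mate of ν lies in 2Hom(X, b g) and is expanded in the dual family there. By cyclicity and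
    -- closing of g, each coefficient is the trace over b of an endomorphism of b.
    have h₂ : ν = ∑ i, traceₗ F b (vHom₂ (η b i) ν) • ξ b i := by
      have h₃ := congrArg (hatₗ F g X b) (hx b ((biadj g).unhat (Q := b) ν))
      refine ((biadj g).hat_unhat (Q := b) ν).symm.trans (h₃.trans ?_)
      refine (map_sum (hatₗ F g X b) _ _).trans (Finset.sum_congr rfl fun i _ => ?_)
      refine (map_smul (hatₗ F g X b) _ _).trans (congrArg (· • ξ b i) ?_)
      refine (trace_comm (g := homComp b g) ((biadj g).unhat ν) (y b i)).trans ?_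
      refine (trace_ptr b g _).trans (congrArg (traceₗ F b) ?_)
      refine ((biadj g).check_comp_hat _ _).symm.trans ?_
      exact congrArg (vHom₂ (η b i)) ((biadj g).hat_unhat (Q := b) ν)
    -- Terms with s different from b contain a 2-morphism between distinct simple 1-morphisms and
    -- vanish. In the term s = b the weight dim_q(b) turns the scalar endomorphism into its trace,
    -- which reproduces the expansion `h₂`.
    rw [h₁, Finset.sum_eq_single b]
    · conv_rhs => rw [h₂]
      rw [Finset.smul_sum]
      exact Finset.sum_congr rfl fun i _ => h𝓑.qdim_smul_comp hb _ _
    · intro s hs hsb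
      rw [Finset.sum_eq_zero, smul_zero]
      intro i _
      rw [h𝓑.orthogonal s hs b hb hsb (vHom₂ (η s i) ν)]
      exact map_zero (vₗ F _)
    · exact fun h => (h hb).elim
  obtain ⟨m, h, hh, incl, proj, -, -, hsum⟩ := h𝓑.generates K
  calc R = vHom₂ R (∑ k, vHom₂ (proj k) (incl k)) := by rw [hsum, v_idHom₂]
    _ = ∑ k, vHom₂ (proj k) (incl k) := by
      refine (map_sum (vₗ F R) _ _).trans (Finset.sum_congr rfl fun k _ => ?_)
      exact (vHom₂_assoc _ _ _).symm.trans (congrArg (vHom₂ · _) (key _ (hh k) _))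
    _ = _ := hsum

end Resolution

end DualTwoCategory

namespace DualTwoCategory

/-! ## Strict functors preserving duals, and decomposition along a basis -/

/-- A strict endofunctor of the underlying strict 2-category that preserves duals. -/
structure DualityFunctor (C : DualTwoCategory.{u, v, w}) where
  obj : C.Obj → C.Obj
  mor : C.Mor → C.Mor
  cell : C.Cell → C.Cell
  src_mor (f : C.Mor) : C.src (mor f) = obj (C.src f)
  tgt_mor (f : C.Mor) : C.tgt (mor f) = obj (C.tgt f)
  dom_cell (α : C.Cell) : C.dom (cell α) = mor (C.dom α)
  cod_cell (α : C.Cell) : C.cod (cell α) = mor (C.cod α)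
  mor_comp (f g : C.Mor) : C.tgt f = C.src g → mor (f ⨾ g) = mor f ⨾ mor g
  cell_idc (f : C.Mor) : cell (𝕀 f) = 𝕀 (mor f)
  cell_vcomp (α β : C.Cell) : C.cod α = C.dom β → cell (α ⊙ᵥ β) = cell α ⊙ᵥ cell β
  cell_hcomp (α β : C.Cell) : C.tgt (C.dom α) = C.src (C.dom β) →
    cell (α ⊙ₕ β) = cell α ⊙ₕ cell β
  mor_star₁ (f : C.Mor) : C.star₁ (mor f) = mor (C.star₁ f)
  cell_i₁ (f : C.Mor) : C.i₁ (mor f) = cell (C.i₁ f)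
  cell_e₁ (f : C.Mor) : C.e₁ (mor f) = cell (C.e₁ f)

/-- The functor `X ⊗ -`. -/
def lTensFunctor {C : DualTwoCategory.{u, v, w}} (X : C.Obj) : DualityFunctor C where
  obj := C.tensor X
  mor := C.lTensor X
  cell := C.lTensor₂ X
  src_mor := C.law.src_lTensor X
  tgt_mor := C.law.tgt_lTensor X
  dom_cell := C.law.dom_lTensor₂ X
  cod_cell := C.law.cod_lTensor₂ X
  mor_comp := C.law.lTensor_comp X
  cell_idc := C.law.lTensor₂_idc X
  cell_vcomp := C.law.lTensor₂_vcomp X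
  cell_hcomp := C.law.lTensor₂_hcomp X
  mor_star₁ := C.law.star₁_lTensor X
  cell_i₁ := C.law.i₁_lTensor X
  cell_e₁ := C.law.e₁_lTensor X

/-- The functor `- ⊗ X`. -/
def rTensFunctor {C : DualTwoCategory.{u, v, w}} (X : C.Obj) : DualityFunctor C where
  obj A := C.tensor A X
  mor f := C.rTensor f X
  cell α := C.rTensor₂ α X
  src_mor f := C.law.src_rTensor f X
  tgt_mor f := C.law.tgt_rTensor f X
  dom_cell α := C.law.dom_rTensor₂ α X
  cod_cell α := C.law.cod_rTensor₂ α X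
  mor_comp f g := C.law.comp_rTensor f g X
  cell_idc f := C.law.idc_rTensor₂ f X
  cell_vcomp α β := C.law.vcomp_rTensor₂ α β X
  cell_hcomp α β := C.law.hcomp_rTensor₂ α β X
  mor_star₁ f := C.law.star₁_rTensor f X
  cell_i₁ f := C.law.i₁_rTensor f X
  cell_e₁ f := C.law.e₁_rTensor f X

namespace DualityFunctor

open CategoryTheory Bicategory

variable {C : DualTwoCategory.{u, v, w}} {A B D A' B' D' : C.Obj} (Φ : DualityFunctor C)

/-- The action on 1-morphisms. -/
def map (f : A ⟶ B) : Φ.obj A ⟶ Φ.obj B :=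
  ⟨Φ.mor f.1, (Φ.src_mor _).trans (congrArg _ f.2.1), (Φ.tgt_mor _).trans (congrArg _ f.2.2)⟩

/-- The action on 2-morphisms. -/
def map₂ {f g : A ⟶ B} (α : f ⟶ g) : Φ.map f ⟶ Φ.map g :=
  ⟨Φ.cell α.1, (Φ.dom_cell _).trans (congrArg _ α.2.1), (Φ.cod_cell _).trans (congrArg _ α.2.2)⟩

theorem map₂_comp {f g h : A ⟶ B} (α : f ⟶ g) (β : g ⟶ h) :
    Φ.map₂ (α ≫ β) = Φ.map₂ α ≫ Φ.map₂ β :=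
  Subtype.ext (Φ.cell_vcomp _ _ (vcomposable α β))

theorem cell_h {f f' : A ⟶ B} {g g' : B ⟶ D} (α : f ⟶ f') (β : g ⟶ g') :
    Φ.cell (α.1 ⊙ₕ β.1) = Φ.cell α.1 ⊙ₕ Φ.cell β.1 :=
  Φ.cell_hcomp _ _ (hcomposable α β)

/-- The operation α ↦ 1_x ∘ Φ(α) places a 2-morphism inside a larger word: x stands for the letters
in front, and Φ adjoins an object on one side. The context lemmas show that this operation respects
the calculus of mates and partial traces. -/
theorem context_h (x : A' ⟶ Φ.obj A) {f f' : A ⟶ B} {g g' : B ⟶ D} (α : f ⟶ f') (β : g ⟶ g') :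
    𝕀 x.1 ⊙ₕ Φ.cell (α.1 ⊙ₕ β.1) = (𝕀 x.1 ⊙ₕ Φ.cell α.1) ⊙ₕ Φ.cell β.1 := by
  rw [cell_h]
  exact (hHom₂_assoc (idHom₂ x) (Φ.map₂ α) (Φ.map₂ β)).symm

theorem context_v (x : A' ⟶ Φ.obj A) {f g h : A ⟶ B} (α : f ⟶ g) (β : g ⟶ h) :
    𝕀 x.1 ⊙ₕ Φ.cell (α.1 ⊙ᵥ β.1) = (𝕀 x.1 ⊙ₕ Φ.cell α.1) ⊙ᵥ (𝕀 x.1 ⊙ₕ Φ.cell β.1) := by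
  have h := whiskerLeft_comp x (Φ.map₂ α) (Φ.map₂ β)
  rw [← map₂_comp] at h
  exact congrArg Subtype.val h

theorem context_id (x : A' ⟶ Φ.obj A) (f : A ⟶ B) {Q : A' ⟶ B'} (hQ : Q.1 = x.1 ⨾ Φ.mor f.1) :
    𝕀 x.1 ⊙ₕ Φ.cell (𝕀 f.1) = 𝕀 Q.1 := by
  rw [Φ.cell_idc, hQ]
  exact C.law.idc_hcomp_idc _ _ (composable x (Φ.map f))

section

variable {x : A' ⟶ Φ.obj A} {X : A ⟶ B} {g : D ⟶ B} {s : A ⟶ D} {P : A' ⟶ B'} {G : D' ⟶ B'}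
  {Q : A' ⟶ D'}

/-- Bending uses only a dual and a counit, both of which Φ preserves. The data in the larger word
are described by their underlying 1-morphisms and 2-morphisms, so that any bracketing of the word is
allowed. -/
theorem context_hat (hG : G.1 = Φ.mor g.1) (hQ : Q.1 = x.1 ⨾ Φ.mor s.1)
    (m : X ⟶ s ≫ g) (M : P ⟶ Q ≫ G) (hM : M.1 = 𝕀 x.1 ⊙ₕ Φ.cell m.1) :
    ((biadj G).hat M).1 = 𝕀 x.1 ⊙ₕ Φ.cell ((biadj g).hat m).1 := by
  let p : X ≫ dual g ⟶ s ≫ g ≫ dual g := m ▷ dual g ≫ (α_ _ _ _).hom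
  let q : s ≫ g ≫ dual g ⟶ s := s ◁ counitCell' g ≫ (ρ_ s).hom
  have h : (biadj g).hat m = p ≫ q := by simp [Biadjunction.hat, p, q, biadj]
  have hp : p.1 = m.1 ⊙ₕ 𝕀 (C.star₁ g.1) := comp_associator_hom_val _ _ _ _
  have hq : q.1 = 𝕀 s.1 ⊙ₕ C.e₁ (C.star₁ g.1) := comp_rightUnitor_hom_val _ _
  have h₁ : ((biadj G).hat M).1 =
      (M.1 ⊙ₕ 𝕀 (C.star₁ G.1)) ⊙ᵥ (𝕀 Q.1 ⊙ₕ C.e₁ (C.star₁ G.1)) :=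
    congrArg (C.vcomp _) ((associator_hom_comp_val _ _ _ _).trans (comp_rightUnitor_hom_val _ _))
  have e₁ := Φ.context_h x m (𝟙 (dual g))
  have e₂ := Φ.context_h x (𝟙 s) (counitCell' g)
  have e₃ := Φ.context_v x p q
  rw [h]
  refine h₁.trans (.trans ?_ e₃.symm)
  rw [hp, hq]
  refine congrArg₂ C.vcomp (.trans ?_ e₁.symm) (.trans ?_ e₂.symm)
  · rw [hM, hG, Φ.mor_star₁]
    exact congrArg (C.hcomp _) (Φ.cell_idc _).symm
  · rw [hG, Φ.mor_star₁, Φ.cell_e₁]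
    exact congrArg (C.hcomp · _) (Φ.context_id x s hQ).symm

theorem context_check (hG : G.1 = Φ.mor g.1) (hQ : Q.1 = x.1 ⨾ Φ.mor s.1)
    (m : s ≫ g ⟶ X) (M : Q ≫ G ⟶ P) (hM : M.1 = 𝕀 x.1 ⊙ₕ Φ.cell m.1) :
    ((biadj G).check M).1 = 𝕀 x.1 ⊙ₕ Φ.cell ((biadj g).check m).1 := by
  let p : s ≫ g ≫ dual g ⟶ X ≫ dual g := (α_ _ _ _).inv ≫ m ▷ dual g
  let q : s ⟶ s ≫ g ≫ dual g := (ρ_ s).inv ≫ s ◁ unitCell g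
  have h : (biadj g).check m = q ≫ p := by simp [Biadjunction.check, p, q, biadj]
  have hp : p.1 = m.1 ⊙ₕ 𝕀 (C.star₁ g.1) := associator_inv_comp_val _ _ _ _
  have hq : q.1 = 𝕀 s.1 ⊙ₕ C.i₁ g.1 := rightUnitor_inv_comp_val _ _
  have h₁ : ((biadj G).check M).1 =
      (𝕀 Q.1 ⊙ₕ C.i₁ G.1) ⊙ᵥ (M.1 ⊙ₕ 𝕀 (C.star₁ G.1)) :=
    (rightUnitor_inv_comp_val _ _).trans (congrArg (C.vcomp _) (associator_inv_comp_val _ _ _ _))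
  have e₁ := Φ.context_h x m (𝟙 (dual g))
  have e₂ := Φ.context_h x (𝟙 s) (unitCell g)
  have e₃ := Φ.context_v x q p
  rw [h]
  refine h₁.trans (.trans ?_ e₃.symm)
  rw [hp, hq]
  refine congrArg₂ C.vcomp (.trans ?_ e₂.symm) (.trans ?_ e₁.symm)
  · rw [hG, Φ.cell_i₁]
    exact congrArg (C.hcomp · _) (Φ.context_id x s hQ).symm
  · rw [hM, hG, Φ.mor_star₁]
    exact congrArg (C.hcomp _) (Φ.cell_idc _).symm

end

section Linear

variable (F : Type*) [Field F] [Additive C] [VectLinear F C]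

/-- The action on 2-morphisms is linear. -/
structure IsLinear : Prop where
  map_add {A B : C.Obj} {f g : A ⟶ B} (α β : C.Hom₂ f g) :
    (show C.Hom₂ (Φ.map f) (Φ.map g) from Φ.map₂ (f := f) (g := g) (α + β)) =
      (show C.Hom₂ (Φ.map f) (Φ.map g) from Φ.map₂ (f := f) (g := g) α) +
        (show C.Hom₂ (Φ.map f) (Φ.map g) from Φ.map₂ (f := f) (g := g) β)
  map_smul {A B : C.Obj} {f g : A ⟶ B} (c : F) (α : C.Hom₂ f g) :
    (show C.Hom₂ (Φ.map f) (Φ.map g) from Φ.map₂ (f := f) (g := g) (c • α)) =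
      c • (show C.Hom₂ (Φ.map f) (Φ.map g) from Φ.map₂ (f := f) (g := g) α)

theorem isLinear_lTens (X : C.Obj) : (lTensFunctor X).IsLinear F where
  map_add := FLinear.lHom₂_add F X
  map_smul := FLinear.lHom₂_smul X

theorem isLinear_rTens (X : C.Obj) : (rTensFunctor X).IsLinear F where
  map_add := FLinear.rHom₂_add F X
  map_smul := FLinear.rHom₂_smul X

variable {Φ F}

/-- The action on 2-morphisms as a linear map. -/
def mapₗ (hΦ : Φ.IsLinear F) (f g : A ⟶ B) : C.Hom₂ f g →ₗ[F] C.Hom₂ (Φ.map f) (Φ.map g) where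
  toFun α := Φ.map₂ (f := f) (g := g) α
  map_add' := hΦ.map_add
  map_smul' := hΦ.map_smul

/-- The linear map given by the context is applied to the resolution of the identity of X g*. The
sum stays indexed by the simple 1-morphisms s of the small Hom-category, although the 1-morphisms `Q
s` of the larger one need not be simple. -/
theorem context_resolution [NonDegenerate F C] (hΦ : Φ.IsLinear F)
    {𝓑 : Finset (C.Hom A D)} (h𝓑 : IsBasis F 𝓑)
    {X : A ⟶ B} {g : D ⟶ B} {n : C.Hom A D → ℕ}
    {x : ∀ s : C.Hom A D, Fin (n s) → C.Hom₂ X (homComp s g)}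
    {y : ∀ s : C.Hom A D, Fin (n s) → C.Hom₂ (homComp s g) X}
    (hx : ∀ s, ∀ v, v = ∑ i, pairing F X (homComp s g) v (y s i) • x s i)
    {x₀ : A' ⟶ Φ.obj A} {P : A' ⟶ B'} {G : D' ⟶ B'} {Q : C.Hom A D → (A' ⟶ D')}
    (hP : P.1 = x₀.1 ⨾ Φ.mor X.1) (hG : G.1 = Φ.mor g.1)
    (hQ : ∀ s, (Q s).1 = x₀.1 ⨾ Φ.mor s.1)
    (M : ∀ s, Fin (n s) → (P ⟶ Q s ≫ G)) (hM : ∀ s i, (M s i).1 = 𝕀 x₀.1 ⊙ₕ Φ.cell (x s i).1)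
    (M' : ∀ s, Fin (n s) → (Q s ≫ G ⟶ P)) (hM' : ∀ s i, (M' s i).1 = 𝕀 x₀.1 ⊙ₕ Φ.cell (y s i).1) :
    ∑ s ∈ 𝓑, qdim F s • ∑ i, vHom₂ ((biadj G).hat (M s i)) ((biadj G).check (M' s i)) =
      idHom₂ (homComp P (homStar G)) := by
  have hPG : (homComp x₀ (Φ.map (X ≫ dual g))).1 = (homComp P (homStar G)).1 := by
    refine .trans ?_ (congrArg₂ C.comp hP.symm ((Φ.mor_star₁ g.1).symm.trans
      (congrArg C.star₁ hG.symm)))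
    refine .trans ?_ (homComp_assoc x₀ (Φ.map X) (Φ.map (dual g))).symm
    exact congrArg (C.comp _) (Φ.mor_comp _ _ (composable X (dual g)))
  let L : C.Hom₂ (X ≫ dual g) (X ≫ dual g) →ₗ[F]
      C.Hom₂ (homComp P (homStar G)) (homComp P (homStar G)) :=
    recast F hPG hPG ∘ₗ hₗ F (idHom₂ x₀) ∘ₗ mapₗ hΦ _ _
  have h := congrArg L (h𝓑.resolution X g n x y hx)
  have h₁ : L (idHom₂ (homComp X (homStar g))) = idHom₂ (homComp P (homStar G)) :=
    Subtype.ext ((Φ.context_id x₀ (X ≫ dual g) (Q := homComp x₀ (Φ.map (X ≫ dual g))) rfl).trans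
      (congrArg C.idc hPG))
  rw [h₁] at h
  refine .trans ?_ h
  refine .trans ?_ (map_sum L _ _).symm
  refine Finset.sum_congr rfl fun s _ => ?_
  refine .trans (congrArg _ ?_) (map_smul L _ _).symm
  refine .trans ?_ (map_sum L _ _).symm
  refine Finset.sum_congr rfl fun i _ => Subtype.ext ?_
  refine .trans ?_ (Φ.context_v x₀ ((biadj g).hat (x s i)) ((biadj g).check (y s i))).symm
  exact congrArg₂ C.vcomp (Φ.context_hat hG (hQ s) _ _ (hM s i))
    (Φ.context_check hG (hQ s) _ _ (hM' s i))

/-- The resolution of the identity of P G* is inserted in front of the mate of κ. Each middle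
composite is then a partial trace by `check_comp_hat`, and bending back gives the claim. -/
theorem decomposition_left {𝓑 : Finset (C.Hom A D)} {n : C.Hom A D → ℕ}
    {P : A' ⟶ B'} {G : D' ⟶ B'} {Q : C.Hom A D → (A' ⟶ D')}
    {M : ∀ s, Fin (n s) → (P ⟶ Q s ≫ G)} {M' : ∀ s, Fin (n s) → (Q s ≫ G ⟶ P)}
    (h : ∑ s ∈ 𝓑, qdim F s • ∑ i, vHom₂ ((biadj G).hat (M s i)) ((biadj G).check (M' s i)) =
      idHom₂ (homComp P (homStar G))) {Y : A' ⟶ D'} (κ : C.Hom₂ P (homComp Y G)) :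
    κ = ∑ s ∈ 𝓑, qdim F s • ∑ i, vHom₂ (M s i) ((biadj G).ptr (M' s i ≫ κ) ▷ G) := by
  let L : C.Hom₂ (P ≫ dual G) (P ≫ dual G) →ₗ[F] C.Hom₂ P (homComp Y G) :=
    unhatₗ F G P Y ∘ₗ (vₗ F).flip ((biadj G).hat (Q := Y) κ)
  have h₁ : L (idHom₂ (homComp P (homStar G))) = κ := by
    refine (congrArg (unhatₗ F G P Y) (idHom₂_v _)).trans ?_
    exact (unhatₗ_apply G _).trans ((biadj G).unhat_hat (Q := Y) κ)
  refine h₁.symm.trans ((congrArg L h.symm).trans ?_)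
  refine (map_sum L _ _).trans (Finset.sum_congr rfl fun s _ => ?_)
  refine (map_smul L _ _).trans (congrArg _ ?_)
  refine (map_sum L _ _).trans (Finset.sum_congr rfl fun i _ => ?_)
  refine (congrArg (unhatₗ F G P Y) (vHom₂_assoc _ _ _)).trans ((unhatₗ_apply G _).trans ?_)
  refine .trans ?_ (congrArg (fun z => vHom₂ (M s i) (z ▷ G)) ((biadj G).check_comp_hat _ _))
  exact (biadj G).unhat_hat_comp _ _

/-- The mirror argument: the resolution is inserted behind the other mate of κ. -/
theorem decomposition_right {𝓑 : Finset (C.Hom A D)} {n : C.Hom A D → ℕ}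
    {P : A' ⟶ B'} {G : D' ⟶ B'} {Q : C.Hom A D → (A' ⟶ D')}
    {M : ∀ s, Fin (n s) → (P ⟶ Q s ≫ G)} {M' : ∀ s, Fin (n s) → (Q s ≫ G ⟶ P)}
    (h : ∑ s ∈ 𝓑, qdim F s • ∑ i, vHom₂ ((biadj G).hat (M s i)) ((biadj G).check (M' s i)) =
      idHom₂ (homComp P (homStar G))) {Y : A' ⟶ D'} (κ : C.Hom₂ (homComp Y G) P) :
    κ = ∑ s ∈ 𝓑, qdim F s • ∑ i, vHom₂ ((biadj G).ptr (κ ≫ M s i) ▷ G) (M' s i) := by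
  let L : C.Hom₂ (P ≫ dual G) (P ≫ dual G) →ₗ[F] C.Hom₂ (homComp Y G) P :=
    uncheckₗ F G P Y ∘ₗ vₗ F ((biadj G).check (Q := Y) κ)
  have h₁ : L (idHom₂ (homComp P (homStar G))) = κ := by
    refine (congrArg (uncheckₗ F G P Y) (v_idHom₂ _)).trans ?_
    exact (biadj G).uncheck_check (Q := Y) κ
  refine h₁.symm.trans ((congrArg L h.symm).trans ?_)
  refine (map_sum L _ _).trans (Finset.sum_congr rfl fun s _ => ?_)
  refine (map_smul L _ _).trans (congrArg _ ?_)
  refine (map_sum L _ _).trans (Finset.sum_congr rfl fun i _ => ?_)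
  refine (congrArg (uncheckₗ F G P Y) (vHom₂_assoc _ _ _).symm).trans ?_
  refine .trans ?_ (congrArg (fun z => vHom₂ (z ▷ G) (M' s i)) ((biadj G).check_comp_hat _ _))
  exact (biadj G).uncheck_comp_check _ _

end Linear

end DualityFunctor

end DualTwoCategory

/-! ## Contractions of tensors -/

section Contraction

open scoped TensorProduct
open DualTwoCategory

variable {F : Type*} [Field F]

/-- Contraction of the first tensor factor with a linear form. -/
noncomputable def contract {V : Type*} (R : Type*) [AddCommGroup V] [AddCommGroup R] [Module F V]
    [Module F R] (φ : V →ₗ[F] F) : V ⊗[F] R →ₗ[F] R :=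
  (TensorProduct.lid F R).toLinearMap ∘ₗ φ.rTensor R

section

variable {V R S : Type*} [AddCommGroup V] [AddCommGroup R] [AddCommGroup S] [Module F V]
  [Module F R] [Module F S] (φ : V →ₗ[F] F)

@[simp]
theorem contract_tmul (v : V) (r : R) : contract R φ (v ⊗ₜ r) = φ v • r := by
  simp [contract]

theorem contract_lTensor (f : R →ₗ[F] S) (z : V ⊗[F] R) :
    contract S φ (f.lTensor V z) = f (contract R φ z) := by
  induction z with
  | zero => simp
  | tmul x y => simp
  | add x y hx hy => simp [hx, hy]

theorem contract_assoc (z : V ⊗[F] R) (s : S) :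
    contract (R ⊗[F] S) φ (TensorProduct.assoc F V R S (z ⊗ₜ s)) = contract R φ z ⊗ₜ s := by
  induction z with
  | zero => simp
  | tmul x y => simp [TensorProduct.smul_tmul']
  | add x y hx hy => simp [TensorProduct.add_tmul, hx, hy]

theorem contract_leftComm {W : Type*} [AddCommGroup W] [Module F W] (w : W) (z : V ⊗[F] R) :
    contract (W ⊗[F] R) φ (TensorProduct.leftComm F W V R (w ⊗ₜ z)) = w ⊗ₜ contract R φ z := by
  induction z with
  | zero => simp
  | tmul x y => simp
  | add x y hx hy => simp [TensorProduct.tmul_add, hx, hy]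

/-- This inserts a dual family into one tensor factor. It serves both to expand intermediate tensors
and, through `ext_contract`, to test equality by contraction. -/
theorem eq_sum_contract {n : ℕ} {x : Fin n → V} {y : Fin n → V →ₗ[F] F}
    (h : ∀ v, v = ∑ i, y i v • x i) (z : V ⊗[F] R) :
    z = ∑ i, x i ⊗ₜ contract R (y i) z := by
  induction z with
  | zero => simp
  | tmul v r =>
    conv_lhs => rw [h v]
    simp [TensorProduct.sum_tmul, TensorProduct.smul_tmul]
  | add x y hx hy =>
    conv_lhs => rw [hx, hy]
    simp [TensorProduct.tmul_add, Finset.sum_add_distrib]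

theorem ext_contract {n : ℕ} {x : Fin n → V} {y : Fin n → V →ₗ[F] F}
    (h : ∀ v, v = ∑ i, y i v • x i) {z z' : V ⊗[F] R}
    (hz : ∀ i, contract R (y i) z = contract R (y i) z') : z = z' := by
  rw [eq_sum_contract h z, eq_sum_contract h z']
  simp only [hz]

end

section

variable {V₁ V₂ V₃ W₁ W₂ W₃ R : Type*} [AddCommGroup V₁] [AddCommGroup V₂] [AddCommGroup V₃]
  [AddCommGroup W₁] [AddCommGroup W₂] [AddCommGroup W₃] [AddCommGroup R] [Module F V₁]
  [Module F V₂] [Module F V₃] [Module F W₁] [Module F W₂] [Module F W₃] [Module F R]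

theorem contract_tensorRight (L : V₁ ⊗[F] V₂ →ₗ[F] W₁ ⊗[F] (W₂ ⊗[F] W₃)) (φ : W₁ →ₗ[F] F)
    (a : V₁) (b : V₂) (r : R) :
    contract _ φ (tensorRight R L (a ⊗ₜ (b ⊗ₜ r))) =
      TensorProduct.assoc F W₂ W₃ R (contract _ φ (L (a ⊗ₜ b)) ⊗ₜ r) := by
  rw [← contract_assoc, ← LinearEquiv.coe_coe, ← contract_lTensor]
  rfl

theorem contract_contract_tensorRight (L : V₁ ⊗[F] V₂ →ₗ[F] W₁ ⊗[F] (W₂ ⊗[F] W₃))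
    (φ : W₁ →ₗ[F] F) (ψ : W₂ →ₗ[F] F) (a : V₁) (b : V₂) (r : R) :
    contract _ ψ (contract _ φ (tensorRight R L (a ⊗ₜ (b ⊗ₜ r)))) =
      contract _ ψ (contract _ φ (L (a ⊗ₜ b))) ⊗ₜ r := by
  rw [contract_tensorRight, contract_assoc]

end

variable {V₁ V₂ V₃ W₁ W₂ W₃ U₁ U₂ U₃ Y₁ Y₂ Y₃ : Type*}
  [AddCommGroup V₁] [AddCommGroup V₂] [AddCommGroup V₃]
  [AddCommGroup W₁] [AddCommGroup W₂] [AddCommGroup W₃]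
  [AddCommGroup U₁] [AddCommGroup U₂] [AddCommGroup U₃]
  [AddCommGroup Y₁] [AddCommGroup Y₂] [AddCommGroup Y₃]
  [Module F V₁] [Module F V₂] [Module F V₃] [Module F W₁] [Module F W₂] [Module F W₃]
  [Module F U₁] [Module F U₂] [Module F U₃] [Module F Y₁] [Module F Y₂] [Module F Y₃]

/-- Complete contraction of the composite of partition functions on the right-hand side. -/
theorem contract_comp_right (L₁ : V₁ ⊗[F] V₂ →ₗ[F] W₁ ⊗[F] (W₂ ⊗[F] W₃))
    (L₂ : W₂ ⊗[F] V₃ →ₗ[F] U₁ ⊗[F] (U₂ ⊗[F] U₃))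
    (L₃ : W₃ ⊗[F] U₃ →ₗ[F] Y₁ ⊗[F] (Y₂ ⊗[F] Y₃))
    (w₁ : W₁ →ₗ[F] F) (u₁ : U₁ →ₗ[F] F) (u₂ : U₂ →ₗ[F] F) (y₁ : Y₁ →ₗ[F] F) (y₂ : Y₂ →ₗ[F] F)
    (y₃ : Y₃ →ₗ[F] F)
    {n₂ n₃ n : ℕ} {p₂ : Fin n₂ → W₂} {q₂ : Fin n₂ → W₂ →ₗ[F] F}
    {p₃ : Fin n₃ → W₃} {q₃ : Fin n₃ → W₃ →ₗ[F] F} {p : Fin n → U₃} {q : Fin n → U₃ →ₗ[F] F}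
    (h₂ : ∀ v, v = ∑ i, q₂ i v • p₂ i) (h₃ : ∀ v, v = ∑ i, q₃ i v • p₃ i)
    (h : ∀ v, v = ∑ i, q i v • p i) (a : V₁) (b : V₂) (c : V₃) :
    y₃ (contract _ y₂ (contract _ y₁ (contract _ u₂ (contract _ u₁ (contract _ w₁
      ((((L₃.lTensor U₂).lTensor U₁).lTensor W₁ ∘ₗ
        (((swapLast U₃ W₃).lTensor U₂).lTensor U₁).lTensor W₁ ∘ₗ
        (tensorRight W₃ L₂).lTensor W₁ ∘ₗ
        ((swapLast W₃ V₃).lTensor W₂).lTensor W₁ ∘ₗ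
        tensorRight V₃ L₁) (a ⊗ₜ (b ⊗ₜ c)))))))) =
    ∑ i, ∑ j, ∑ k, q₃ j (contract _ (q₂ i) (contract _ w₁ (L₁ (a ⊗ₜ b)))) *
      (q k (contract _ u₂ (contract _ u₁ (L₂ (p₂ i ⊗ₜ c)))) *
        y₃ (contract _ y₂ (contract _ y₁ (L₃ (p₃ j ⊗ₜ p k))))) := by
  simp only [LinearMap.comp_apply, contract_lTensor, contract_tensorRight]
  generalize contract _ w₁ (L₁ (a ⊗ₜ b)) = Z
  -- The factors W₂, W₃ and U₃ are produced by one map and consumed by a later one; they play the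
  -- role of the interior state spaces. Each is expanded in its dual family, after which the three
  -- maps decouple into scalars.
  conv_lhs => rw [eq_sum_contract h₂ Z]
  simp only [TensorProduct.sum_tmul, map_sum, TensorProduct.assoc_tmul, LinearMap.lTensor_tmul]
  refine Finset.sum_congr rfl fun i _ => ?_
  conv_lhs => rw [h₃ (contract _ (q₂ i) Z)]
  simp only [TensorProduct.sum_tmul, TensorProduct.tmul_sum, map_sum, swapLast,
    LinearEquiv.coe_coe, TensorProduct.comm_tmul, contract_contract_tensorRight]
  refine Finset.sum_congr rfl fun j _ => ?_
  conv_lhs => rw [h (contract _ u₂ (contract _ u₁ (L₂ (p₂ i ⊗ₜ c))))]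
  simp only [TensorProduct.tmul_sum, map_sum, TensorProduct.tmul_smul, map_smul, smul_eq_mul,
    ← TensorProduct.smul_tmul']
  refine Finset.sum_congr rfl fun k _ => ?_
  ring

/-- Complete contraction of the composite of partition functions on the left-hand side. -/
theorem contract_comp_left (L₁ : V₂ ⊗[F] V₃ →ₗ[F] U₁ ⊗[F] (U₂ ⊗[F] U₃))
    (L₂ : V₁ ⊗[F] U₂ →ₗ[F] Y₁ ⊗[F] (Y₂ ⊗[F] Y₃))
    (L₃ : Y₁ ⊗[F] U₁ →ₗ[F] W₁ ⊗[F] (W₂ ⊗[F] W₃))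
    (w₁ : W₁ →ₗ[F] F) (w₂ : W₂ →ₗ[F] F) (w₃ : W₃ →ₗ[F] F) (y₂ : Y₂ →ₗ[F] F) (y₃ : Y₃ →ₗ[F] F)
    (u₃ : U₃ →ₗ[F] F)
    {n₁ n₂ n : ℕ} {p₁ : Fin n₁ → U₁} {q₁ : Fin n₁ → U₁ →ₗ[F] F}
    {p₂ : Fin n₂ → U₂} {q₂ : Fin n₂ → U₂ →ₗ[F] F} {p : Fin n → Y₁} {q : Fin n → Y₁ →ₗ[F] F}
    (h₁ : ∀ v, v = ∑ i, q₁ i v • p₁ i) (h₂ : ∀ v, v = ∑ i, q₂ i v • p₂ i)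
    (h : ∀ v, v = ∑ i, q i v • p i) (a : V₁) (b : V₂) (c : V₃) :
    u₃ (contract _ y₃ (contract _ w₃ (contract _ y₂ (contract _ w₂ (contract _ w₁
      ((((swapHead W₃ Y₂ (Y₃ ⊗[F] U₃)).lTensor W₂).lTensor W₁ ∘ₗ
        tensorRight (Y₂ ⊗[F] (Y₃ ⊗[F] U₃)) L₃ ∘ₗ
        swapHead U₁ Y₁ (Y₂ ⊗[F] (Y₃ ⊗[F] U₃)) ∘ₗ
        (tensorRight U₃ L₂).lTensor U₁ ∘ₗ
        swapHead V₁ U₁ (U₂ ⊗[F] U₃) ∘ₗ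
        L₁.lTensor V₁) (a ⊗ₜ (b ⊗ₜ c)))))))) =
    ∑ i, ∑ j, ∑ k, u₃ (contract _ (q₂ j) (contract _ (q₁ i) (L₁ (b ⊗ₜ c)))) *
      (y₃ (contract _ y₂ (contract _ (q k) (L₂ (a ⊗ₜ p₂ j)))) *
        w₃ (contract _ w₂ (contract _ w₁ (L₃ (p k ⊗ₜ p₁ i))))) := by
  simp only [LinearMap.comp_apply, LinearMap.lTensor_tmul]
  generalize L₁ (b ⊗ₜ c) = Z
  -- Here the intermediate factors are U₁ and U₂, produced by `L₁`, and Y₁, produced by `L₂`.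
  conv_lhs => rw [eq_sum_contract h₁ Z]
  simp only [TensorProduct.tmul_sum, map_sum, swapHead, LinearEquiv.coe_coe,
    TensorProduct.leftComm_tmul, LinearMap.lTensor_tmul]
  refine Finset.sum_congr rfl fun i _ => ?_
  generalize contract _ (q₁ i) Z = Z'
  conv_lhs => rw [eq_sum_contract h₂ Z']
  simp only [TensorProduct.tmul_sum, map_sum]
  refine Finset.sum_congr rfl fun j _ => ?_
  generalize contract _ (q₂ j) Z' = z
  conv_lhs => rw [eq_sum_contract h (tensorRight _ L₂ _)]
  simp only [TensorProduct.tmul_sum, map_sum,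
    TensorProduct.leftComm_tmul, contract_tensorRight, contract_lTensor, LinearEquiv.coe_coe]
  refine Finset.sum_congr rfl fun k _ => ?_
  rw [contract_assoc, contract_leftComm, contract_assoc, contract_tmul,
    map_smul, contract_tmul, map_smul, map_smul, smul_eq_mul, smul_eq_mul]
  ring

end Contraction

namespace DualTwoCategory

/-! ## Words of labels -/

section Words

open CategoryTheory Bicategory

variable {C : DualTwoCategory.{u, v, w}} {A B D E K L M N : C.Obj}

theorem head_val {x₁ : A ⟶ B} {x₂ : B ⟶ D} {y₁ : A ⟶ K} {y₂ : K ⟶ D} (α : x₁ ≫ x₂ ⟶ y₁ ≫ y₂)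
    (z : D ⟶ E) : (head α z).1 = α.1 ⊙ₕ 𝕀 z.1 :=
  (associator_inv_comp_val _ _ _ _).trans (comp_associator_hom_val _ _ _ _)

theorem whiskerLeft_associator_hom_comp_val (x : A ⟶ B) (f : B ⟶ D) (g : D ⟶ E) (h : E ⟶ K)
    {k : A ⟶ K} (α : x ≫ f ≫ g ≫ h ⟶ k) : (x ◁ (α_ f g h).hom ≫ α).1 = α.1 := by
  have e : x ◁ (α_ f g h).hom =
      (eqIso (congrArg (C.comp x.1) (homComp_assoc f g h)) : x ≫ (f ≫ g) ≫ h ≅ x ≫ f ≫ g ≫ h).hom :=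
    Subtype.ext (h_eqCell x (homComp_assoc f g h))
  rw [e]
  exact eqIso_hom_comp_val _ _

theorem comp_whiskerLeft_associator_inv_val (x : A ⟶ B) (f : B ⟶ D) (g : D ⟶ E) (h : E ⟶ K)
    {k : A ⟶ K} (α : k ⟶ x ≫ f ≫ g ≫ h) : (α ≫ x ◁ (α_ f g h).inv).1 = α.1 := by
  have e : x ◁ (α_ f g h).inv =
      (eqIso (congrArg (C.comp x.1) (homComp_assoc f g h)) : x ≫ (f ≫ g) ≫ h ≅ x ≫ f ≫ g ≫ h).inv :=
    Subtype.ext (h_eqCell x (homComp_assoc f g h).symm)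
  rw [e]
  exact comp_eqIso_inv_val _ _

/-- The partial trace of a 2-morphism between words of three letters. -/
def ptr₂ {x : A ⟶ B} {y : B ⟶ D} {x' : A ⟶ K} {y' : K ⟶ D} (g : D ⟶ E)
    (κ : x ≫ y ≫ g ⟶ x' ≫ y' ≫ g) : x ≫ y ⟶ x' ≫ y' :=
  (biadj g).ptr ((α_ _ _ _).hom ≫ κ ≫ (α_ _ _ _).inv)

section

variable {F : Type*} [Field F] [Additive C] [VectLinear F C]

/-- Since k leaves the last letter g alone, that letter can be closed around κ only: cyclicity moves
k out of the way and `trace_ptr` closes g. -/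
theorem trace_head {x : A ⟶ B} {y : B ⟶ D} {x' : A ⟶ K} {y' : K ⟶ D} {g : D ⟶ E}
    (k : x ≫ y ⟶ x' ≫ y') (κ : x' ≫ y' ≫ g ⟶ x ≫ y ≫ g) :
    traceₗ F (x ≫ y ≫ g) (head k g ≫ κ) = traceₗ F (x ≫ y) (k ≫ ptr₂ g κ) := by
  have h : (head k g ≫ κ : x ≫ y ≫ g ⟶ x ≫ y ≫ g) =
      (α_ _ _ _).inv ≫ (k ▷ g ≫ (α_ _ _ _).hom ≫ κ) := by simp [head]
  refine (congrArg (traceₗ F (x ≫ y ≫ g)) h).trans ?_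
  refine (trace_comm _ _).trans ?_
  refine (trace_ptr (x ≫ y) g _).trans (congrArg (traceₗ F (x ≫ y)) ?_)
  rw [ptr₂, ← Biadjunction.comp_ptr]
  simp

theorem trace_head₃ {x : A ⟶ B} {y : B ⟶ D} {z : D ⟶ L} {x' : A ⟶ K} {y' : K ⟶ M} {z' : M ⟶ L}
    {g : L ⟶ E} (k : x ≫ y ≫ z ⟶ x' ≫ y' ≫ z') (κ : x' ≫ y' ≫ z' ≫ g ⟶ x ≫ y ≫ z ≫ g) :
    traceₗ F (x ≫ y ≫ z ≫ g) (head₃ k g ≫ κ) = traceₗ F (x ≫ y ≫ z) (k ≫ (biadj g).ptr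
      ((α_ _ _ _).hom ≫ x' ◁ (α_ _ _ _).hom ≫ κ ≫ x ◁ (α_ _ _ _).inv ≫ (α_ _ _ _).inv)) := by
  have h : (head₃ k g ≫ κ : x ≫ y ≫ z ≫ g ⟶ x ≫ y ≫ z ≫ g) =
      (x ◁ (α_ _ _ _).inv ≫ (α_ _ _ _).inv) ≫
        (k ▷ g ≫ (α_ _ _ _).hom ≫ x' ◁ (α_ _ _ _).hom ≫ κ) := by simp [head₃]
  refine (congrArg (traceₗ F (x ≫ y ≫ z ≫ g)) h).trans ?_
  refine (trace_comm _ _).trans ?_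
  refine (trace_ptr (x ≫ y ≫ z) g _).trans (congrArg (traceₗ F (x ≫ y ≫ z)) ?_)
  rw [← Biadjunction.comp_ptr]
  simp

end

namespace DualityFunctor

variable (Φ : DualityFunctor C)

/-- A partial trace is a composite of two mates, one of them the mate of an identity, and mates
commute with contexts. -/
theorem context_ptr {A' B' D' : C.Obj} {x : A' ⟶ Φ.obj A} {g : D ⟶ B} {s s' : A ⟶ D}
    {G : D' ⟶ B'} {Q Q' : A' ⟶ D'} (hG : G.1 = Φ.mor g.1) (hQ : Q.1 = x.1 ⨾ Φ.mor s.1)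
    (hQ' : Q'.1 = x.1 ⨾ Φ.mor s'.1) (m : s ≫ g ⟶ s' ≫ g) (κ : Q ≫ G ⟶ Q' ≫ G)
    (hκ : κ.1 = 𝕀 x.1 ⊙ₕ Φ.cell m.1) :
    ((biadj G).ptr κ).1 = 𝕀 x.1 ⊙ₕ Φ.cell ((biadj g).ptr m).1 := by
  have hQG : (Q ≫ G).1 = x.1 ⨾ Φ.mor (s ≫ g).1 := by
    refine .trans (congrArg₂ C.comp hQ hG) (.trans (homComp_assoc x (Φ.map s) (Φ.map g)) ?_)
    exact congrArg (C.comp _) (Φ.mor_comp _ _ (composable s g)).symm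
  have h₁ : (biadj G).ptr κ = (biadj G).check (𝟙 (Q ≫ G)) ≫ (biadj G).hat κ := by
    rw [Biadjunction.check_comp_hat, Category.id_comp]
  have h₂ : (biadj g).ptr m = (biadj g).check (𝟙 (s ≫ g)) ≫ (biadj g).hat m := by
    rw [Biadjunction.check_comp_hat, Category.id_comp]
  rw [h₁, h₂]
  refine .trans (congrArg₂ C.vcomp ?_ ?_) (Φ.context_v x _ _).symm
  · exact Φ.context_check hG hQ _ _ (Φ.context_id x (s ≫ g) hQG).symm
  · exact Φ.context_hat hG hQ' _ _ hκ

/-- Read from left to right, this undoes a partial trace that sits inside a context: the closed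
letter G reappears at the end of the word, and the 2-morphisms hidden in the partial trace become
ordinary members of the chain. -/
theorem trace_context {F : Type*} [Field F] [Additive C] [VectLinear F C]
    {A' B' D' K' M' : C.Obj} {x₀ : A' ⟶ Φ.obj A} {x : A ⟶ B} {y : B ⟶ D} {x' : A ⟶ K}
    {y' : K ⟶ D} {g : D ⟶ E} {X : Φ.obj A ⟶ B'} {Y : B' ⟶ D'} {X' : Φ.obj A ⟶ K'} {Y' : K' ⟶ D'}
    {G : D' ⟶ M'} (hX : X.1 = Φ.mor x.1) (hY : Y.1 = Φ.mor y.1) (hX' : X'.1 = Φ.mor x'.1)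
    (hY' : Y'.1 = Φ.mor y'.1) (hG : G.1 = Φ.mor g.1)
    (m : x ≫ y ≫ g ⟶ x' ≫ y' ≫ g) (μ : x₀ ≫ X ≫ Y ⟶ x₀ ≫ X' ≫ Y')
    (hμ : μ.1 = 𝕀 x₀.1 ⊙ₕ Φ.cell (ptr₂ g m).1)
    (κ : x₀ ≫ X ≫ Y ≫ G ⟶ x₀ ≫ X' ≫ Y' ≫ G) (hκ : κ.1 = 𝕀 x₀.1 ⊙ₕ Φ.cell m.1)
    (k : x₀ ≫ X' ≫ Y' ⟶ x₀ ≫ X ≫ Y) :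
    traceₗ F (x₀ ≫ X' ≫ Y') (k ≫ μ) = traceₗ F (x₀ ≫ X' ≫ Y' ≫ G) (head₃ k G ≫ κ) := by
  rw [trace_head₃]
  congr 2
  apply Subtype.ext
  have h : ((α_ _ _ _).hom ≫ m ≫ (α_ _ _ _).inv : (x ≫ y) ≫ g ⟶ (x' ≫ y') ≫ g).1 = m.1 :=
    (associator_hom_comp_val _ _ _ _).trans (comp_associator_inv_val _ _ _ _)
  refine hμ.trans (Φ.context_ptr (s := x ≫ y) (s' := x' ≫ y') hG ?_ ?_
    ((α_ _ _ _).hom ≫ m ≫ (α_ _ _ _).inv) _ ?_).symm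
  · refine congrArg (C.comp _) ((congrArg₂ C.comp hX hY).trans ?_)
    exact (Φ.mor_comp _ _ (composable x y)).symm
  · refine congrArg (C.comp _) ((congrArg₂ C.comp hX' hY').trans ?_)
    exact (Φ.mor_comp _ _ (composable x' y')).symm
  · rw [h, ← hκ]
    refine (associator_hom_comp_val _ _ _ _).trans ?_
    refine (whiskerLeft_associator_hom_comp_val _ _ _ _ _).trans ?_
    rw [← Category.assoc]
    exact (comp_associator_inv_val _ _ _ _).trans (comp_whiskerLeft_associator_inv_val _ _ _ _ _)

end DualityFunctor

end Words

end DualTwoCategory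

namespace CategoryTheory.Bicategory

/-- Two ways of traversing a closed chain of 2-morphisms of four-letter words have the same trace if
`hp` and `hu` relate the tensorators in them. -/
theorem trace_word_eq {B : Type*} [Bicategory B] {R : Type*}
    {o p₁ p₂ p₃ p₄ p₅ p₆ p₇ p₈ p₉ q₁ q₂ q₃ q₄ q₅ W : B} (T : ∀ f : o ⟶ W, (f ⟶ f) → R)
    (hT : ∀ {f g : o ⟶ W} (α : f ⟶ g) (β : g ⟶ f), T f (α ≫ β) = T g (β ≫ α))
    {a₁ : o ⟶ p₁} {a₂ : p₁ ⟶ p₂} {a₃ : p₂ ⟶ p₃} {a₄ : p₃ ⟶ W}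
    {b₁ : o ⟶ p₄} {b₂ : p₄ ⟶ p₂} {c₂ : p₄ ⟶ p₅} {c₃ : p₅ ⟶ p₃}
    {d₁ : o ⟶ p₆} {d₂ : p₆ ⟶ p₅} {v₁ : p₆ ⟶ p₇} {y₃ : p₇ ⟶ p₃}
    {l₃ : p₇ ⟶ p₈} {k₃ : p₈ ⟶ W} {n : p₆ ⟶ p₉} {j : p₉ ⟶ p₈}
    {g₁ : o ⟶ q₁} {g₂ : q₁ ⟶ p₉} {h₂ : q₁ ⟶ q₂} {h₃ : q₂ ⟶ p₈} {i₂ : p₁ ⟶ q₂}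
    {m₃ : q₂ ⟶ q₃} {m₄ : q₃ ⟶ W} {w₁ : p₂ ⟶ q₃}
    {w₃ : p₅ ⟶ q₄} {z₃ : q₄ ⟶ W} {o₃ : p₉ ⟶ q₄} {x₁ : p₄ ⟶ q₅} {z₅ : q₅ ⟶ q₃} {g₆ : q₅ ⟶ q₄}
    (a : a₁ ≫ a₂ ⟶ b₁ ≫ b₂) (b : b₁ ≫ c₂ ⟶ d₁ ≫ d₂) (c : d₁ ≫ n ⟶ g₁ ≫ g₂)
    (p : d₂ ≫ c₃ ⟶ v₁ ≫ y₃) (p' : o₃ ≫ z₃ ⟶ j ≫ k₃) (q : g₂ ≫ j ⟶ h₂ ≫ h₃)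
    (r : g₁ ≫ h₂ ⟶ a₁ ≫ i₂) (s : h₃ ≫ k₃ ⟶ m₃ ≫ m₄) (t : i₂ ≫ m₃ ⟶ a₂ ≫ w₁)
    (u : w₁ ≫ m₄ ⟶ a₃ ≫ a₄) (u' : x₁ ≫ g₆ ⟶ c₂ ≫ w₃)
    (t₀ : b₂ ≫ a₃ ⟶ c₂ ≫ c₃) (t₁ : c₃ ≫ a₄ ⟶ w₃ ≫ z₃) (t₂ : d₂ ≫ w₃ ⟶ n ≫ o₃)
    (t₃ : y₃ ≫ a₄ ⟶ l₃ ≫ k₃) (t₄ : v₁ ≫ l₃ ⟶ n ≫ j) (t₅ : b₂ ≫ w₁ ⟶ x₁ ≫ z₅)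
    (t₆ : z₅ ≫ m₄ ⟶ g₆ ≫ z₃)
    (hp : head p a₄ ≫ v₁ ◁ t₃ ≫ head t₄ k₃ = d₂ ◁ t₁ ≫ head t₂ z₃ ≫ n ◁ p')
    (hu : head t₅ m₄ ≫ x₁ ◁ t₆ ≫ head u' z₃ = b₂ ◁ u ≫ head t₀ a₄ ≫ c₂ ◁ t₁) :
    T (g₁ ≫ h₂ ≫ m₃ ≫ m₄) (head₃ (head r m₃ ≫ a₁ ◁ t) m₄ ≫ head a (w₁ ≫ m₄) ≫
      b₁ ◁ head t₅ m₄ ≫ b₁ ◁ x₁ ◁ t₆ ≫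
      head₃ (b₁ ◁ u' ≫ head b w₃ ≫ d₁ ◁ t₂ ≫ head c o₃) z₃ ≫
      g₁ ◁ (g₂ ◁ p' ≫ head q k₃ ≫ h₂ ◁ s)) =
    T (a₁ ≫ a₂ ≫ a₃ ≫ a₄) (head₃ (head a a₃ ≫ b₁ ◁ t₀ ≫ head b c₃ ≫ d₁ ◁ p) a₄ ≫
      d₁ ◁ v₁ ◁ t₃ ≫ head₃ (d₁ ◁ t₄ ≫ head c j ≫ g₁ ◁ q ≫ head r h₃) k₃ ≫
      a₁ ◁ (i₂ ◁ s ≫ head t m₄ ≫ a₂ ◁ u)) := by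
  -- The path π₁ contains a, b, p, c, q and the path π₂ contains r, s, t, u; together they form the
  -- second cycle. The path π₃ contains everything but s, so it completes s to the first cycle.
  let π₁ : a₁ ≫ a₂ ≫ a₃ ≫ a₄ ⟶ g₁ ≫ h₂ ≫ h₃ ≫ k₃ :=
    head a (a₃ ≫ a₄) ≫ b₁ ◁ head t₀ a₄ ≫ head b (c₃ ≫ a₄) ≫
      d₁ ◁ (head p a₄ ≫ v₁ ◁ t₃ ≫ head t₄ k₃) ≫ head c (j ≫ k₃) ≫ g₁ ◁ head q k₃
  let π₂ : g₁ ≫ h₂ ≫ h₃ ≫ k₃ ⟶ a₁ ≫ a₂ ≫ a₃ ≫ a₄ :=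
    head r (h₃ ≫ k₃) ≫ a₁ ◁ i₂ ◁ s ≫ a₁ ◁ head t m₄ ≫ a₁ ◁ a₂ ◁ u
  let π₃ : g₁ ≫ h₂ ≫ m₃ ≫ m₄ ⟶ g₁ ≫ h₂ ≫ h₃ ≫ k₃ :=
    head r (m₃ ≫ m₄) ≫ a₁ ◁ head t m₄ ≫ a₁ ◁ a₂ ◁ u ≫ π₁
  have e₁ : head₃ (head r m₃ ≫ a₁ ◁ t) m₄ ≫ head a (w₁ ≫ m₄) ≫
      b₁ ◁ head t₅ m₄ ≫ b₁ ◁ x₁ ◁ t₆ ≫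
      head₃ (b₁ ◁ u' ≫ head b w₃ ≫ d₁ ◁ t₂ ≫ head c o₃) z₃ ≫
      g₁ ◁ (g₂ ◁ p' ≫ head q k₃ ≫ h₂ ◁ s) = π₃ ≫ g₁ ◁ h₂ ◁ s := by
    -- `hu` moves u in front of the tensorators, and `hp` moves p in front of those that it meets.
    -- The rest is interchange of a, b and c with 2-morphisms on later letters.
    have hu' := congrArg (b₁ ◁ ·) hu
    simp only [whiskerLeft_comp] at hu'
    have hu'' {f : o ⟶ W} (k : b₁ ≫ c₂ ≫ w₃ ≫ z₃ ⟶ f) := hu' =≫ k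
    simp only [Category.assoc] at hu''
    simp only [π₃, π₁, head₃_comp, head₃_cons, head₃_head, Category.assoc, whiskerLeft_comp, hp]
    rw [hu'', ← head_exchange_assoc a, head_exchange_assoc b, head_exchange_assoc c]
  have e₂ : head₃ (head a a₃ ≫ b₁ ◁ t₀ ≫ head b c₃ ≫ d₁ ◁ p) a₄ ≫
      d₁ ◁ v₁ ◁ t₃ ≫ head₃ (d₁ ◁ t₄ ≫ head c j ≫ g₁ ◁ q ≫ head r h₃) k₃ ≫
      a₁ ◁ (i₂ ◁ s ≫ head t m₄ ≫ a₂ ◁ u) = π₁ ≫ π₂ := by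
    simp only [π₂, π₁, head₃_comp, head₃_cons, head₃_head, Category.assoc, whiskerLeft_comp]
  -- Here s acts on the last two letters and r on the first two, so they commute.
  have e₃ : g₁ ◁ h₂ ◁ s ≫ π₃ = π₂ ≫ π₁ := by
    simp only [π₃, π₂, Category.assoc, ← head_exchange_assoc]
  rw [e₁, e₂, hT, e₃, hT]

end CategoryTheory.Bicategory

namespace DualTwoCategory

/-! ## Labels and tensorators as letters and 2-morphisms of words -/

section Letters

open CategoryTheory Bicategory

variable {C : DualTwoCategory.{u, v, w}} {A B D E K L M N X Y : C.Obj}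

/-- `f ⊗ X` for a label `f`. -/
def rLetter (f : A ⟶ B ⊠ D) (X : C.Obj) : A ⊠ X ⟶ B ⊠ D ⊠ X :=
  castTgt (C.law.tensor_assoc _ _ _) (homR f X)

theorem comp_lTens_val (X : C.Obj) (x : A ⟶ B) (y : B ⟶ D) :
    X ⊲ (x ≫ y).1 = (lTens X x ≫ lTens X y).1 :=
  homL_homComp X x y

theorem comp_rLetter_val (f : A ⟶ B ⊠ D) (g : B ⟶ K ⊠ L) (X : C.Obj) :
    (f ≫ rLetter g D).1 ⊳ X = (rLetter f X ≫ rLetter g (D ⊠ X)).1 :=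
  (homR_homComp f (rLetter g D) X).trans
    (congrArg (C.comp _) (C.law.rTensor_tensor _ _ _).symm)

theorem comp_lTens_rLetter_val (f : A ⟶ B ⊠ D) (g : D ⟶ K ⊠ L) (X : C.Obj) :
    (f ≫ lTens B g).1 ⊳ X = (rLetter f X ≫ lTens B (rLetter g X)).1 :=
  (homR_homComp f (lTens B g) X).trans
    (congrArg (C.comp _) (C.law.lTensor_rTensor _ _ _))

/-- `X ⊗ α` for a 2-morphism `α` of words. -/
def lCell (X : C.Obj) {x : A ⟶ B} {y : B ⟶ D} {x' : A ⟶ K} {y' : K ⟶ D} (α : x ≫ y ⟶ x' ≫ y') :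
    lTens X x ≫ lTens X y ⟶ lTens X x' ≫ lTens X y' :=
  ⟨X ⊲₂ α.1, (lTens₂ X α).2.1.trans (comp_lTens_val X x y),
    (lTens₂ X α).2.2.trans (comp_lTens_val X x' y')⟩

/-- `α ⊗ X` for `α ∈ 2H(ijkl)`. -/
def rCell {f : A ⟶ B ⊠ D} {g : D ⟶ K ⊠ L} {f' : A ⟶ E ⊠ L} {g' : E ⟶ B ⊠ K}
    (α : f ≫ lTens B g ⟶ f' ≫ rLetter g' L) (X : C.Obj) :
    rLetter f X ≫ lTens B (rLetter g X) ⟶ rLetter f' X ≫ rLetter g' (L ⊠ X) :=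
  ⟨α.1 ⊳₂ X, (rTens₂ α X).2.1.trans (comp_lTens_rLetter_val f g X),
    (rTens₂ α X).2.2.trans (comp_rLetter_val f' g' X)⟩

/-- `α ⊗ X` for `α ∈ 2H'(ijkl)`. -/
def rCell' {f : A ⟶ B ⊠ D} {g : D ⟶ K ⊠ L} {f' : A ⟶ E ⊠ L} {g' : E ⟶ B ⊠ K}
    (α : f' ≫ rLetter g' L ⟶ f ≫ lTens B g) (X : C.Obj) :
    rLetter f' X ≫ rLetter g' (L ⊠ X) ⟶ rLetter f X ≫ lTens B (rLetter g X) :=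
  ⟨α.1 ⊳₂ X, (rTens₂ α X).2.1.trans (comp_rLetter_val f' g' X),
    (rTens₂ α X).2.2.trans (comp_lTens_rLetter_val f g X)⟩

/-- The tensorator of a label `f` and a 1-morphism `g`. -/
def tauCell (f : M ⟶ K ⊠ L) (g : A ⟶ B) :
    rLetter f A ≫ lTens K (lTens L g) ⟶ lTens M g ≫ rLetter f B :=
  ⟨τ f.1 g.1, (homTau f g).2.1.trans (congrArg (C.comp _) (C.law.tensor_lTensor _ _ _)),
    (homTau f g).2.2⟩

/-- The tensorator is natural in the label. -/
theorem rCell'_tauCell {f : A ⟶ B ⊠ D} {g : D ⟶ K ⊠ L} {f' : A ⟶ E ⊠ L} {g' : E ⟶ B ⊠ K}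
    (α : f' ≫ rLetter g' L ⟶ f ≫ lTens B g) (x : X ⟶ Y) :
    head (rCell' α X) (lTens B (lTens K (lTens L x))) ≫ rLetter f X ◁ lCell B (tauCell g x) ≫
        head (tauCell f x) (lTens B (rLetter g Y)) =
      rLetter f' X ◁ tauCell g' (lTens L x) ≫ head (tauCell f' x) (rLetter g' (L ⊠ Y)) ≫
        lTens A x ◁ rCell' α Y := by
  apply Subtype.ext
  -- Naturality is applied to α in the first variable and an identity in the second. The tensorators
  -- of the two composites are then split at their middle object by `tensorator_comp_left`.
  have h := C.law.tensorator_natural α.1 (𝕀 x.1)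
  rw [α.2.1, α.2.2, C.law.dom_idc, C.law.cod_idc] at h
  have h₁ : τ (f ≫ lTens B g).1 x.1 = _ :=
    C.law.tensorator_comp_left f.1 (lTens B g).1 x.1 (composable f (lTens B g))
  have h₂ : τ (f' ≫ rLetter g' L).1 x.1 = _ :=
    C.law.tensorator_comp_left f'.1 (rLetter g' L).1 x.1 (composable f' (rLetter g' L))
  rw [h₁, h₂] at h
  have hx : C.src x.1 = X := x.2.1
  have hy : C.tgt x.1 = Y := x.2.2
  have hA : C.src (f' ≫ rLetter g' L).1 = A := (f' ≫ rLetter g' L).2.1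
  have hB : C.tgt (f' ≫ rLetter g' L).1 = B ⊠ K ⊠ L := (f' ≫ rLetter g' L).2.2
  have hf : C.tgt f.1 = B ⊠ D := f.2.2
  rw [hx, hy, hA, hB, C.law.lTensor₂_idc, C.law.lTensor₂_idc, C.law.tensor_lTensor,
    C.law.tensor_lTensor] at h
  refine .trans ?_ (h.trans ?_)
  · refine congrArg₂ C.vcomp (head_val _ _) (congrArg₂ C.vcomp ?_
      ((head_val _ _).trans ?_))
    · exact congrArg (C.hcomp _) (C.law.tensorator_lTensor _ _ _).symm
    · exact congrArg (fun z => C.hcomp _ (C.idc z)) (C.law.lTensor_rTensor _ _ _).symm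
  · refine .trans ?_ (congrArg Subtype.val (Category.assoc (rLetter f' X ◁ tauCell g' (lTens L x))
      (head (tauCell f' x) (rLetter g' (L ⊠ Y))) (lTens A x ◁ rCell' α Y)))
    refine congrArg (C.vcomp · _) (congrArg₂ C.vcomp ?_ (.trans ?_ (head_val _ _).symm))
    · exact congrArg (C.hcomp _) (C.law.tensorator_middle _ _ _)
    · exact congrArg (fun z => C.hcomp _ (C.idc z)) (C.law.rTensor_tensor _ _ _).symm

/-- The tensorator is natural in the second variable. -/
theorem tauCell_natural (f : M ⟶ K ⊠ L) {x : A ⟶ B} {y : B ⟶ D} {x' : A ⟶ E} {y' : E ⟶ D}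
    (α : x ≫ y ⟶ x' ≫ y') :
    head (tauCell f x) (lTens K (lTens L y)) ≫ lTens M x ◁ tauCell f y ≫
        head (lCell M α) (rLetter f D) =
      rLetter f A ◁ lCell K (lCell L α) ≫ head (tauCell f x') (lTens K (lTens L y')) ≫
        lTens M x' ◁ tauCell f y' := by
  apply Subtype.ext
  -- The roles are exchanged: an identity in the first variable, and `tensorator_comp_right` splits
  -- the composites in the second.
  have h := C.law.tensorator_natural (𝕀 f.1) α.1
  rw [α.2.1, α.2.2, C.law.dom_idc, C.law.cod_idc] at h
  have h₁ : τ f.1 (x ≫ y).1 = _ :=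
    C.law.tensorator_comp_right f.1 x.1 y.1 (composable x y)
  have h₂ : τ f.1 (x' ≫ y').1 = _ :=
    C.law.tensorator_comp_right f.1 x'.1 y'.1 (composable x' y')
  have hA : C.src (x ≫ y).1 = A := (x ≫ y).2.1
  have hD : C.tgt (x ≫ y).1 = D := (x ≫ y).2.2
  have hf : C.src f.1 = M := f.2.1
  have hf' : C.tgt f.1 = K ⊠ L := f.2.2
  rw [h₁, h₂, hA, hD, hf, hf', C.law.idc_rTensor₂, C.law.idc_rTensor₂, C.law.tensor_lTensor,
    C.law.tensor_lTensor, C.law.tensor_lTensor₂] at h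
  refine .trans ?_ (h.symm.trans ?_)
  · refine .trans (congrArg Subtype.val (Category.assoc (head (tauCell f x) (lTens K (lTens L y)))
      (lTens M x ◁ tauCell f y) (head (lCell M α) (rLetter f D)))).symm ?_
    exact congrArg₂ C.vcomp (congrArg (C.vcomp · _) (head_val _ _)) (head_val _ _)
  · exact congrArg (C.vcomp _) (congrArg (C.vcomp · _)
      (head_val (tauCell f x') (lTens K (lTens L y'))).symm)

end Letters

end DualTwoCategory

namespace DualTwoCategory

/-! ## Evaluation of the form of a 4-simplex -/

section FourSimplex

open CategoryTheory Bicategory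
open scoped TensorProduct

variable {C : DualTwoCategory.{u, v, w}} {F : Type*} [Field F] [Additive C] [VectLinear F C]

theorem pairing_comm {A B : C.Obj} {f g : C.Hom A B} (α : C.Hom₂ f g) (β : C.Hom₂ g f) :
    pairing F f g α β = pairing F g f β α :=
  trace_comm (f := f) (g := g) α β

theorem trace_rotate {A B : C.Obj} {f g h k : A ⟶ B} (a : f ⟶ g) (b : g ⟶ h) (c : h ⟶ k)
    (d : k ⟶ f) : traceₗ F f ((a ≫ b ≫ c) ≫ d) = traceₗ F h (c ≫ d ≫ a ≫ b) := by
  refine .trans (congrArg (traceₗ F f) ?_) ((trace_comm (a ≫ b) (c ≫ d)).trans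
    (congrArg (traceₗ F h) (Category.assoc _ _ _)))
  simp only [Category.assoc]

theorem trace_rotate' {A B : C.Obj} {f g h k : A ⟶ B} (a : f ⟶ g) (b : g ⟶ h) (c : h ⟶ k)
    (d : k ⟶ f) : traceₗ F k (d ≫ a ≫ b ≫ c) = traceₗ F g (b ≫ c ≫ d ≫ a) := by
  refine .trans (congrArg (traceₗ F k) ?_) ((trace_comm (d ≫ a) (b ≫ c)).trans
    (congrArg (traceₗ F g) (Category.assoc _ _ _)))
  simp only [Category.assoc]

variable {e_ij e_jk e_kl e_lm e_ik e_jl e_km e_il e_jm e_im : C.Obj}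

/-- An element of `H(ijkl)` as a 2-morphism of words. -/
def word {f_ijk : e_ik ⟶ e_jk ⊠ e_ij} {f_ijl : e_il ⟶ e_jl ⊠ e_ij}
    {f_ikl : e_il ⟶ e_kl ⊠ e_ik} {f_jkl : e_jl ⟶ e_kl ⊠ e_jk}
    (α : H₂ f_ijk f_ijl f_ikl f_jkl) :
    f_ikl ≫ lTens e_kl f_ijk ⟶ f_ijl ≫ rLetter f_jkl e_ij := α

/-- An element of `H'(ijkl)` as a 2-morphism of words. -/
def word' {f_ijk : e_ik ⟶ e_jk ⊠ e_ij} {f_ijl : e_il ⟶ e_jl ⊠ e_ij}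
    {f_ikl : e_il ⟶ e_kl ⊠ e_ik} {f_jkl : e_jl ⟶ e_kl ⊠ e_jk}
    (α : H₂' f_ijk f_ijl f_ikl f_jkl) :
    f_ijl ≫ rLetter f_jkl e_ij ⟶ f_ikl ≫ lTens e_kl f_ijk := α

variable (f_ijk : e_ik ⟶ e_jk ⊠ e_ij) (f_ijl : e_il ⟶ e_jl ⊠ e_ij)
  (f_ijm : e_im ⟶ e_jm ⊠ e_ij) (f_ikl : e_il ⟶ e_kl ⊠ e_ik)
  (f_ikm : e_im ⟶ e_km ⊠ e_ik) (f_ilm : e_im ⟶ e_lm ⊠ e_il)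
  (f_jkl : e_jl ⟶ e_kl ⊠ e_jk) (f_jkm : e_jm ⟶ e_km ⊠ e_jk)
  (f_jlm : e_jm ⟶ e_lm ⊠ e_jl) (f_klm : e_km ⟶ e_lm ⊠ e_kl)

theorem glueSource_eq (β : H₂ f_ikl f_ikm f_ilm f_klm) (δ : H₂ f_ijk f_ijm f_ikm f_jkm) :
    glueSource F f_ijk f_ijm f_ikl f_ikm f_ilm f_jkm f_klm (β ⊗ₜ δ) =
      head (word β) (lTens e_lm (lTens e_kl f_ijk)) ≫ f_ikm ◁ tauCell f_klm f_ijk ≫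
        head (word δ) (rLetter f_klm (e_jk ⊠ e_ij)) := by
  apply Subtype.ext
  refine (glueSource_tmul ..).trans ?_
  exact congrArg₂ C.vcomp (head_val (word β) (lTens e_lm (lTens e_kl f_ijk))).symm
    (congrArg (C.vcomp _) (head_val (word δ) (rLetter f_klm (e_jk ⊠ e_ij))).symm)

theorem glueTarget_eq (α : H₂' f_jkl f_jkm f_jlm f_klm) (γ : H₂' f_ijl f_ijm f_ilm f_jlm)
    (ζ : H₂' f_ijk f_ijl f_ikl f_jkl) :
    glueTarget F f_ijk f_ijl f_ijm f_ikl f_ilm f_jkl f_jkm f_jlm f_klm (α ⊗ₜ (γ ⊗ₜ ζ)) =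
      f_ijm ◁ rCell' (word' α) e_ij ≫ head (word' γ) (lTens e_lm (rLetter f_jkl e_ij)) ≫
        f_ilm ◁ lCell e_lm (word' ζ) := by
  apply Subtype.ext
  refine (glueTarget_tmul ..).trans ?_
  exact congrArg (C.vcomp _) (congrArg (C.vcomp · _)
    (head_val (word' γ) (lTens e_lm (rLetter f_jkl e_ij))).symm)

/-- Cyclicity brings the chosen entry of the 4-simplex to the head of the closed chain. Closing the
letter that it does not touch presents the form as the pairing of this entry with one 2-morphism.
The next two lemmas do this for other entries. -/
theorem pairing_glueSource_right (β : H₂ f_ikl f_ikm f_ilm f_klm)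
    (δ : H₂ f_ijk f_ijm f_ikm f_jkm)
    (κ : f_ijm ≫ rLetter f_jkm e_ij ≫ rLetter f_klm (e_jk ⊠ e_ij) ⟶
      f_ilm ≫ lTens e_lm f_ikl ≫ lTens e_lm (lTens e_kl f_ijk)) :
    pairing F (leftPath₄ f_ijk f_ikl f_ilm) (rightPath₄ f_ijm f_jkm f_klm)
        (glueSource F f_ijk f_ijm f_ikl f_ikm f_ilm f_jkm f_klm (β ⊗ₜ δ)) κ =
      pairing F (leftPath f_ijk f_ikm) (rightPath f_ijm f_jkm) δ
        (ptr₂ (rLetter f_klm (e_jk ⊠ e_ij)) (κ ≫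
          head (word β) (lTens e_lm (lTens e_kl f_ijk)) ≫ f_ikm ◁ tauCell f_klm f_ijk)) := by
  rw [glueSource_eq]
  exact (trace_rotate _ _ _ κ).trans (trace_head (word δ) _)

theorem pairing_glueSource_left (β : H₂ f_ikl f_ikm f_ilm f_klm)
    (δ : H₂ f_ijk f_ijm f_ikm f_jkm)
    (κ : f_ijm ≫ rLetter f_jkm e_ij ≫ rLetter f_klm (e_jk ⊠ e_ij) ⟶
      f_ilm ≫ lTens e_lm f_ikl ≫ lTens e_lm (lTens e_kl f_ijk)) :
    pairing F (leftPath₄ f_ijk f_ikl f_ilm) (rightPath₄ f_ijm f_jkm f_klm)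
        (glueSource F f_ijk f_ijm f_ikl f_ikm f_ilm f_jkm f_klm (β ⊗ₜ δ)) κ =
      pairing F (leftPath f_ikl f_ilm) (rightPath f_ikm f_klm) β
        (ptr₂ (lTens e_lm (lTens e_kl f_ijk)) (f_ikm ◁ tauCell f_klm f_ijk ≫
          head (word δ) (rLetter f_klm (e_jk ⊠ e_ij)) ≫ κ)) := by
  rw [glueSource_eq]
  refine .trans (congrArg (traceₗ F (leftPath₄ f_ijk f_ikl f_ilm)) ?_) (trace_head (word β) _)
  exact (Category.assoc _ _ κ).trans (congrArg (_ ≫ ·) (Category.assoc _ _ κ))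

theorem pairing_glueTarget
    (κ : f_ilm ≫ lTens e_lm f_ikl ≫ lTens e_lm (lTens e_kl f_ijk) ⟶
      f_ijm ≫ rLetter f_jkm e_ij ≫ rLetter f_klm (e_jk ⊠ e_ij))
    (α : H₂' f_jkl f_jkm f_jlm f_klm) (γ : H₂' f_ijl f_ijm f_ilm f_jlm)
    (ζ : H₂' f_ijk f_ijl f_ikl f_jkl) :
    pairing F (leftPath₄ f_ijk f_ikl f_ilm) (rightPath₄ f_ijm f_jkm f_klm) κ
        (glueTarget F f_ijk f_ijl f_ijm f_ikl f_ilm f_jkl f_jkm f_jlm f_klm (α ⊗ₜ (γ ⊗ₜ ζ))) =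
      pairing F (leftPath f_ijl f_ilm) (rightPath f_ijm f_jlm)
        (ptr₂ (lTens e_lm (rLetter f_jkl e_ij)) (f_ilm ◁ lCell e_lm (word' ζ) ≫ κ ≫
          f_ijm ◁ rCell' (word' α) e_ij)) γ := by
  rw [glueTarget_eq]
  exact ((trace_rotate' _ _ _ κ).trans (trace_head (word' γ) _)).trans (trace_comm (word' γ) _)

end FourSimplex

end DualTwoCategory

namespace DualTwoCategory

/-! ### Complete contractions of a single partition function. -/

section Contraction

open scoped TensorProduct

variable {C : DualTwoCategory.{u, v, w}} {F : Type*} [Field F] [Additive C] [VectLinear F C]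
  [NonDegenerate F C]
variable {e_ij e_jk e_kl e_lm e_ik e_jl e_km e_il e_jm e_im : C.Obj}
variable (f_ijk : C.Hom e_ik (e_jk ⊠ e_ij)) (f_ijl : C.Hom e_il (e_jl ⊠ e_ij))
  (f_ijm : C.Hom e_im (e_jm ⊠ e_ij)) (f_ikl : C.Hom e_il (e_kl ⊠ e_ik))
  (f_ikm : C.Hom e_im (e_km ⊠ e_ik)) (f_ilm : C.Hom e_im (e_lm ⊠ e_il))
  (f_jkl : C.Hom e_jl (e_kl ⊠ e_jk)) (f_jkm : C.Hom e_jm (e_km ⊠ e_jk))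
  (f_jlm : C.Hom e_jm (e_lm ⊠ e_jl)) (f_klm : C.Hom e_km (e_lm ⊠ e_kl))

theorem contract_eq_targetDual (α : H₂' f_jkl f_jkm f_jlm f_klm) (γ : H₂' f_ijl f_ijm f_ilm f_jlm)
    (ζ : H₂' f_ijk f_ijl f_ikl f_jkl)
    (z : H₂ f_jkl f_jkm f_jlm f_klm ⊗[F] (H₂ f_ijl f_ijm f_ilm f_jlm ⊗[F]
      H₂ f_ijk f_ijl f_ikl f_jkl)) :
    (pairing F _ _).flip ζ (contract _ ((pairing F _ _).flip γ)
        (contract _ ((pairing F _ _).flip α) z)) =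
      targetDual F f_ijk f_ijl f_ijm f_ikl f_ilm f_jkl f_jkm f_jlm f_klm z (α ⊗ₜ (γ ⊗ₜ ζ)) := by
  induction z with
  | zero => simp
  | add x y hx hy => simp only [map_add, LinearMap.add_apply, hx, hy]
  | tmul x y =>
    induction y with
    | zero => simp
    | add y y' hy hy' => simp only [TensorProduct.tmul_add, map_add, LinearMap.add_apply, hy, hy']
    | tmul y z =>
      rw [targetDual_tmul, contract_tmul, map_smul, contract_tmul, map_smul, map_smul]
      rfl

theorem contract_Zpos (β : H₂ f_ikl f_ikm f_ilm f_klm) (δ : H₂ f_ijk f_ijm f_ikm f_jkm)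
    (α : H₂' f_jkl f_jkm f_jlm f_klm) (γ : H₂' f_ijl f_ijm f_ilm f_jlm)
    (ζ : H₂' f_ijk f_ijl f_ikl f_jkl) :
    (pairing F _ _).flip ζ (contract _ ((pairing F _ _).flip γ)
        (contract _ ((pairing F _ _).flip α)
          (Zpos F f_ijk f_ijl f_ijm f_ikl f_ikm f_ilm f_jkl f_jkm f_jlm f_klm (β ⊗ₜ δ)))) =
      pairing F _ _ (glueSource F f_ijk f_ijm f_ikl f_ikm f_ilm f_jkm f_klm (β ⊗ₜ δ))
        (glueTarget F f_ijk f_ijl f_ijm f_ikl f_ilm f_jkl f_jkm f_jlm f_klm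
          (α ⊗ₜ (γ ⊗ₜ ζ))) := by
  rw [contract_eq_targetDual, targetDual_Zpos]

end Contraction

end DualTwoCategory

/-- Both arguments of Q are expanded in dual families. It removes the sums over two interior state
spaces at once, replacing the dual bases in the middle factor by the 2-morphisms with which the
outer two factors pair them. -/
theorem LinearMap.sum_mul_dual_families {F V V' U U' : Type*} [Field F] [AddCommGroup V]
    [AddCommGroup V'] [AddCommGroup U] [AddCommGroup U'] [Module F V] [Module F V'] [Module F U]
    [Module F U'] (p : V →ₗ[F] V' →ₗ[F] F) (p' : U →ₗ[F] U' →ₗ[F] F)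
    (Q : V →ₗ[F] U' →ₗ[F] F) {n m : ℕ} {x : Fin n → V} {y : Fin n → V'} {x' : Fin m → U}
    {y' : Fin m → U'} (h : ∀ v, v = ∑ i, p v (y i) • x i) (h' : ∀ u, u = ∑ j, p' (x' j) u • y' j)
    (v : V) (u : U') :
    ∑ i, ∑ j, p v (y i) * (Q (x i) (y' j) * p' (x' j) u) = Q v u := by
  conv_rhs => rw [h v, h' u]
  simp only [map_sum, LinearMap.sum_apply, map_smul, LinearMap.smul_apply, smul_eq_mul,
    Finset.mul_sum]
  rw [Finset.sum_comm]
  refine Finset.sum_congr rfl fun i _ => Finset.sum_congr rfl fun j _ => ?_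
  ring

namespace DualTwoCategory

/-! ### Decomposition along a basis for 2-morphisms of three-letter words. -/

section WordDecomposition

open CategoryTheory Bicategory

variable {C : DualTwoCategory.{u, v, w}} {F : Type*} [Field F] [Additive C] [VectLinear F C]

/-- The linear form `κ ↦ tr(π · (κ ∘ z) · ρ)`. -/
noncomputable def traceHead₃ₗ (F : Type*) [Field F] [VectLinear F C]
    {A B D E K L M : C.Obj} {x₁ : A ⟶ B} {x₂ : B ⟶ D} {x₃ : D ⟶ E} {y₁ : A ⟶ K} {y₂ : K ⟶ L}
    {y₃ : L ⟶ E} {z : E ⟶ M} {g : A ⟶ M} (π : g ⟶ x₁ ≫ x₂ ≫ x₃ ≫ z)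
    (ρ : y₁ ≫ y₂ ≫ y₃ ≫ z ⟶ g) : C.Hom₂ (x₁ ≫ x₂ ≫ x₃) (y₁ ≫ y₂ ≫ y₃) →ₗ[F] F :=
  traceₗ F g ∘ₗ vₗ F (π ≫ x₁ ◁ (α_ _ _ _).inv ≫ (α_ _ _ _).inv) ∘ₗ
    (vₗ F).flip ((α_ _ _ _).hom ≫ y₁ ◁ (α_ _ _ _).hom ≫ ρ) ∘ₗ (hₗ F).flip (idHom₂ z)

theorem traceHead₃ₗ_apply
    {A B D E K L M : C.Obj} {x₁ : A ⟶ B} {x₂ : B ⟶ D} {x₃ : D ⟶ E} {y₁ : A ⟶ K} {y₂ : K ⟶ L}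
    {y₃ : L ⟶ E} {z : E ⟶ M} {g : A ⟶ M} (π : g ⟶ x₁ ≫ x₂ ≫ x₃ ≫ z)
    (ρ : y₁ ≫ y₂ ≫ y₃ ≫ z ⟶ g) (κ : x₁ ≫ x₂ ≫ x₃ ⟶ y₁ ≫ y₂ ≫ y₃) :
    traceHead₃ₗ F π ρ κ = traceₗ F g (π ≫ head₃ κ z ≫ ρ) := by
  refine .trans (b := traceₗ F g ((π ≫ x₁ ◁ (α_ _ _ _).inv ≫ (α_ _ _ _).inv) ≫
    κ ▷ z ≫ (α_ _ _ _).hom ≫ y₁ ◁ (α_ _ _ _).hom ≫ ρ)) rfl ?_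
  simp [head₃]

variable [NonDegenerate F C] {A B D A' B' D' K L : C.Obj} {Φ : DualityFunctor C}

/-- This is `decomposition_left` for right-bracketed words: the basis member enters as the second
letter, behind the fixed letter x₁. The maps `M` and `M'` only rebracket to isolate the last letter.
-/
theorem word_decomposition_left (hΦ : Φ.IsLinear F) {𝓑 : Finset (C.Hom A D)} (h𝓑 : IsBasis F 𝓑)
    {X : A ⟶ B} {g : D ⟶ B} {n : C.Hom A D → ℕ}
    {x : ∀ s : C.Hom A D, Fin (n s) → C.Hom₂ X (homComp s g)}
    {y : ∀ s : C.Hom A D, Fin (n s) → C.Hom₂ (homComp s g) X}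
    (hx : ∀ s, ∀ v, v = ∑ i, pairing F X (homComp s g) v (y s i) • x s i)
    {x₁ : A' ⟶ Φ.obj A} {x₂ : Φ.obj A ⟶ K} {x₃ : K ⟶ B'} {y₁ : A' ⟶ L} {y₂ : L ⟶ D'}
    {G : D' ⟶ B'} {Q : C.Hom A D → (Φ.obj A ⟶ D')}
    (hX : (x₂ ≫ x₃).1 = Φ.mor X.1) (hG : G.1 = Φ.mor g.1) (hQ : ∀ s, (Q s).1 = Φ.mor s.1)
    (μ : ∀ s, Fin (n s) → (x₂ ≫ x₃ ⟶ Q s ≫ G)) (hμ : ∀ s i, (μ s i).1 = Φ.cell (x s i).1)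
    (μ' : ∀ s, Fin (n s) → (Q s ≫ G ⟶ x₂ ≫ x₃)) (hμ' : ∀ s i, (μ' s i).1 = Φ.cell (y s i).1)
    (κ : C.Hom₂ (x₁ ≫ x₂ ≫ x₃) (y₁ ≫ y₂ ≫ G)) :
    κ = ∑ s ∈ 𝓑, qdim F s • ∑ i, vHom₂ (x₁ ◁ μ s i)
      (head (ptr₂ (x := x₁) (y := Q s) (x' := y₁) (y' := y₂) G (x₁ ◁ μ' s i ≫ κ)) G) := by
  let M (s i) : x₁ ≫ x₂ ≫ x₃ ⟶ (x₁ ≫ Q s) ≫ G := x₁ ◁ μ s i ≫ (α_ _ _ _).inv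
  let M' (s i) : (x₁ ≫ Q s) ≫ G ⟶ x₁ ≫ x₂ ≫ x₃ := (α_ _ _ _).hom ≫ x₁ ◁ μ' s i
  have h := DualityFunctor.decomposition_left (F := F) (Y := y₁ ≫ y₂) (Q := fun s => x₁ ≫ Q s)
    (M := M) (M' := M')
    (Φ.context_resolution hΦ h𝓑 hx (x₀ := x₁) (P := x₁ ≫ x₂ ≫ x₃) (G := G)
      (congrArg (C.comp _) hX) hG (fun s => congrArg (C.comp _) (hQ s)) M
      (fun s i => (comp_associator_inv_val _ _ _ _).trans (congrArg (C.hcomp _) (hμ s i))) M'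
      (fun s i => (associator_hom_comp_val _ _ _ _).trans (congrArg (C.hcomp _) (hμ' s i))))
    (vHom₂ κ (α_ y₁ y₂ G).inv)
  have h' := congrArg ((vₗ F).flip (α_ y₁ y₂ G).hom) h
  refine .trans ?_ (h'.trans ?_)
  · let κ' : x₁ ≫ x₂ ≫ x₃ ⟶ y₁ ≫ y₂ ≫ G := κ
    change κ' = (κ' ≫ (α_ y₁ y₂ G).inv) ≫ (α_ y₁ y₂ G).hom
    simp
  · refine (map_sum _ _ _).trans (Finset.sum_congr rfl fun s _ => ?_)
    refine (map_smul _ _ _).trans (congrArg _ ?_)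
    refine (map_sum _ _ _).trans (Finset.sum_congr rfl fun i _ => ?_)
    let κ' : x₁ ≫ x₂ ≫ x₃ ⟶ y₁ ≫ y₂ ≫ G := κ
    change (M s i ≫ (biadj G).ptr (M' s i ≫ κ' ≫ (α_ y₁ y₂ G).inv) ▷ G) ≫ (α_ y₁ y₂ G).hom =
      x₁ ◁ μ s i ≫ head (ptr₂ G (x₁ ◁ μ' s i ≫ κ')) G
    simp [M, M', head, ptr₂]

theorem word_decomposition_right (hΦ : Φ.IsLinear F) {𝓑 : Finset (C.Hom A D)} (h𝓑 : IsBasis F 𝓑)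
    {X : A ⟶ B} {g : D ⟶ B} {n : C.Hom A D → ℕ}
    {x : ∀ s : C.Hom A D, Fin (n s) → C.Hom₂ X (homComp s g)}
    {y : ∀ s : C.Hom A D, Fin (n s) → C.Hom₂ (homComp s g) X}
    (hx : ∀ s, ∀ v, v = ∑ i, pairing F X (homComp s g) v (y s i) • x s i)
    {x₁ : A' ⟶ Φ.obj A} {x₂ : Φ.obj A ⟶ K} {x₃ : K ⟶ B'} {y₁ : A' ⟶ L} {y₂ : L ⟶ D'}
    {G : D' ⟶ B'} {Q : C.Hom A D → (Φ.obj A ⟶ D')}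
    (hX : (x₂ ≫ x₃).1 = Φ.mor X.1) (hG : G.1 = Φ.mor g.1) (hQ : ∀ s, (Q s).1 = Φ.mor s.1)
    (μ : ∀ s, Fin (n s) → (x₂ ≫ x₃ ⟶ Q s ≫ G)) (hμ : ∀ s i, (μ s i).1 = Φ.cell (x s i).1)
    (μ' : ∀ s, Fin (n s) → (Q s ≫ G ⟶ x₂ ≫ x₃)) (hμ' : ∀ s i, (μ' s i).1 = Φ.cell (y s i).1)
    (κ : C.Hom₂ (y₁ ≫ y₂ ≫ G) (x₁ ≫ x₂ ≫ x₃)) :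
    κ = ∑ s ∈ 𝓑, qdim F s • ∑ i, vHom₂
      (head (ptr₂ (x := y₁) (y := y₂) (x' := x₁) (y' := Q s) G (κ ≫ x₁ ◁ μ s i)) G)
      (x₁ ◁ μ' s i) := by
  let M (s i) : x₁ ≫ x₂ ≫ x₃ ⟶ (x₁ ≫ Q s) ≫ G := x₁ ◁ μ s i ≫ (α_ _ _ _).inv
  let M' (s i) : (x₁ ≫ Q s) ≫ G ⟶ x₁ ≫ x₂ ≫ x₃ := (α_ _ _ _).hom ≫ x₁ ◁ μ' s i
  let κ' : y₁ ≫ y₂ ≫ G ⟶ x₁ ≫ x₂ ≫ x₃ := κ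
  have h := DualityFunctor.decomposition_right (F := F) (Y := y₁ ≫ y₂) (Q := fun s => x₁ ≫ Q s)
    (M := M) (M' := M')
    (Φ.context_resolution hΦ h𝓑 hx (x₀ := x₁) (P := x₁ ≫ x₂ ≫ x₃) (G := G)
      (congrArg (C.comp _) hX) hG (fun s => congrArg (C.comp _) (hQ s)) M
      (fun s i => (comp_associator_inv_val _ _ _ _).trans (congrArg (C.hcomp _) (hμ s i))) M'
      (fun s i => (associator_hom_comp_val _ _ _ _).trans (congrArg (C.hcomp _) (hμ' s i))))
    (vHom₂ (α_ y₁ y₂ G).hom κ)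
  have h' := congrArg (vₗ F (α_ y₁ y₂ G).inv) h
  refine .trans ?_ (h'.trans ?_)
  · change κ' = (α_ y₁ y₂ G).inv ≫ (α_ y₁ y₂ G).hom ≫ κ'
    simp
  · refine (map_sum _ _ _).trans (Finset.sum_congr rfl fun s _ => ?_)
    refine (map_smul _ _ _).trans (congrArg _ ?_)
    refine (map_sum _ _ _).trans (Finset.sum_congr rfl fun i _ => ?_)
    change (α_ y₁ y₂ G).inv ≫ (biadj G).ptr (((α_ y₁ y₂ G).hom ≫ κ') ≫ M s i) ▷ G ≫ M' s i =
      head (ptr₂ G (κ' ≫ x₁ ◁ μ s i)) G ≫ x₁ ◁ μ' s i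
    simp [M, M', head, ptr₂]

end WordDecomposition

end DualTwoCategory

namespace CategoryTheory.Bicategory

theorem comp_comp_comp_comp {V : Type*} [Category* V] {x₀ x₁ x₂ x₃ x₄ x₅ x₆ : V} (a : x₀ ⟶ x₁)
    (b : x₁ ⟶ x₂) (c : x₂ ⟶ x₃) (d : x₃ ⟶ x₄) (e : x₄ ⟶ x₅) (f : x₅ ⟶ x₆) :
    (a ≫ b ≫ c) ≫ d ≫ e ≫ f = (a ≫ b ≫ c ≫ d ≫ e) ≫ f := by
  simp only [Category.assoc]

variable {B : Type*} [Bicategory B] {R : Type*}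

/-- Cyclicity carries m and t from the end of the chain to its start. There t acts on letters that π
does not touch, so π can be moved in front of t and next to m. -/
theorem trace_slide_left {o p₁ p₂ p₃ p₄ p₅ p₆ p₇ W : B} (T : ∀ f : o ⟶ W, (f ⟶ f) → R)
    (hT : ∀ {f g : o ⟶ W} (α : f ⟶ g) (β : g ⟶ f), T f (α ≫ β) = T g (β ≫ α))
    {x₁ : o ⟶ p₁} {x₂ : p₁ ⟶ p₂} {x₃ : p₂ ⟶ p₃} {x₄ : p₃ ⟶ W} {l : p₁ ⟶ p₄} {y₁ : o ⟶ p₅}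
    {y₂ : p₅ ⟶ p₄} {l₃ : p₄ ⟶ p₆} {k₃ : p₆ ⟶ W} {i₂ : p₁ ⟶ p₇} {h₃ : p₇ ⟶ p₆} {G : p₄ ⟶ p₃}
    (π : x₁ ≫ l ⟶ y₁ ≫ y₂) (κ : y₁ ≫ y₂ ≫ l₃ ⟶ x₁ ≫ i₂ ≫ h₃)
    (δ : i₂ ≫ h₃ ≫ k₃ ⟶ x₂ ≫ x₃ ≫ x₄) (m : x₂ ≫ x₃ ⟶ l ≫ G) (t : G ≫ x₄ ⟶ l₃ ≫ k₃) :
    T _ (head₃ (head π l₃ ≫ κ) k₃ ≫ x₁ ◁ (δ ≫ head m x₄ ≫ l ◁ t)) =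
      T _ (head₃ (x₁ ◁ m ≫ head π G) x₄ ≫ y₁ ◁ y₂ ◁ t ≫ head₃ κ k₃ ≫ x₁ ◁ δ) := by
  have h : head₃ (x₁ ◁ m ≫ head π G) x₄ ≫ y₁ ◁ y₂ ◁ t ≫ head₃ κ k₃ ≫ x₁ ◁ δ =
      (x₁ ◁ head m x₄ ≫ x₁ ◁ l ◁ t) ≫ head₃ (head π l₃ ≫ κ) k₃ ≫ x₁ ◁ δ := by
    simp only [head₃_comp, head₃_cons, head₃_head, Category.assoc, head_exchange_assoc]
  rw [h, hT (x₁ ◁ head m x₄ ≫ x₁ ◁ l ◁ t)]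
  simp only [whiskerLeft_comp, Category.assoc]

/-- Only interchange is involved: π acts on the first two letters and t₆ on the last two, so π moves
behind t₆ and next to x. -/
theorem slide_right {o p₁ p₂ p₃ p₄ p₅ p₆ p₇ p₈ W : B}
    {v₁ : o ⟶ p₁} {v₂ : p₁ ⟶ p₂} {v₃ : p₂ ⟶ p₃} {m₄ : p₃ ⟶ W} {a₁ : o ⟶ p₄} {a₂ : p₄ ⟶ p₅}
    {w₁ : p₅ ⟶ p₃} {b₁ : o ⟶ p₆} {b₂ : p₆ ⟶ p₅} {x₁ : p₆ ⟶ p₇} {z₅ : p₇ ⟶ p₃} {l : p₁ ⟶ p₇}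
    {G : p₇ ⟶ p₈} {z₃ : p₈ ⟶ W} {q₁ : B} {y₂ : p₁ ⟶ q₁} {y₃ : q₁ ⟶ p₈}
    {P : p₁ ⟶ W}
    (ρ : v₁ ≫ v₂ ≫ v₃ ⟶ a₁ ≫ a₂ ≫ w₁) (a : a₁ ≫ a₂ ⟶ b₁ ≫ b₂) (t₅ : b₂ ≫ w₁ ⟶ x₁ ≫ z₅)
    (π : b₁ ≫ x₁ ⟶ v₁ ≫ l) (t₆ : z₅ ≫ m₄ ⟶ G ≫ z₃) (x : l ≫ G ⟶ y₂ ≫ y₃)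
    (δ : y₂ ≫ y₃ ≫ z₃ ⟶ P) :
    head₃ (ρ ≫ head a w₁ ≫ b₁ ◁ t₅ ≫ head π z₅) m₄ ≫ v₁ ◁ (l ◁ t₆ ≫ head x z₃ ≫ δ) =
      (head₃ ρ m₄ ≫ head a (w₁ ≫ m₄) ≫ b₁ ◁ head t₅ m₄ ≫ b₁ ◁ x₁ ◁ t₆) ≫
        head₃ (head π G ≫ v₁ ◁ x) z₃ ≫ v₁ ◁ δ := by
  simp only [head₃_comp, head₃_cons, head₃_head, Category.assoc, whiskerLeft_comp,
    head_exchange_assoc]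

end CategoryTheory.Bicategory

namespace DualTwoCategory

section LTensorWords

open CategoryTheory Bicategory

variable {C : DualTwoCategory.{u, v, w}} {A B D K L M N E : C.Obj} (X : C.Obj)

theorem lTensor₂_comp {f g h : A ⟶ B} (α : f ⟶ g) (β : g ⟶ h) :
    X ⊲₂ (α ≫ β).1 = (X ⊲₂ α.1) ⊙ᵥ (X ⊲₂ β.1) :=
  congrArg Subtype.val (lTens₂_comp X α β)

theorem rTensor₂_comp {f g h : A ⟶ B} (α : f ⟶ g) (β : g ⟶ h) :
    (α ≫ β).1 ⊳₂ X = (α.1 ⊳₂ X) ⊙ᵥ (β.1 ⊳₂ X) :=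
  congrArg Subtype.val (rTens₂_comp α β X)

theorem lTensor₂_whiskerLeft (x : A ⟶ B) {f g : B ⟶ D} (α : f ⟶ g) :
    X ⊲₂ (x ◁ α).1 = 𝕀 (X ⊲ x.1) ⊙ₕ (X ⊲₂ α.1) :=
  (lTens₂_h X (𝟙 x) α).trans (congrArg (C.hcomp · _) (C.law.lTensor₂_idc _ _))

theorem rTensor₂_whiskerLeft (x : A ⟶ B) {f g : B ⟶ D} (α : f ⟶ g) :
    (x ◁ α).1 ⊳₂ X = 𝕀 (x.1 ⊳ X) ⊙ₕ (α.1 ⊳₂ X) :=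
  (rTens₂_h (𝟙 x) α X).trans (congrArg (C.hcomp · _) (C.law.idc_rTensor₂ _ _))

theorem lTensor₂_head {x₁ : A ⟶ B} {x₂ : B ⟶ D} {y₁ : A ⟶ K} {y₂ : K ⟶ D}
    (α : x₁ ≫ x₂ ⟶ y₁ ≫ y₂) (z : D ⟶ E) :
    X ⊲₂ (head α z).1 = (X ⊲₂ α.1) ⊙ₕ 𝕀 (X ⊲ z.1) :=
  (congrArg (C.lTensor₂ X) (head_val α z)).trans
    ((lTens₂_h X α (𝟙 z)).trans (congrArg (C.hcomp _) (C.law.lTensor₂_idc _ _)))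

theorem rTensor₂_head {x₁ : A ⟶ B} {x₂ : B ⟶ D} {y₁ : A ⟶ K} {y₂ : K ⟶ D}
    (α : x₁ ≫ x₂ ⟶ y₁ ≫ y₂) (z : D ⟶ E) :
    (head α z).1 ⊳₂ X = (α.1 ⊳₂ X) ⊙ₕ 𝕀 (z.1 ⊳ X) :=
  (congrArg (C.rTensor₂ · X) (head_val α z)).trans
    ((rTens₂_h α (𝟙 z) X).trans (congrArg (C.hcomp _) (C.law.idc_rTensor₂ _ _)))

end LTensorWords

/-! ### Fusion of the middle 4-simplex with the partial traces that come from the other two. -/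

section Evaluation

open CategoryTheory Bicategory
open scoped TensorProduct

variable {C : DualTwoCategory.{u, v, w}} {F : Type*} [Field F] [Additive C] [VectLinear F C]
variable {e01 e02 e03 e04 e05 e12 e13 e14 e15 e23 e24 e25 e34 e35 e45 : C.Obj}
  (f012 : e02 ⟶ e12 ⊠ e01) (f013 : e03 ⟶ e13 ⊠ e01) (f014 : e04 ⟶ e14 ⊠ e01)
  (f015 : e05 ⟶ e15 ⊠ e01) (f023 : e03 ⟶ e23 ⊠ e02) (f024 : e04 ⟶ e24 ⊠ e02)
  (f025 : e05 ⟶ e25 ⊠ e02) (f034 : e04 ⟶ e34 ⊠ e03) (f035 : e05 ⟶ e35 ⊠ e03)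
  (f045 : e05 ⟶ e45 ⊠ e04) (f123 : e13 ⟶ e23 ⊠ e12) (f124 : e14 ⟶ e24 ⊠ e12)
  (f125 : e15 ⟶ e25 ⊠ e12) (f134 : e14 ⟶ e34 ⊠ e13) (f135 : e15 ⟶ e35 ⊠ e13)
  (f145 : e15 ⟶ e45 ⊠ e14) (f234 : e24 ⟶ e34 ⊠ e23) (f235 : e25 ⟶ e35 ⊠ e23)
  (f245 : e25 ⟶ e45 ⊠ e24) (f345 : e35 ⟶ e45 ⊠ e34)

variable {f012 f013 f014 f023 f024 f034 f123 f124 f134 f234} in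
/-- The 2-morphism whose partial trace is paired with `H(0124)`. -/
def rightLoop (s : H₂' f123 f124 f134 f234) (t : H₂' f013 f014 f034 f134)
    (u : H₂' f012 f013 f023 f123) (m : H₂ f023 f024 f034 f234) :
    f014 ≫ rLetter f124 e01 ≫ rLetter f234 (e12 ⊠ e01) ⟶
      f024 ≫ lTens e24 f012 ≫ rLetter f234 (e12 ⊠ e01) :=
  (f014 ◁ rCell' (word' s) e01 ≫ head (word' t) (lTens e34 (rLetter f123 e01)) ≫
    f034 ◁ lCell e34 (word' u)) ≫
    head (word m) (lTens e34 (lTens e23 f012)) ≫ f024 ◁ tauCell f234 f012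

variable {f012 f013 f014 f015 f025 f034 f045 f023 f123 f124 f125 f134 f145 f234 f245} in
/-- The last 2-morphisms of the closed chain on the right-hand side. -/
def rightTail (c : H₂ f012 f015 f025 f125)
    (q : H₂' f124 f125 f145 f245) (r : H₂' f014 f015 f045 f145)
    (s : H₂' f123 f124 f134 f234) (t : H₂' f013 f014 f034 f134)
    (u : H₂' f012 f013 f023 f123) :
    f025 ≫ rLetter f245 e02 ≫ lTens e45 (rLetter f234 e02) ≫
      lTens e45 (lTens e34 (lTens e23 f012)) ⟶
    f045 ≫ lTens e45 f034 ≫ lTens e45 (lTens e34 f023) ≫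
      lTens e45 (lTens e34 (lTens e23 f012)) :=
  f025 ◁ rLetter f245 e02 ◁ lCell e45 (tauCell f234 f012) ≫
    head₃ (f025 ◁ tauCell f245 f012 ≫ head (word c) (rLetter f245 (e12 ⊠ e01)) ≫
      f015 ◁ rCell' (word' q) e01 ≫ head (word' r) (lTens e45 (rLetter f124 e01)))
      (lTens e45 (rLetter f234 (e12 ⊠ e01))) ≫
    f045 ◁ (lTens e45 f014 ◁ lCell e45 (rCell' (word' s) e01) ≫
      head (lCell e45 (word' t)) (lTens e45 (lTens e34 (rLetter f123 e01))) ≫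
      lTens e45 f034 ◁ lCell e45 (lCell e34 (word' u)))

/-- The entry for 0124 is a partial trace over the chain of 01234. It is opened inside the context
of `e45 ⊗ -` by `trace_context`, and `trace_slide_left` then places m directly before π. This is the
shape of a summand in the decomposition of `rightCell`. -/
theorem pairing_right (π : H₂ f024 f025 f045 f245) (c : H₂ f012 f015 f025 f125)
    (q : H₂' f124 f125 f145 f245) (r : H₂' f014 f015 f045 f145)
    (s : H₂' f123 f124 f134 f234) (t : H₂' f013 f014 f034 f134)
    (u : H₂' f012 f013 f023 f123) (m : H₂ f023 f024 f034 f234) :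
    pairing F _ _ (glueSource F f012 f015 f024 f025 f045 f125 f245 (π ⊗ₜ c))
      (glueTarget F f012 f014 f015 f024 f045 f124 f125 f145 f245
        (q ⊗ₜ (r ⊗ₜ (ptr₂ (rLetter f234 (e12 ⊠ e01)) (rightLoop s t u m) :
          H₂' f012 f014 f024 f124)))) =
    traceₗ F (f045 ≫ lTens e45 f034 ≫ lTens e45 (lTens e34 f023) ≫
      lTens e45 (lTens e34 (lTens e23 f012)))
      (head₃ (f045 ◁ lCell e45 (word m) ≫ head (word π) (lTens e45 (rLetter f234 e02)))
        (lTens e45 (lTens e34 (lTens e23 f012))) ≫ rightTail c q r s t u) := by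
  let k' : f025 ≫ rLetter f245 e02 ≫ lTens e45 (lTens e24 f012) ⟶
      f045 ≫ lTens e45 f014 ≫ lTens e45 (rLetter f124 e01) :=
    f025 ◁ tauCell f245 f012 ≫ head (word c) (rLetter f245 (e12 ⊠ e01)) ≫
      f015 ◁ rCell' (word' q) e01 ≫ head (word' r) (lTens e45 (rLetter f124 e01))
  let k : f045 ≫ lTens e45 f024 ≫ lTens e45 (lTens e24 f012) ⟶
      f045 ≫ lTens e45 f014 ≫ lTens e45 (rLetter f124 e01) :=
    head (word π) (lTens e45 (lTens e24 f012)) ≫ k'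
  let ν : f014 ≫ rLetter f124 e01 ⟶ f024 ≫ lTens e24 f012 :=
    ptr₂ (rLetter f234 (e12 ⊠ e01)) (rightLoop s t u m)
  let δ := lTens e45 f014 ◁ lCell e45 (rCell' (word' s) e01) ≫
      head (lCell e45 (word' t)) (lTens e45 (lTens e34 (rLetter f123 e01))) ≫
      lTens e45 f034 ◁ lCell e45 (lCell e34 (word' u))
  let κ := f045 ◁ (δ ≫ head (lCell e45 (word m)) (lTens e45 (lTens e34 (lTens e23 f012))) ≫
        lTens e45 f024 ◁ lCell e45 (tauCell f234 f012))
  -- Tensoring with e45 is a strict 2-functor, so it is applied to each factor of the loop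
  -- separately.
  have hκ : κ.1 = 𝕀 f045.1 ⊙ₕ e45 ⊲₂ (rightLoop s t u m).1 := by
    refine congrArg (C.hcomp _) ?_
    refine .trans ?_ (lTensor₂_comp _ _ _).symm
    refine congrArg₂ C.vcomp (.trans ?_ (lTensor₂_comp _ _ _).symm)
      (.trans ?_ (lTensor₂_comp _ _ _).symm)
    · refine congrArg₂ C.vcomp (lTensor₂_whiskerLeft _ _ _).symm
        (.trans ?_ (lTensor₂_comp _ _ _).symm)
      exact congrArg₂ C.vcomp ((head_val _ _).trans (lTensor₂_head _ _ _).symm)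
        (lTensor₂_whiskerLeft _ _ _).symm
    · exact congrArg₂ C.vcomp ((head_val _ _).trans (lTensor₂_head _ _ _).symm)
        (lTensor₂_whiskerLeft _ _ _).symm
  have h := (lTensFunctor e45).trace_context (F := F) (x₀ := f045) (X := lTens e45 f014)
    (Y := lTens e45 (rLetter f124 e01)) (X' := lTens e45 f024) (Y' := lTens e45 (lTens e24 f012))
    (G := lTens e45 (rLetter f234 (e12 ⊠ e01)))
    rfl rfl rfl rfl rfl (rightLoop s t u m) (f045 ◁ lCell e45 ν) rfl κ hκ k
  refine (congrArg₂ (fun x y => pairing F _ _ x y) (glueSource_eq ..) (glueTarget_eq ..)).trans ?_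
  have h' := trace_slide_left (fun f => traceₗ F f) trace_comm (word π) k' δ
    (lCell e45 (word m)) (lCell e45 (tauCell f234 f012))
  refine .trans (congrArg (traceₗ F _) ?_) (h.trans h')
  exact comp_comp_comp_comp _ _ _ _ _ (f045 ◁ lCell e45 ν)

variable {f012 f013 f023 f123 f124 f125 f134 f135 f145 f234 f235 f245 f345} in
/-- The 2-morphism whose partial trace is paired with `H(1345)`. -/
def leftLoop (p : H₂' f234 f235 f245 f345) (q : H₂' f124 f125 f145 f245)
    (s : H₂' f123 f124 f134 f234) (x : H₂ f123 f125 f135 f235) :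
    f135 ≫ rLetter f345 e13 ≫ lTens e45 (lTens e34 f123) ⟶
      f145 ≫ lTens e45 f134 ≫ lTens e45 (lTens e34 f123) :=
  f135 ◁ tauCell f345 f123 ≫ head (word x) (rLetter f345 (e23 ⊠ e12)) ≫
    f125 ◁ rCell' (word' p) e12 ≫ head (word' q) (lTens e45 (rLetter f234 e12)) ≫
    f145 ◁ lCell e45 (word' s)

variable {f013 f014 f015 f034 f035 f045 f123 f134 f145 f345} in
/-- The first 2-morphisms of the closed chain on the left-hand side. -/
def leftHead (a : H₂ f034 f035 f045 f345) (r : H₂' f014 f015 f045 f145)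
    (t : H₂' f013 f014 f034 f134) :
    f015 ≫ rLetter f145 e01 ≫ lTens e45 (rLetter f134 e01) ≫
      lTens e45 (lTens e34 (rLetter f123 e01)) ⟶
    f035 ≫ lTens e35 f013 ≫ lTens e35 (rLetter f123 e01) ≫
      rLetter f345 (e23 ⊠ e12 ⊠ e01) :=
  head₃ (head (word' r) (lTens e45 (rLetter f134 e01)) ≫ f045 ◁ lCell e45 (word' t))
      (lTens e45 (lTens e34 (rLetter f123 e01))) ≫
    head (word a) (lTens e45 (lTens e34 f013) ≫ lTens e45 (lTens e34 (rLetter f123 e01))) ≫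
    f035 ◁ head (tauCell f345 f013) (lTens e45 (lTens e34 (rLetter f123 e01))) ≫
    f035 ◁ lTens e35 f013 ◁ tauCell f345 (rLetter f123 e01)

variable {f123 f124 f125 f134 f145 f234 f235 f245 f345} in
/-- The last 2-morphisms of the closed chain on the left-hand side. -/
def leftTail (p : H₂' f234 f235 f245 f345) (q : H₂' f124 f125 f145 f245)
    (s : H₂' f123 f124 f134 f234) :
    f015 ≫ rLetter f125 e01 ≫ rLetter f235 (e12 ⊠ e01) ≫ rLetter f345 (e23 ⊠ e12 ⊠ e01) ⟶
    f015 ≫ rLetter f145 e01 ≫ lTens e45 (rLetter f134 e01) ≫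
      lTens e45 (lTens e34 (rLetter f123 e01)) :=
  f015 ◁ (rLetter f125 e01 ◁ rCell' (word' p) (e12 ⊠ e01) ≫
    head (rCell' (word' q) e01) (lTens e45 (rLetter f234 (e12 ⊠ e01))) ≫
    rLetter f145 e01 ◁ lCell e45 (rCell' (word' s) e01))

theorem trace_rotate₃ {A B : C.Obj} {f₁ f₂ f₃ f₄ f₅ f₆ : A ⟶ B} (a : f₁ ⟶ f₂) (b : f₂ ⟶ f₃)
    (c : f₃ ⟶ f₄) (d : f₄ ⟶ f₅) (e : f₅ ⟶ f₆) (k : f₆ ⟶ f₁) :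
    traceₗ F f₁ ((a ≫ b ≫ c) ≫ d ≫ e ≫ k) = traceₗ F f₅ (((e ≫ k) ≫ a ≫ b ≫ c) ≫ d) := by
  refine .trans (congrArg (traceₗ F f₁) ?_) ((trace_comm ((a ≫ b ≫ c) ≫ d) (e ≫ k)).trans
    (congrArg (traceₗ F f₅) (Category.assoc _ _ _).symm))
  simp only [Category.assoc]

/-- The mirror of `pairing_right`: the entry for 1345 is opened inside the context of `- ⊗ e01`, and
`slide_right` brings x directly behind π. -/
theorem pairing_left (π : H₂ f013 f015 f035 f135) (a : H₂ f034 f035 f045 f345)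
    (p : H₂' f234 f235 f245 f345) (q : H₂' f124 f125 f145 f245) (r : H₂' f014 f015 f045 f145)
    (s : H₂' f123 f124 f134 f234) (t : H₂' f013 f014 f034 f134) (x : H₂ f123 f125 f135 f235) :
    pairing F _ _ (glueSource F f013 f015 f034 f035 f045 f135 f345 (a ⊗ₜ π))
      (glueTarget F f013 f014 f015 f034 f045 f134 f135 f145 f345
        ((ptr₂ (lTens e45 (lTens e34 f123)) (leftLoop p q s x) : H₂' f134 f135 f145 f345) ⊗ₜ
          (r ⊗ₜ t))) =
    traceₗ F (f015 ≫ rLetter f145 e01 ≫ lTens e45 (rLetter f134 e01) ≫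
      lTens e45 (lTens e34 (rLetter f123 e01)))
      (leftHead a r t ≫ head₃ (head (word π) (lTens e35 (rLetter f123 e01)) ≫
        f015 ◁ rCell (word x) e01) (rLetter f345 (e23 ⊠ e12 ⊠ e01)) ≫ leftTail f015 p q s) := by
  let ρ : f015 ≫ rLetter f145 e01 ≫ lTens e45 (rLetter f134 e01) ⟶
      f045 ≫ lTens e45 f034 ≫ lTens e45 (lTens e34 f013) :=
    head (word' r) (lTens e45 (rLetter f134 e01)) ≫ f045 ◁ lCell e45 (word' t)
  let k : f015 ≫ rLetter f145 e01 ≫ lTens e45 (rLetter f134 e01) ⟶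
      f015 ≫ rLetter f135 e01 ≫ rLetter f345 (e13 ⊠ e01) :=
    ρ ≫ head (word a) (lTens e45 (lTens e34 f013)) ≫ f035 ◁ tauCell f345 f013 ≫
      head (word π) (rLetter f345 (e13 ⊠ e01))
  let ν : f135 ≫ rLetter f345 e13 ⟶ f145 ≫ lTens e45 f134 :=
    ptr₂ (lTens e45 (lTens e34 f123)) (leftLoop p q s x)
  let δ := rLetter f125 e01 ◁ rCell' (word' p) (e12 ⊠ e01) ≫
    head (rCell' (word' q) e01) (lTens e45 (rLetter f234 (e12 ⊠ e01))) ≫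
    rLetter f145 e01 ◁ lCell e45 (rCell' (word' s) e01)
  let κ := f015 ◁ (rLetter f135 e01 ◁ tauCell f345 (rLetter f123 e01) ≫
    head (rCell (word x) e01) (rLetter f345 (e23 ⊠ e12 ⊠ e01)) ≫ δ)
  -- Besides functoriality, this uses the compatibility of tensorators and of iterated tensor
  -- products with - ⊗ e01, since the letters are written with all objects collected on their outer
  -- sides.
  have hκ : κ.1 = 𝕀 f015.1 ⊙ₕ (leftLoop p q s x).1 ⊳₂ e01 := by
    refine congrArg (C.hcomp _) ?_
    refine .trans ?_ (rTensor₂_comp _ _ _).symm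
    refine congrArg₂ C.vcomp (.trans ?_ (rTensor₂_whiskerLeft _ _ _).symm)
      (.trans ?_ (rTensor₂_comp _ _ _).symm)
    · exact congrArg (C.hcomp _) (C.law.tensorator_rTensor _ _ _)
    refine congrArg₂ C.vcomp ((head_val _ _).trans (.trans ?_ (rTensor₂_head _ _ _).symm))
      (.trans ?_ (rTensor₂_comp _ _ _).symm)
    · exact congrArg (fun z => C.hcomp _ (C.idc z)) ((congrArg (C.rTensor f345.1)
        (C.law.tensor_assoc _ _ _).symm).trans (C.law.rTensor_tensor _ _ _))
    refine congrArg₂ C.vcomp (.trans ?_ (rTensor₂_whiskerLeft _ _ _).symm)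
      (.trans ?_ (rTensor₂_comp _ _ _).symm)
    · exact congrArg (C.hcomp _) (C.law.rTensor₂_tensor _ _ _)
    refine congrArg₂ C.vcomp ((head_val _ _).trans (.trans ?_ (rTensor₂_head _ _ _).symm))
      (.trans ?_ (rTensor₂_whiskerLeft _ _ _).symm)
    · exact congrArg (fun z => C.hcomp _ (C.idc z)) ((congrArg (C.lTensor e45)
        (C.law.rTensor_tensor _ _ _)).trans (C.law.lTensor_rTensor _ _ _).symm)
    · exact congrArg (C.hcomp _) (C.law.lTensor₂_rTensor₂ _ _ _).symm
  have hG : (lTens e45 (lTens e34 (rLetter f123 e01))).1 =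
      (lTens e45 (lTens e34 f123)).1 ⊳ e01 :=
    ((C.law.lTensor_rTensor _ _ _).trans (congrArg (C.lTensor e45)
      (C.law.lTensor_rTensor _ _ _))).symm
  have h := (rTensFunctor e01).trace_context (F := F) (x₀ := f015) (x := f135)
    (y := rLetter f345 e13) (x' := f145) (y' := lTens e45 f134) (X := rLetter f135 e01)
    (Y := rLetter f345 (e13 ⊠ e01)) (X' := rLetter f145 e01) (Y' := lTens e45 (rLetter f134 e01))
    (G := lTens e45 (lTens e34 (rLetter f123 e01)))
    rfl (C.law.rTensor_tensor _ _ _) rfl (C.law.lTensor_rTensor _ _ _).symm hG (leftLoop p q s x)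
    (f015 ◁ rCell' ν e01) rfl κ hκ k
  refine (congrArg₂ (fun x y => pairing F _ _ x y) (glueSource_eq ..) (glueTarget_eq ..)).trans ?_
  have h' := slide_right ρ (word a) (tauCell f345 f013) (word π) (tauCell f345 (rLetter f123 e01))
    (rCell (word x) e01) δ
  exact (trace_rotate₃ _ _ _ (f015 ◁ rCell' ν e01) _ _).trans
    (h.trans (congrArg (traceₗ F _) h'))

end Evaluation

end DualTwoCategory

namespace DualTwoCategory

/-! ### The form of a 4-simplex as the pairing with a single entry. -/

section GluedPairing

open CategoryTheory Bicategory
open scoped TensorProduct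

variable {C : DualTwoCategory.{u, v, w}} {F : Type*} [Field F] [Additive C] [VectLinear F C]
variable {e_ij e_jk e_kl e_lm e_ik e_jl e_km e_il e_jm e_im : C.Obj}
  {f_ijk : e_ik ⟶ e_jk ⊠ e_ij} {f_ijl : e_il ⟶ e_jl ⊠ e_ij}
  {f_ijm : e_im ⟶ e_jm ⊠ e_ij} {f_ikl : e_il ⟶ e_kl ⊠ e_ik}
  {f_ikm : e_im ⟶ e_km ⊠ e_ik} {f_ilm : e_im ⟶ e_lm ⊠ e_il}
  {f_jkl : e_jl ⟶ e_kl ⊠ e_jk} {f_jkm : e_jm ⟶ e_km ⊠ e_jk}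
  {f_jlm : e_jm ⟶ e_lm ⊠ e_jl} {f_klm : e_km ⟶ e_lm ⊠ e_kl}

/-- The source composite of a 4-simplex as a 2-morphism of words. -/
def glueWord (β : H₂ f_ikl f_ikm f_ilm f_klm) (δ : H₂ f_ijk f_ijm f_ikm f_jkm) :
    f_ilm ≫ lTens e_lm f_ikl ≫ lTens e_lm (lTens e_kl f_ijk) ⟶
      f_ijm ≫ rLetter f_jkm e_ij ≫ rLetter f_klm (e_jk ⊠ e_ij) :=
  head (word β) (lTens e_lm (lTens e_kl f_ijk)) ≫ f_ikm ◁ tauCell f_klm f_ijk ≫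
    head (word δ) (rLetter f_klm (e_jk ⊠ e_ij))

/-- The target composite of a 4-simplex as a 2-morphism of words. -/
def glueWord' (α : H₂' f_jkl f_jkm f_jlm f_klm) (γ : H₂' f_ijl f_ijm f_ilm f_jlm)
    (ζ : H₂' f_ijk f_ijl f_ikl f_jkl) :
    f_ijm ≫ rLetter f_jkm e_ij ≫ rLetter f_klm (e_jk ⊠ e_ij) ⟶
      f_ilm ≫ lTens e_lm f_ikl ≫ lTens e_lm (lTens e_kl f_ijk) :=
  f_ijm ◁ rCell' (word' α) e_ij ≫ head (word' γ) (lTens e_lm (rLetter f_jkl e_ij)) ≫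
    f_ilm ◁ lCell e_lm (word' ζ)

variable (β : H₂ f_ikl f_ikm f_ilm f_klm) (δ : H₂ f_ijk f_ijm f_ikm f_jkm)
  (α : H₂' f_jkl f_jkm f_jlm f_klm) (γ : H₂' f_ijl f_ijm f_ilm f_jlm)
  (ζ : H₂' f_ijk f_ijl f_ikl f_jkl)

theorem pairing_glue_target :
    pairing F _ _ (glueSource F f_ijk f_ijm f_ikl f_ikm f_ilm f_jkm f_klm (β ⊗ₜ δ))
        (glueTarget F f_ijk f_ijl f_ijm f_ikl f_ilm f_jkl f_jkm f_jlm f_klm (α ⊗ₜ (γ ⊗ₜ ζ))) =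
      pairing F (leftPath f_ijl f_ilm) (rightPath f_ijm f_jlm)
        (ptr₂ (lTens e_lm (rLetter f_jkl e_ij)) (f_ilm ◁ lCell e_lm (word' ζ) ≫
          glueWord β δ ≫ f_ijm ◁ rCell' (word' α) e_ij)) γ := by
  refine (pairing_glueTarget f_ijk f_ijl f_ijm f_ikl f_ilm f_jkl f_jkm f_jlm f_klm _ α γ ζ).trans ?_
  exact congrArg (fun z : f_ilm ≫ lTens e_lm f_ikl ≫ lTens e_lm (lTens e_kl f_ijk) ⟶
      f_ijm ≫ rLetter f_jkm e_ij ≫ rLetter f_klm (e_jk ⊠ e_ij) =>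
    pairing F (leftPath f_ijl f_ilm) (rightPath f_ijm f_jlm)
    (ptr₂ (lTens e_lm (rLetter f_jkl e_ij)) (f_ilm ◁ lCell e_lm (word' ζ) ≫
      z ≫ f_ijm ◁ rCell' (word' α) e_ij)) γ)
    (glueSource_eq f_ijk f_ijm f_ikl f_ikm f_ilm f_jkm f_klm β δ)

theorem pairing_glue_target_assoc :
    pairing F _ _ (glueSource F f_ijk f_ijm f_ikl f_ikm f_ilm f_jkm f_klm (β ⊗ₜ δ))
        (glueTarget F f_ijk f_ijl f_ijm f_ikl f_ilm f_jkl f_jkm f_jlm f_klm (α ⊗ₜ (γ ⊗ₜ ζ))) =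
      pairing F (leftPath f_ijl f_ilm) (rightPath f_ijm f_jlm)
        (ptr₂ (lTens e_lm (rLetter f_jkl e_ij)) ((f_ilm ◁ lCell e_lm (word' ζ) ≫
          glueWord β δ) ≫ f_ijm ◁ rCell' (word' α) e_ij)) γ := by
  rw [pairing_glue_target, Category.assoc]

theorem pairing_glue_right :
    pairing F _ _ (glueSource F f_ijk f_ijm f_ikl f_ikm f_ilm f_jkm f_klm (β ⊗ₜ δ))
        (glueTarget F f_ijk f_ijl f_ijm f_ikl f_ilm f_jkl f_jkm f_jlm f_klm (α ⊗ₜ (γ ⊗ₜ ζ))) =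
      pairing F (leftPath f_ijk f_ikm) (rightPath f_ijm f_jkm) δ
        (ptr₂ (rLetter f_klm (e_jk ⊠ e_ij)) (glueWord' α γ ζ ≫
          head (word β) (lTens e_lm (lTens e_kl f_ijk)) ≫ f_ikm ◁ tauCell f_klm f_ijk)) := by
  refine (pairing_glueSource_right f_ijk f_ijm f_ikl f_ikm f_ilm f_jkm f_klm β δ _).trans ?_
  exact congrArg (fun z : f_ijm ≫ rLetter f_jkm e_ij ≫ rLetter f_klm (e_jk ⊠ e_ij) ⟶
      f_ilm ≫ lTens e_lm f_ikl ≫ lTens e_lm (lTens e_kl f_ijk) =>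
    pairing F (leftPath f_ijk f_ikm) (rightPath f_ijm f_jkm) δ
    (ptr₂ (rLetter f_klm (e_jk ⊠ e_ij)) (z ≫
      head (word β) (lTens e_lm (lTens e_kl f_ijk)) ≫ f_ikm ◁ tauCell f_klm f_ijk)))
    (glueTarget_eq f_ijk f_ijl f_ijm f_ikl f_ilm f_jkl f_jkm f_jlm f_klm α γ ζ)

theorem pairing_glue_left :
    pairing F _ _ (glueSource F f_ijk f_ijm f_ikl f_ikm f_ilm f_jkm f_klm (β ⊗ₜ δ))
        (glueTarget F f_ijk f_ijl f_ijm f_ikl f_ilm f_jkl f_jkm f_jlm f_klm (α ⊗ₜ (γ ⊗ₜ ζ))) =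
      pairing F (leftPath f_ikl f_ilm) (rightPath f_ikm f_klm) β
        (ptr₂ (lTens e_lm (lTens e_kl f_ijk)) (f_ikm ◁ tauCell f_klm f_ijk ≫
          head (word δ) (rLetter f_klm (e_jk ⊠ e_ij)) ≫ glueWord' α γ ζ)) := by
  refine (pairing_glueSource_left f_ijk f_ijm f_ikl f_ikm f_ilm f_jkm f_klm β δ _).trans ?_
  exact congrArg (fun z : f_ijm ≫ rLetter f_jkm e_ij ≫ rLetter f_klm (e_jk ⊠ e_ij) ⟶
      f_ilm ≫ lTens e_lm f_ikl ≫ lTens e_lm (lTens e_kl f_ijk) =>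
    pairing F (leftPath f_ikl f_ilm) (rightPath f_ikm f_klm) β
    (ptr₂ (lTens e_lm (lTens e_kl f_ijk)) (f_ikm ◁ tauCell f_klm f_ijk ≫
      head (word δ) (rLetter f_klm (e_jk ⊠ e_ij)) ≫ z)))
    (glueTarget_eq f_ijk f_ijl f_ijm f_ikl f_ilm f_jkl f_jkm f_jlm f_klm α γ ζ)

end GluedPairing

end DualTwoCategory

namespace DualTwoCategory

/-! ### Elimination of the interior label and of the interior state spaces. -/

section Sums

open CategoryTheory Bicategory
open scoped TensorProduct

variable {C : DualTwoCategory.{u, v, w}} {F : Type*} [Field F] [Additive C] [VectLinear F C]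
  [NonDegenerate F C]
variable {e01 e02 e03 e04 e05 e12 e13 e14 e15 e23 e24 e25 e34 e35 e45 : C.Obj}
  {f012 : e02 ⟶ e12 ⊠ e01} {f013 : e03 ⟶ e13 ⊠ e01} {f014 : e04 ⟶ e14 ⊠ e01}
  {f015 : e05 ⟶ e15 ⊠ e01} {f023 : e03 ⟶ e23 ⊠ e02}
  {f025 : e05 ⟶ e25 ⊠ e02} {f034 : e04 ⟶ e34 ⊠ e03} {f035 : e05 ⟶ e35 ⊠ e03}
  {f045 : e05 ⟶ e45 ⊠ e04} {f123 : e13 ⟶ e23 ⊠ e12} {f124 : e14 ⟶ e24 ⊠ e12}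
  {f125 : e15 ⟶ e25 ⊠ e12} {f134 : e14 ⟶ e34 ⊠ e13}
  {f145 : e15 ⟶ e45 ⊠ e14} {f234 : e24 ⟶ e34 ⊠ e23} {f235 : e25 ⟶ e35 ⊠ e23}
  {f245 : e25 ⟶ e45 ⊠ e24} {f345 : e35 ⟶ e45 ⊠ e34}

theorem exists_dual_families {A B : C.Obj} (f g : C.Hom A B) :
    ∃ (n : ℕ) (x : Fin n → C.Hom₂ f g) (y : Fin n → C.Hom₂ g f),
      (∀ v, v = ∑ i, pairing F f g v (y i) • x i) ∧ ∀ w, w = ∑ i, pairing F f g (x i) w • y i :=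
  LinearMap.IsPerfPair.exists_dual_families (pairing F f g)

/-- The 2-morphism that is decomposed along the basis on the right-hand side. -/
def rightCell (a : H₂ f034 f035 f045 f345) (b : H₂ f023 f025 f035 f235)
    (p : H₂' f234 f235 f245 f345) : f045 ≫ lTens e45 f034 ≫ lTens e45 (lTens e34 f023) ⟶
      f025 ≫ rLetter f245 e02 ≫ lTens e45 (rLetter f234 e02) :=
  glueWord a b ≫ f025 ◁ rCell' (word' p) e02

/-- The interior state spaces are 0245, 0234 and 0124. The sums over 0245 and 0124 fuse the three
4-simplices, while the sum over 0234 together with dim_q(f024) and the sum over f024 is a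
decomposition of `rightCell`. -/
theorem contract_sum_right {𝓑 : Finset (C.Hom e04 (e24 ⊠ e02))} (h𝓑 : IsBasis F 𝓑)
    (a : H₂ f034 f035 f045 f345) (b : H₂ f023 f025 f035 f235) (c : H₂ f012 f015 f025 f125)
    (p : H₂' f234 f235 f245 f345) (q : H₂' f124 f125 f145 f245) (r : H₂' f014 f015 f045 f145)
    (s : H₂' f123 f124 f134 f234) (t : H₂' f013 f014 f034 f134) (u : H₂' f012 f013 f023 f123) :
    ∑ f024 ∈ 𝓑, qdim F f024 *
      (pairing F _ _).flip u (contract _ ((pairing F _ _).flip t) (contract _ ((pairing F _ _).flip s)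
        (contract _ ((pairing F _ _).flip r) (contract _ ((pairing F _ _).flip q)
          (contract _ ((pairing F _ _).flip p)
        (((((Zpos F f012 f013 f014 f023 f024 f034 f123 f124 f134 f234).lTensor _).lTensor _).lTensor _ ∘ₗ
          (((swapLast (H₂ f012 f014 f024 f124) (H₂ f023 f024 f034 f234)).lTensor _).lTensor _).lTensor _ ∘ₗ
          (tensorRight (H₂ f023 f024 f034 f234)
            (Zpos F f012 f014 f015 f024 f025 f045 f124 f125 f145 f245)).lTensor _ ∘ₗ
          ((swapLast (H₂ f023 f024 f034 f234) (H₂ f012 f015 f025 f125)).lTensor _).lTensor _ ∘ₗ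
          tensorRight (H₂ f012 f015 f025 f125)
            (Zpos F f023 f024 f025 f034 f035 f045 f234 f235 f245 f345)) (a ⊗ₜ (b ⊗ₜ c)))))))) =
    traceₗ F (f045 ≫ lTens e45 f034 ≫ lTens e45 (lTens e34 f023) ≫
      lTens e45 (lTens e34 (lTens e23 f012)))
      (head₃ (rightCell a b p) (lTens e45 (lTens e34 (lTens e23 f012))) ≫
        rightTail c q r s t u) := by
  choose n₂ x₂ y₂ h₂ h₂' using fun f024 : C.Hom e04 (e24 ⊠ e02) =>
    exists_dual_families (F := F) (leftPath f024 f045) (rightPath f025 f245)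
  choose n₃ x₃ y₃ h₃ h₃' using fun f024 : C.Hom e04 (e24 ⊠ e02) =>
    exists_dual_families (F := F) (leftPath f023 f034) (rightPath f024 f234)
  choose n x y h h' using fun f024 : C.Hom e04 (e24 ⊠ e02) =>
    exists_dual_families (F := F) (leftPath f012 f024) (rightPath f014 f124)
  -- The small category is Hom(e04, e24 ⊗ e02), with X the left path of the tetrahedron 0234 and g =
  -- f234 ⊗ e02. The composite of f024 with g is then the right path, so the dual families are bases
  -- of `H₂` and `H₂'` for 0234. The functor `e45 ⊗ -` and the letter f045 form the context.
  have hA := word_decomposition_left (DualityFunctor.isLinear_lTens F e45) h𝓑 (X := leftPath f023 f034)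
    (g := rLetter f234 e02) h₃ (x₁ := f045) (x₂ := lTens e45 f034)
    (x₃ := lTens e45 (lTens e34 f023)) (y₁ := f025) (y₂ := rLetter f245 e02)
    (G := lTens e45 (rLetter f234 e02)) (Q := fun f024 => lTens e45 f024)
    (comp_lTens_val e45 f034 (lTens e34 f023)).symm rfl (fun _ => rfl)
    (fun f024 j => lCell e45 (word (x₃ f024 j))) (fun _ _ => rfl)
    (fun f024 j => lCell e45 (word' (y₃ f024 j))) (fun _ _ => rfl) (rightCell a b p)
  have hT := congrArg (traceHead₃ₗ F (𝟙 _) (rightTail c q r s t u)) hA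
  rw [traceHead₃ₗ_apply, Category.id_comp] at hT
  refine .trans ?_ hT.symm
  refine .trans ?_ (map_sum _ _ _).symm
  refine Finset.sum_congr rfl fun f024 _ => ?_
  refine .trans (congrArg _ ?_) ((map_smul _ _ _).trans (smul_eq_mul _ _)).symm
  refine .trans ?_ (map_sum _ _ _).symm
  rw [contract_comp_right _ _ _ _ _ _ _ _ _
    (q₂ := fun i => (pairing F _ _).flip (y₂ f024 i)) (q₃ := fun i => (pairing F _ _).flip (y₃ f024 i))
    (q := fun i => (pairing F _ _).flip (y f024 i)) (h₂ f024) (h₃ f024) (h f024)]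
  simp only [contract_Zpos]
  -- The index j of the 0234 basis is made the outer one, since it is shared with the decomposition.
  -- The indices i and l are then summed for fixed j.
  rw [Finset.sum_comm]
  refine Finset.sum_congr rfl fun j _ => ?_
  let π : H₂ f024 f025 f045 f245 := ptr₂ (lTens e45 (rLetter f234 e02))
    (f045 ◁ lCell e45 (word' (y₃ f024 j)) ≫ rightCell a b p)
  let ν : H₂' f012 f014 f024 f124 := ptr₂ (rLetter f234 (e12 ⊠ e01))
    (rightLoop s t u (x₃ f024 j))
  let Q : H₂ f024 f025 f045 f245 →ₗ[F] H₂' f012 f014 f024 f124 →ₗ[F] F :=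
    (pairing F _ _).compl₁₂
      (glueSource F f012 f015 f024 f025 f045 f125 f245 ∘ₗ (TensorProduct.mk F _ _).flip c)
      (glueTarget F f012 f014 f015 f024 f045 f124 f125 f145 f245 ∘ₗ
        TensorProduct.mk F _ _ q ∘ₗ TensorProduct.mk F _ _ r)
  -- Here π pairs with the 0245 basis in the way Z(02345) does, ν pairs with the 0124 basis in the
  -- way Z(01234) does, and Q is the form of the middle simplex 01245.
  have hQ := LinearMap.sum_mul_dual_families (pairing F _ _) (pairing F _ _) Q (h₂ f024)
    (h' f024) π ν
  refine .trans ?_ (hQ.trans ?_)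
  · refine Finset.sum_congr rfl fun i _ => Finset.sum_congr rfl fun l _ => ?_
    refine congrArg₂ _ ?_ (congrArg _ ?_)
    · exact pairing_glue_target a b p (y₂ f024 i) (y₃ f024 j)
    · exact pairing_glue_right (x₃ f024 j) (x f024 l) s t u
  · refine (pairing_right ..).trans ?_
    refine .trans (congrArg _ ?_) (traceHead₃ₗ_apply (𝟙 _) (rightTail c q r s t u) _).symm
    exact (Category.id_comp _).symm

variable (f015) in
/-- The 2-morphism that is decomposed along the basis on the left-hand side. -/
def leftCell (b : H₂ f023 f025 f035 f235) (c : H₂ f012 f015 f025 f125)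
    (u : H₂' f012 f013 f023 f123) :
    f035 ≫ lTens e35 f013 ≫ lTens e35 (rLetter f123 e01) ⟶
      f015 ≫ rLetter f125 e01 ≫ rLetter f235 (e12 ⊠ e01) :=
  f035 ◁ lCell e35 (word' u) ≫ glueWord b c

/-- Here the interior state spaces are 1235, 0135 and 1345. The dual basis of 1235 belongs to the
decomposition of `leftCell` along f135, and those of 0135 and 1345 fuse the 4-simplices. -/
theorem contract_sum_left {𝓑 : Finset (C.Hom e15 (e35 ⊠ e13))} (h𝓑 : IsBasis F 𝓑)
    (a : H₂ f034 f035 f045 f345) (b : H₂ f023 f025 f035 f235) (c : H₂ f012 f015 f025 f125)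
    (p : H₂' f234 f235 f245 f345) (q : H₂' f124 f125 f145 f245) (r : H₂' f014 f015 f045 f145)
    (s : H₂' f123 f124 f134 f234) (t : H₂' f013 f014 f034 f134) (u : H₂' f012 f013 f023 f123) :
    ∑ f135 ∈ 𝓑, qdim F f135 *
      (pairing F _ _).flip u (contract _ ((pairing F _ _).flip t) (contract _ ((pairing F _ _).flip s)
        (contract _ ((pairing F _ _).flip r) (contract _ ((pairing F _ _).flip q)
          (contract _ ((pairing F _ _).flip p)
        ((((swapHead (H₂ f123 f124 f134 f234) (H₂ f014 f015 f045 f145)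
            (H₂ f013 f014 f034 f134 ⊗[F] H₂ f012 f013 f023 f123)).lTensor _).lTensor _ ∘ₗ
          tensorRight (H₂ f014 f015 f045 f145 ⊗[F] (H₂ f013 f014 f034 f134 ⊗[F]
            H₂ f012 f013 f023 f123))
            (Zpos F f123 f124 f125 f134 f135 f145 f234 f235 f245 f345) ∘ₗ
          swapHead (H₂ f123 f125 f135 f235) (H₂ f134 f135 f145 f345)
            (H₂ f014 f015 f045 f145 ⊗[F] (H₂ f013 f014 f034 f134 ⊗[F] H₂ f012 f013 f023 f123)) ∘ₗ
          (tensorRight (H₂ f012 f013 f023 f123)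
            (Zpos F f013 f014 f015 f034 f035 f045 f134 f135 f145 f345)).lTensor _ ∘ₗ
          swapHead (H₂ f034 f035 f045 f345) (H₂ f123 f125 f135 f235)
            (H₂ f013 f015 f035 f135 ⊗[F] H₂ f012 f013 f023 f123) ∘ₗ
          (Zpos F f012 f013 f015 f023 f025 f035 f123 f125 f135 f235).lTensor _)
            (a ⊗ₜ (b ⊗ₜ c)))))))) =
    traceₗ F (f015 ≫ rLetter f145 e01 ≫ lTens e45 (rLetter f134 e01) ≫
      lTens e45 (lTens e34 (rLetter f123 e01)))
      (leftHead a r t ≫ head₃ (leftCell f015 b c u) (rLetter f345 (e23 ⊠ e12 ⊠ e01)) ≫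
        leftTail f015 p q s) := by
  choose n₁ x₁ y₁ h₁ h₁' using fun f135 : C.Hom e15 (e35 ⊠ e13) =>
    exists_dual_families (F := F) (leftPath f123 f135) (rightPath f125 f235)
  choose n₂ x₂ y₂ h₂ h₂' using fun f135 : C.Hom e15 (e35 ⊠ e13) =>
    exists_dual_families (F := F) (leftPath f013 f035) (rightPath f015 f135)
  choose n x y h h' using fun f135 : C.Hom e15 (e35 ⊠ e13) =>
    exists_dual_families (F := F) (leftPath f134 f145) (rightPath f135 f345)
  -- The resolution now starts from the right path of 1235, so the two dual families exchange roles;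
  -- symmetry of the pairing makes this legitimate.
  have h₁'' : ∀ f135 v, v = ∑ i, pairing F (rightPath f125 f235) (leftPath f123 f135) v
      (x₁ f135 i) • y₁ f135 i := fun f135 v => (h₁' f135 v).trans
    (Finset.sum_congr rfl fun i _ => congrArg (· • y₁ f135 i) (pairing_comm _ _))
  -- The small category is Hom(e15, e35 ⊗ e13), with X the right path of 1235 and g = e35 ⊗ f123.
  -- The context consists of the letter f015 and the functor `- ⊗ e01`.
  have hA := word_decomposition_right (DualityFunctor.isLinear_rTens F e01) h𝓑
    (X := rightPath f125 f235)
    (g := lTens e35 f123) h₁'' (x₁ := f015) (x₂ := rLetter f125 e01)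
    (x₃ := rLetter f235 (e12 ⊠ e01)) (y₁ := f035) (y₂ := lTens e35 f013)
    (G := lTens e35 (rLetter f123 e01)) (Q := fun f135 => rLetter f135 e01)
    (comp_rLetter_val f125 f235 e01).symm (C.law.lTensor_rTensor _ _ _).symm (fun _ => rfl)
    (fun f135 j => rCell' (word' (y₁ f135 j)) e01) (fun _ _ => rfl)
    (fun f135 j => rCell (word (x₁ f135 j)) e01) (fun _ _ => rfl) (leftCell f015 b c u)
  have hT := congrArg (traceHead₃ₗ F (leftHead a r t) (leftTail f015 p q s)) hA
  rw [traceHead₃ₗ_apply] at hT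
  refine .trans ?_ hT.symm
  refine .trans ?_ (map_sum _ _ _).symm
  refine Finset.sum_congr rfl fun f135 _ => ?_
  refine .trans (congrArg _ ?_) ((map_smul _ _ _).trans (smul_eq_mul _ _)).symm
  refine .trans ?_ (map_sum _ _ _).symm
  rw [contract_comp_left _ _ _ _ _ _ _ _ _
    (q₁ := fun i => (pairing F _ _).flip (y₁ f135 i))
    (q₂ := fun i => (pairing F _ _).flip (y₂ f135 i))
    (q := fun i => (pairing F _ _).flip (y f135 i)) (h₁ f135) (h₂ f135) (h f135)]
  simp only [contract_Zpos]
  refine Finset.sum_congr rfl fun j _ => ?_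
  let π : H₂ f013 f015 f035 f135 := ptr₂ (lTens e35 (rLetter f123 e01))
    (leftCell f015 b c u ≫ f015 ◁ rCell' (word' (y₁ f135 j)) e01)
  let ν : H₂' f134 f135 f145 f345 := ptr₂ (lTens e45 (lTens e34 f123))
    (leftLoop p q s (x₁ f135 j))
  let Q : H₂ f013 f015 f035 f135 →ₗ[F] H₂' f134 f135 f145 f345 →ₗ[F] F :=
    (pairing F _ _).compl₁₂
      (glueSource F f013 f015 f034 f035 f045 f135 f345 ∘ₗ TensorProduct.mk F _ _ a)
      (glueTarget F f013 f014 f015 f034 f045 f134 f135 f145 f345 ∘ₗ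
        (TensorProduct.mk F _ _).flip (r ⊗ₜ t))
  have hQ := LinearMap.sum_mul_dual_families (pairing F _ _) (pairing F _ _) Q (h₂ f135)
    (h' f135) π ν
  refine .trans ?_ (hQ.trans ?_)
  · refine Finset.sum_congr rfl fun i _ => Finset.sum_congr rfl fun l _ => ?_
    refine congrArg₂ _ ?_ (congrArg _ ?_)
    · exact pairing_glue_target_assoc b c (y₁ f135 j) (y₂ f135 i) u
    · exact pairing_glue_left (x f135 l) (x₁ f135 j) p q s
  · refine (pairing_left ..).trans ?_
    exact (traceHead₃ₗ_apply (leftHead a r t) (leftTail f015 p q s) _).symm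

end Sums

end DualTwoCategory

/-! ### Reduction of an identity of linear maps to complete contractions. -/

section Contraction

open scoped TensorProduct

/-- Equality of linear combinations of maps between tensor products can be tested on pure tensors
and on families of linear forms that admit dual families. -/
theorem LinearMap.sum_smul_eq_of_contract {F : Type*} [Field F]
    {A B C V₁ V₂ V₃ V₄ V₅ V₆ : Type*} [AddCommGroup A]
    [AddCommGroup B] [AddCommGroup C] [AddCommGroup V₁] [AddCommGroup V₂] [AddCommGroup V₃]
    [AddCommGroup V₄] [AddCommGroup V₅] [AddCommGroup V₆] [Module F A] [Module F B] [Module F C]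
    [Module F V₁] [Module F V₂] [Module F V₃] [Module F V₄] [Module F V₅] [Module F V₆]
    {n₁ n₂ n₃ n₄ n₅ n₆ : ℕ} {x₁ : Fin n₁ → V₁} {x₂ : Fin n₂ → V₂} {x₃ : Fin n₃ → V₃}
    {x₄ : Fin n₄ → V₄} {x₅ : Fin n₅ → V₅} {x₆ : Fin n₆ → V₆}
    {φ₁ : Fin n₁ → V₁ →ₗ[F] F} {φ₂ : Fin n₂ → V₂ →ₗ[F] F} {φ₃ : Fin n₃ → V₃ →ₗ[F] F}
    {φ₄ : Fin n₄ → V₄ →ₗ[F] F} {φ₅ : Fin n₅ → V₅ →ₗ[F] F} {φ₆ : Fin n₆ → V₆ →ₗ[F] F}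
    (h₁ : ∀ v, v = ∑ i, φ₁ i v • x₁ i) (h₂ : ∀ v, v = ∑ i, φ₂ i v • x₂ i)
    (h₃ : ∀ v, v = ∑ i, φ₃ i v • x₃ i) (h₄ : ∀ v, v = ∑ i, φ₄ i v • x₄ i)
    (h₅ : ∀ v, v = ∑ i, φ₅ i v • x₅ i) (h₆ : ∀ v, v = ∑ i, φ₆ i v • x₆ i)
    {ι ι' : Type*} {S : Finset ι} {S' : Finset ι'} {k : ι → F} {k' : ι' → F}
    {M : ι → A ⊗[F] (B ⊗[F] C) →ₗ[F] V₁ ⊗[F] (V₂ ⊗[F] (V₃ ⊗[F] (V₄ ⊗[F] (V₅ ⊗[F] V₆))))}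
    {M' : ι' → A ⊗[F] (B ⊗[F] C) →ₗ[F] V₁ ⊗[F] (V₂ ⊗[F] (V₃ ⊗[F] (V₄ ⊗[F] (V₅ ⊗[F] V₆))))}
    (h : ∀ a b c i₁ i₂ i₃ i₄ i₅ i₆,
      ∑ i ∈ S, k i * φ₆ i₆ (contract _ (φ₅ i₅) (contract _ (φ₄ i₄) (contract _ (φ₃ i₃)
        (contract _ (φ₂ i₂) (contract _ (φ₁ i₁) (M i (a ⊗ₜ (b ⊗ₜ c)))))))) =
      ∑ i ∈ S', k' i * φ₆ i₆ (contract _ (φ₅ i₅) (contract _ (φ₄ i₄) (contract _ (φ₃ i₃)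
        (contract _ (φ₂ i₂) (contract _ (φ₁ i₁) (M' i (a ⊗ₜ (b ⊗ₜ c))))))))) :
    ∑ i ∈ S, k i • M i = ∑ i ∈ S', k' i • M' i := by
  refine TensorProduct.ext' fun a z => ?_
  induction z with
  | zero => simp
  | add z z' hz hz' => rw [TensorProduct.tmul_add, map_add, map_add, hz, hz']
  | tmul b c =>
    -- Five output factors are removed by contraction. The last one is a vector, expanded by `h₆`,
    -- so that only scalars remain to be compared.
    refine ext_contract h₁ fun i₁ => ext_contract h₂ fun i₂ => ext_contract h₃ fun i₃ =>
      ext_contract h₄ fun i₄ => ext_contract h₅ fun i₅ => ?_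
    rw [h₆ (contract _ _ _)]
    refine .trans (Finset.sum_congr rfl fun i₆ _ => congrArg (· • x₆ i₆) ?_) (h₆ _).symm
    simpa only [LinearMap.sum_apply, LinearMap.smul_apply, map_sum, map_smul, smul_eq_mul]
      using h a b c i₁ i₂ i₃ i₄ i₅ i₆

end Contraction

namespace DualTwoCategory

/-! ### Equality of the two closed chains. -/

section Traces

open CategoryTheory Bicategory

variable {C : DualTwoCategory.{u, v, w}} {F : Type*} [Field F] [Additive C] [VectLinear F C]
variable {e01 e02 e03 e04 e05 e12 e13 e14 e15 e23 e24 e25 e34 e35 e45 : C.Obj}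
  {f012 : e02 ⟶ e12 ⊠ e01} {f013 : e03 ⟶ e13 ⊠ e01} {f014 : e04 ⟶ e14 ⊠ e01}
  {f015 : e05 ⟶ e15 ⊠ e01} {f023 : e03 ⟶ e23 ⊠ e02}
  {f025 : e05 ⟶ e25 ⊠ e02} {f034 : e04 ⟶ e34 ⊠ e03} {f035 : e05 ⟶ e35 ⊠ e03}
  {f045 : e05 ⟶ e45 ⊠ e04} {f123 : e13 ⟶ e23 ⊠ e12} {f124 : e14 ⟶ e24 ⊠ e12}
  {f125 : e15 ⟶ e25 ⊠ e12} {f134 : e14 ⟶ e34 ⊠ e13}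
  {f145 : e15 ⟶ e45 ⊠ e14} {f234 : e24 ⟶ e34 ⊠ e23} {f235 : e25 ⟶ e35 ⊠ e23}
  {f245 : e25 ⟶ e45 ⊠ e24} {f345 : e35 ⟶ e45 ⊠ e34}

theorem trace_left_eq_trace_right
    (a : H₂ f034 f035 f045 f345) (b : H₂ f023 f025 f035 f235) (c : H₂ f012 f015 f025 f125)
    (p : H₂' f234 f235 f245 f345) (q : H₂' f124 f125 f145 f245) (r : H₂' f014 f015 f045 f145)
    (s : H₂' f123 f124 f134 f234) (t : H₂' f013 f014 f034 f134) (u : H₂' f012 f013 f023 f123) :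
    traceₗ F (f015 ≫ rLetter f145 e01 ≫ lTens e45 (rLetter f134 e01) ≫
      lTens e45 (lTens e34 (rLetter f123 e01)))
      (leftHead a r t ≫ head₃ (leftCell f015 b c u) (rLetter f345 (e23 ⊠ e12 ⊠ e01)) ≫
        leftTail f015 p q s) =
    traceₗ F (f045 ≫ lTens e45 f034 ≫ lTens e45 (lTens e34 f023) ≫
      lTens e45 (lTens e34 (lTens e23 f012)))
      (head₃ (rightCell a b p) (lTens e45 (lTens e34 (lTens e23 f012))) ≫
        rightTail c q r s t u) := by
  -- The hypotheses of `trace_word_eq` are naturality of the tensorator with f012 at p, and with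
  -- f345 at u. Accordingly p occurs tensored with e02 on one side and with e12 ⊗ e01 on the other,
  -- and u with e45 ⊗ e34 on one side and e35 on the other.
  have h := trace_word_eq (fun f => traceₗ F f) trace_comm (word a) (word b) (word c)
    (rCell' (word' p) e02) (rCell' (word' p) (e12 ⊠ e01)) (rCell' (word' q) e01) (word' r)
    (lCell e45 (rCell' (word' s) e01)) (lCell e45 (word' t)) (lCell e45 (lCell e34 (word' u)))
    (lCell e35 (word' u)) (tauCell f345 f023) (tauCell f345 (lTens e23 f012))
    (tauCell f235 f012) (lCell e45 (tauCell f234 f012)) (tauCell f245 f012)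
    (tauCell f345 f013) (tauCell f345 (rLetter f123 e01))
    (rCell'_tauCell (word' p) f012) (tauCell_natural f345 (word' u))
  refine .trans (congrArg (traceₗ F _) ?_) (h.trans (congrArg (traceₗ F _) ?_))
  · simp only [leftHead, leftTail, leftCell, glueWord, Category.assoc]
  · simp only [rightCell, rightTail, glueWord, Category.assoc]

end Traces

end DualTwoCategory

namespace DualTwoCategory

/-! ### The identity of partition functions. -/

section Exchange

open CategoryTheory Bicategory
open scoped TensorProduct

variable {C : DualTwoCategory.{u, v, w}} {F : Type*} [Field F] [Additive C] [VectLinear F C]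
  [NonDegenerate F C]

/-- The invariance under the exchange of three 4-simplices for any labels in a boundary. -/
theorem sum_Zpos_comp_eq {e01 e02 e03 e04 e05 e12 e13 e14 e15 e23 e24 e25 e34 e35 e45 : C.Obj}
    (f012 : C.Hom e02 (e12 ⊠ e01)) (f013 : C.Hom e03 (e13 ⊠ e01)) (f014 : C.Hom e04 (e14 ⊠ e01))
    (f015 : C.Hom e05 (e15 ⊠ e01)) (f023 : C.Hom e03 (e23 ⊠ e02)) (f025 : C.Hom e05 (e25 ⊠ e02))
    (f034 : C.Hom e04 (e34 ⊠ e03)) (f035 : C.Hom e05 (e35 ⊠ e03)) (f045 : C.Hom e05 (e45 ⊠ e04))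
    (f123 : C.Hom e13 (e23 ⊠ e12)) (f124 : C.Hom e14 (e24 ⊠ e12)) (f125 : C.Hom e15 (e25 ⊠ e12))
    (f134 : C.Hom e14 (e34 ⊠ e13)) (f145 : C.Hom e15 (e45 ⊠ e14)) (f234 : C.Hom e24 (e34 ⊠ e23))
    (f235 : C.Hom e25 (e35 ⊠ e23)) (f245 : C.Hom e25 (e45 ⊠ e24)) (f345 : C.Hom e35 (e45 ⊠ e34))
    {𝓑 : Finset (C.Hom e15 (e35 ⊠ e13))} (h𝓑 : IsBasis F 𝓑)
    {𝓑' : Finset (C.Hom e04 (e24 ⊠ e02))} (h𝓑' : IsBasis F 𝓑') :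
    let H0123 := H₂ f012 f013 f023 f123
    let H0125 := H₂ f012 f015 f025 f125
    let H0134 := H₂ f013 f014 f034 f134
    let H0145 := H₂ f014 f015 f045 f145
    let H0235 := H₂ f023 f025 f035 f235
    let H0345 := H₂ f034 f035 f045 f345
    let H1234 := H₂ f123 f124 f134 f234
    let H1245 := H₂ f124 f125 f145 f245
    let H2345 := H₂ f234 f235 f245 f345
    (∑ f135 ∈ 𝓑,
      let H0135 := H₂ f013 f015 f035 f135
      let H1235 := H₂ f123 f125 f135 f235
      let H1345 := H₂ f134 f135 f145 f345
      let Z01235 := Zpos F f012 f013 f015 f023 f025 f035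
        f123 f125 f135 f235
      let Z01345 := Zpos F f013 f014 f015 f034 f035 f045
        f134 f135 f145 f345
      let Z12345 := Zpos F f123 f124 f125 f134 f135 f145
        f234 f235 f245 f345
      qdim F f135 •
        (((swapHead H1234 H0145 (H0134 ⊗[F] H0123)).lTensor H1245).lTensor H2345 ∘ₗ
        tensorRight (H0145 ⊗[F] (H0134 ⊗[F] H0123)) Z12345 ∘ₗ
        swapHead H1235 H1345 (H0145 ⊗[F] (H0134 ⊗[F] H0123)) ∘ₗ
        (tensorRight H0123 Z01345).lTensor H1235 ∘ₗ
        swapHead H0345 H1235 (H0135 ⊗[F] H0123) ∘ₗ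
        Z01235.lTensor H0345 :
        H0345 ⊗[F] (H0235 ⊗[F] H0125) →ₗ[F]
          H2345 ⊗[F] (H1245 ⊗[F] (H0145 ⊗[F] (H1234 ⊗[F] (H0134 ⊗[F] H0123)))))) =
    ∑ f024 ∈ 𝓑',
      let H0124 := H₂ f012 f014 f024 f124
      let H0234 := H₂ f023 f024 f034 f234
      let H0245 := H₂ f024 f025 f045 f245
      let Z02345 := Zpos F f023 f024 f025 f034 f035 f045
        f234 f235 f245 f345
      let Z01245 := Zpos F f012 f014 f015 f024 f025 f045
        f124 f125 f145 f245
      let Z01234 := Zpos F f012 f013 f014 f023 f024 f034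
        f123 f124 f134 f234
      qdim F f024 •
        (((Z01234.lTensor H0145).lTensor H1245).lTensor H2345 ∘ₗ
        (((swapLast H0124 H0234).lTensor H0145).lTensor H1245).lTensor H2345 ∘ₗ
        (tensorRight H0234 Z01245).lTensor H2345 ∘ₗ
        ((swapLast H0234 H0125).lTensor H0245).lTensor H2345 ∘ₗ
        tensorRight H0125 Z02345 :
        H0345 ⊗[F] (H0235 ⊗[F] H0125) →ₗ[F]
          H2345 ⊗[F] (H1245 ⊗[F] (H0145 ⊗[F] (H1234 ⊗[F] (H0134 ⊗[F] H0123))))) := by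
  intro H0123 H0125 H0134 H0145 H0235 H0345 H1234 H1245 H2345
  -- The dual families of the six output spaces supply the test elements p, q, r, s, t and u.
  obtain ⟨_, _, y₁, h₁, _⟩ := exists_dual_families (F := F)
    (leftPath f234 f245) (rightPath f235 f345)
  obtain ⟨_, _, y₂, h₂, _⟩ := exists_dual_families (F := F)
    (leftPath f124 f145) (rightPath f125 f245)
  obtain ⟨_, _, y₃, h₃, _⟩ := exists_dual_families (F := F)
    (leftPath f014 f045) (rightPath f015 f145)
  obtain ⟨_, _, y₄, h₄, _⟩ := exists_dual_families (F := F)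
    (leftPath f123 f134) (rightPath f124 f234)
  obtain ⟨_, _, y₅, h₅, _⟩ := exists_dual_families (F := F)
    (leftPath f013 f034) (rightPath f014 f134)
  obtain ⟨_, _, y₆, h₆, _⟩ := exists_dual_families (F := F)
    (leftPath f012 f023) (rightPath f013 f123)
  refine LinearMap.sum_smul_eq_of_contract
    (φ₁ := fun i => (pairing F _ _).flip (y₁ i)) (φ₂ := fun i => (pairing F _ _).flip (y₂ i))
    (φ₃ := fun i => (pairing F _ _).flip (y₃ i)) (φ₄ := fun i => (pairing F _ _).flip (y₄ i))
    (φ₅ := fun i => (pairing F _ _).flip (y₅ i)) (φ₆ := fun i => (pairing F _ _).flip (y₆ i))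
    h₁ h₂ h₃ h₄ h₅ h₆ fun a b c i₁ i₂ i₃ i₄ i₅ i₆ => ?_
  -- Each contracted sum equals one trace free of its interior label, and these two traces coincide.
  have h := (contract_sum_left h𝓑 a b c (y₁ i₁) (y₂ i₂) (y₃ i₃) (y₄ i₄) (y₅ i₅) (y₆ i₆)).trans
    ((trace_left_eq_trace_right a b c (y₁ i₁) (y₂ i₂) (y₃ i₃) (y₄ i₄) (y₅ i₅) (y₆ i₆)).trans
      (contract_sum_right h𝓑' a b c (y₁ i₁) (y₂ i₂) (y₃ i₃) (y₄ i₄) (y₅ i₅) (y₆ i₆)).symm)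
  set_option maxRecDepth 20000 in exact h

end Exchange

end DualTwoCategory

open scoped TensorProduct in
open DualTwoCategory in
theorem lemma5p1 {F : Type*} [Field F] [CharZero F]
    (C : DualTwoCategory.{u, v, w})
    (P : PivotalStructure C) (hP : P.IsConsistent) (S : SphericalStructure C)
    [Additive C] [VectLinear F C] [NonDegenerate F C]
    (𝓔 : Finset C.Obj) (h𝓔 : IsFinitelySemisimple F 𝓔)
    (𝓕 : ∀ A B : C.Obj, Finset (C.Hom A B)) (h𝓕 : ∀ A B, IsBasis F (𝓕 A B))
    -- the labels of the edges and of the triangles of the simplex with vertices 0, ..., 5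
    (e : Fin 6 → Fin 6 → C.Obj) (he : ∀ i j, i < j → e i j ∈ 𝓔)
    (f : ∀ i j k : Fin 6, C.Hom (e i k) (C.tensor (e j k) (e i j)))
    (hf : ∀ i j k, i < j → j < k → (i, j, k) ≠ (1, 3, 5) → (i, j, k) ≠ (0, 2, 4) →
      f i j k ∈ 𝓕 (e i k) (C.tensor (e j k) (e i j))) :
    let H0123 := H₂ (f 0 1 2) (f 0 1 3) (f 0 2 3) (f 1 2 3)
    let H0125 := H₂ (f 0 1 2) (f 0 1 5) (f 0 2 5) (f 1 2 5)
    let H0134 := H₂ (f 0 1 3) (f 0 1 4) (f 0 3 4) (f 1 3 4)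
    let H0145 := H₂ (f 0 1 4) (f 0 1 5) (f 0 4 5) (f 1 4 5)
    let H0235 := H₂ (f 0 2 3) (f 0 2 5) (f 0 3 5) (f 2 3 5)
    let H0345 := H₂ (f 0 3 4) (f 0 3 5) (f 0 4 5) (f 3 4 5)
    let H1234 := H₂ (f 1 2 3) (f 1 2 4) (f 1 3 4) (f 2 3 4)
    let H1245 := H₂ (f 1 2 4) (f 1 2 5) (f 1 4 5) (f 2 4 5)
    let H2345 := H₂ (f 2 3 4) (f 2 3 5) (f 2 4 5) (f 3 4 5)
    (∑ f135 ∈ 𝓕 (e 1 5) (C.tensor (e 3 5) (e 1 3)),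
      let H0135 := H₂ (f 0 1 3) (f 0 1 5) (f 0 3 5) f135
      let H1235 := H₂ (f 1 2 3) (f 1 2 5) f135 (f 2 3 5)
      let H1345 := H₂ (f 1 3 4) f135 (f 1 4 5) (f 3 4 5)
      let Z01235 := Zpos F (f 0 1 2) (f 0 1 3) (f 0 1 5) (f 0 2 3) (f 0 2 5) (f 0 3 5)
        (f 1 2 3) (f 1 2 5) f135 (f 2 3 5)
      let Z01345 := Zpos F (f 0 1 3) (f 0 1 4) (f 0 1 5) (f 0 3 4) (f 0 3 5) (f 0 4 5)
        (f 1 3 4) f135 (f 1 4 5) (f 3 4 5)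
      let Z12345 := Zpos F (f 1 2 3) (f 1 2 4) (f 1 2 5) (f 1 3 4) f135 (f 1 4 5)
        (f 2 3 4) (f 2 3 5) (f 2 4 5) (f 3 4 5)
      -- the maps are applied from the bottom to the top
      qdim F f135 •
        (((swapHead H1234 H0145 (H0134 ⊗[F] H0123)).lTensor H1245).lTensor H2345 ∘ₗ
        tensorRight (H0145 ⊗[F] (H0134 ⊗[F] H0123)) Z12345 ∘ₗ
        swapHead H1235 H1345 (H0145 ⊗[F] (H0134 ⊗[F] H0123)) ∘ₗ
        (tensorRight H0123 Z01345).lTensor H1235 ∘ₗ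
        swapHead H0345 H1235 (H0135 ⊗[F] H0123) ∘ₗ
        Z01235.lTensor H0345 :
        H0345 ⊗[F] (H0235 ⊗[F] H0125) →ₗ[F]
          H2345 ⊗[F] (H1245 ⊗[F] (H0145 ⊗[F] (H1234 ⊗[F] (H0134 ⊗[F] H0123)))))) =
    ∑ f024 ∈ 𝓕 (e 0 4) (C.tensor (e 2 4) (e 0 2)),
      let H0124 := H₂ (f 0 1 2) (f 0 1 4) f024 (f 1 2 4)
      let H0234 := H₂ (f 0 2 3) f024 (f 0 3 4) (f 2 3 4)
      let H0245 := H₂ f024 (f 0 2 5) (f 0 4 5) (f 2 4 5)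
      let Z02345 := Zpos F (f 0 2 3) f024 (f 0 2 5) (f 0 3 4) (f 0 3 5) (f 0 4 5)
        (f 2 3 4) (f 2 3 5) (f 2 4 5) (f 3 4 5)
      let Z01245 := Zpos F (f 0 1 2) (f 0 1 4) (f 0 1 5) f024 (f 0 2 5) (f 0 4 5)
        (f 1 2 4) (f 1 2 5) (f 1 4 5) (f 2 4 5)
      let Z01234 := Zpos F (f 0 1 2) (f 0 1 3) (f 0 1 4) (f 0 2 3) f024 (f 0 3 4)
        (f 1 2 3) (f 1 2 4) (f 1 3 4) (f 2 3 4)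
      qdim F f024 •
        (((Z01234.lTensor H0145).lTensor H1245).lTensor H2345 ∘ₗ
        (((swapLast H0124 H0234).lTensor H0145).lTensor H1245).lTensor H2345 ∘ₗ
        (tensorRight H0234 Z01245).lTensor H2345 ∘ₗ
        ((swapLast H0234 H0125).lTensor H0245).lTensor H2345 ∘ₗ
        tensorRight H0125 Z02345 :
        H0345 ⊗[F] (H0235 ⊗[F] H0125) →ₗ[F]
          H2345 ⊗[F] (H1245 ⊗[F] (H0145 ⊗[F] (H1234 ⊗[F] (H0134 ⊗[F] H0123))))) := by
  exact sum_Zpos_comp_eq (f 0 1 2) (f 0 1 3) (f 0 1 4) (f 0 1 5) (f 0 2 3) (f 0 2 5) (f 0 3 4)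
    (f 0 3 5) (f 0 4 5) (f 1 2 3) (f 1 2 4) (f 1 2 5) (f 1 3 4) (f 1 4 5) (f 2 3 4) (f 2 3 5)
    (f 2 4 5) (f 3 4 5) (h𝓕 _ _) (h𝓕 _ _)
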